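/- **Setting.** Let $\Bbbk$ be a commutative ring of characteristic $\neq 2$. Let $F=\bigoplus_{(a,\varepsilon)\in\mathbb N\times\mathbb Z_2}F_{a,\varepsilon}$ be an $\mathbb N$-graded Frobenius $\Bbbk$-superalgebra, free over $\Bbbk$, with finite homogeneous basis $B$ and top degree $\delta$. So $F$ has a linear trace map $\mathrm{tr}\colon F\to\Bbbk$ that is parity-preserving and homogeneous of degree $-\delta$, and $f\mapsto\bigl(g\mapsto(-1)^{\bar f\bar g}\mathrm{tr}(gf)\bigr)$ is an isomorphism $F\to\mathrm{Hom}_\Bbbk(F,\Bbbk)$. Let $\psi$ be the Nakayama automorphism, $\mathrm{tr}(fg)=(-1)^{\bar f\bar g}\mathrm{tr}(g\psi(f))$, and let $\{b^\vee\}_{b\in B}$ be the left dual basis, $\mathrm{tr}(b^\vee c)=\delta_{b,c}$. Assume that $\psi$ has finite order $\theta$, that the characteristic of $\Bbbk$ does not divide $\theta$, and that $F$ has a basis of eigenvectors of $\psi$. **Affine wreath product algebra.** For $n\ge 0$ let $\mathcal A_n(F)$ be the free product of $\Bbbk$-algebras $\Bbbk[x_1,\dots,x_n]\star F^{\otimes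 n}\star\Bbbk S_n$ (with $F^{\otimes n}$ the tensor power of superalgebras) modulo the relations $$\mathbf f x_i=x_i\psi_i(\mathbf f),\qquad s_ix_j=x_js_i\ (j\ne i,i+1),\qquad s_ix_i=x_{i+1}s_i-\sum_{b\in B}b_i\,b^\vee_{i+1},\qquad \pi\mathbf f={}^{\pi}\mathbf f\,\pi ,$$ for $\mathbf f\in F^{\otimes n}$, $\pi\in S_n$. Here $f_i$ is $f$ placed in the $i$-th tensor factor, $\psi_i$ is $\psi$ applied to the $i$-th factor, and $S_n$ acts by superpermutations. The algebra is graded by $|x_i|=\delta$, $|f_i|=|f|$, $|\pi|=0$, with $x_i$ and $\pi$ even and $\bar f_i=\bar f$; $\mathcal A_0(F)=\Bbbk$. **Cyclotomic quotient.** For $k\ge1$ let $$F_\psi^{(k)}=\{f\in F\mid \psi(f)=f,\ gf=(-1)^{\bar f\bar g}f\psi^k(g)\text{ for all }g\in F\}$$ (signs extended by linearity). For $1\le k\le\theta$ let $e_k\in\mathbb N$ and let $c^{(k,1)},\dots,c^{(k,e_k)}\in F_\psi^{(k)}$ be even of degree $k\delta$. Put $d=\sum_{k=1}^\theta k e_k$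 and assume $d>0$. For $n\ge 1$ let $\mathcal A_n^{\mathbf C}(F)$ be the quotient of $\mathcal A_n(F)$ by the two-sided ideal generated by $\prod_{k=1}^{\theta}\prod_{j=1}^{e_k}\bigl(x_1^k-(c^{(k,j)})_1\bigr)$, and let $\mathcal A_0^{\mathbf C}(F)=\Bbbk$. **Theorem.** Let $n\ge0$. The natural homomorphism $\mathcal A_n^{\mathbf C}(F)\to\mathcal A_{n+1}^{\mathbf C}(F)$ ($x_i\mapsto x_i$, $f_i\mapsto f_i$, $\pi\mapsto\pi$) is injective; regard $\mathcal A_n^{\mathbf C}(F)$ as a subalgebra. With $F_{n+1}=\{f_{n+1}\mid f\in F\}$ there is a direct sum decomposition $$\mathcal A_{n+1}^{\mathbf C}(F)=x_{n+1}^{d-1}F_{n+1}\mathcal A_n^{\mathbf C}(F)\ \oplus\ \bigoplus_{a=0}^{d-2}x_{n+1}^{a}F_{n+1}\mathcal A_n^{\mathbf C}(F)\ \oplus\ \mathcal A_n^{\mathbf C}(F)s_n\mathcal A_n^{\mathbf C}(F)$$ (the last summand being $0$ if $n=0$). There is a unique $\Bbbk$-linear map $\mathrm{tr}^{\mathbf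 C}_{n+1}\colon\mathcal A_{n+1}^{\mathbf C}(F)\to\mathcal A_n^{\mathbf C}(F)$ that is the projection onto the first summand followed by $x_{n+1}^{d-1}f_{n+1}y\mapsto\mathrm{tr}(f)\,y$ ($f\in F$, $y\in\mathcal A_n^{\mathbf C}(F)$). With this trace map, $\mathcal A_{n+1}^{\mathbf C}(F)$ is a graded Frobenius extension of $\mathcal A_n^{\mathbf C}(F)$: $\mathrm{tr}^{\mathbf C}_{n+1}$ is a parity-preserving homomorphism of $(\mathcal A_n^{\mathbf C}(F),\mathcal A_n^{\mathbf C}(F))$-bimodules, homogeneous of degree $-d\delta$, and there are finite families $(u_i)_i,(v_i)_i$ of homogeneous elements of $\mathcal A_{n+1}^{\mathbf C}(F)$, with $|u_i|+|v_i|=d\delta$ and $\bar u_i=\bar v_i$, such that $$a=\sum_i u_i\,\mathrm{tr}^{\mathbf C}_{n+1}(v_i a)=\sum_i \mathrm{tr}^{\mathbf C}_{n+1}(a u_i)\,v_i\qquad\text{for all }a\in\mathcal A_{n+1}^{\mathbf C}(F).$$ -/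

import Mathlib

namespace AffineWreath

/-- The Koszul sign `(-1)^(ε η)` for homogeneous elements of (degree, parity) `p = (a, ε)` and
`q = (b, η)`. -/
def koszul (p q : ℕ × ZMod 2) : ℤ := (-1) ^ (p.2.val * q.2.val)

/-- An `ℕ`-graded Frobenius superalgebra `F` over `k`, free as a `k`-module, together with a chosen
homogeneous basis.  The index `(a, ε) : ℕ × ZMod 2` of the grading records degree and parity. -/
structure FrobeniusSuperalgebra (k F : Type*) [CommRing k] [Ring F] [Algebra k F] where
  /-- The homogeneous pieces. -/
  grade : ℕ × ZMod 2 → Submodule k F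
  /-- They make `F` a graded superalgebra. -/
  graded : GradedAlgebra grade
  /-- The trace map. -/
  tr : F →ₗ[k] k
  /-- The top degree of `F`. -/
  δ : ℕ
  isGreatest : IsGreatest {a : ℕ | ∃ ε, grade (a, ε) ≠ ⊥} δ
  /-- The trace map is parity-preserving and homogeneous of degree `-δ`. -/
  tr_eq_zero : ∀ p, p ≠ (δ, 0) → ∀ f ∈ grade p, tr f = 0
  /-- The linear map given on homogeneous elements by `f ↦ (g ↦ (-1)^(f̄ ḡ) tr (g f))` is an
  isomorphism from `F` onto its dual. -/
  nondegenerate : ∃ Φ : F ≃ₗ[k] Module.Dual k F, ∀ p q, ∀ f ∈ grade p, ∀ g ∈ grade q,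
    Φ f g = koszul p q • tr (g * f)
  /-- The rank of `F` as a `k`-module. -/
  rank : ℕ
  /-- A `k`-basis `B` of `F`. -/
  basis : Module.Basis (Fin rank) k F
  basis_homogeneous : ∀ b, ∃ p, basis b ∈ grade p

attribute [instance] FrobeniusSuperalgebra.graded

namespace FrobeniusSuperalgebra

variable {k F : Type*} [CommRing k] [Ring F] [Algebra k F] (D : FrobeniusSuperalgebra k F)

/-- The isomorphism `f ↦ (g ↦ (-1)^(f̄ ḡ) tr (g f))`, extended linearly. -/
noncomputable def toDual : F ≃ₗ[k] Module.Dual k F := D.nondegenerate.choose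

theorem toDual_apply {p q : ℕ × ZMod 2} {f g : F} (hf : f ∈ D.grade p) (hg : g ∈ D.grade q) :
    D.toDual f g = koszul p q • D.tr (g * f) :=
  D.nondegenerate.choose_spec p q f hf g hg

theorem tr_mul_eq_zero {p q : ℕ × ZMod 2} {f g : F} (hf : f ∈ D.grade p) (hg : g ∈ D.grade q)
    (hpq : p.2 ≠ q.2) : D.tr (f * g) = 0 := by
  refine D.tr_eq_zero (p + q) ?_ _ (SetLike.mul_mem_graded hf hg)
  intro h
  apply hpq
  have h2 : p.2 + q.2 = 0 := congrArg Prod.snd h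
  have h3 : ∀ a b : ZMod 2, a + b = 0 → a = b := by decide
  exact h3 _ _ h2

theorem toDual_apply_left {p : ℕ × ZMod 2} {f : F} (hf : f ∈ D.grade p) (g : F) :
    D.toDual f g = koszul p p • D.tr (g * f) := by
  induction g using DirectSum.Decomposition.inductionOn D.grade with
  | zero => simp
  | @homogeneous q m =>
    rw [D.toDual_apply hf m.2]
    by_cases h : q.2 = p.2
    · simp only [koszul, h]
    · rw [D.tr_mul_eq_zero m.2 hf h]; simp
  | add a b ha hb => rw [map_add, ha, hb, add_mul, map_add, smul_add]

theorem toDual_apply_right {q : ℕ × ZMod 2} {g : F} (hg : g ∈ D.grade q) (f : F) :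
    D.toDual f g = koszul q q • D.tr (g * f) := by
  induction f using DirectSum.Decomposition.inductionOn D.grade with
  | zero => simp
  | @homogeneous p m =>
    rw [D.toDual_apply m.2 hg]
    by_cases h : q.2 = p.2
    · simp only [koszul, h]
    · rw [D.tr_mul_eq_zero hg m.2 h]; simp
  | add a b ha hb => rw [map_add, LinearMap.add_apply, ha, hb, mul_add, map_add, smul_add]

/-- The Nakayama automorphism `ψ` (as a linear map). -/
noncomputable def nakayama : Module.End k F :=
  D.toDual.symm.toLinearMap ∘ₗ (LinearMap.mul k F).compr₂ D.tr

/-- The defining property of the Nakayama automorphism; it determines `ψ` since the trace map is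
nondegenerate. -/
theorem tr_mul_nakayama {p q : ℕ × ZMod 2} {f g : F} (hf : f ∈ D.grade p) (hg : g ∈ D.grade q) :
    D.tr (f * g) = koszul p q • D.tr (g * D.nakayama f) := by
  have h1 : D.toDual (D.nakayama f) g = D.tr (f * g) := by simp [nakayama]
  have h2 := D.toDual_apply_right hg (D.nakayama f)
  rw [h1] at h2
  by_cases h : p.2 = q.2
  · rw [h2]; simp only [koszul, h]
  · rw [D.tr_mul_eq_zero hf hg h] at h2 ⊢
    have h3 : D.tr (g * D.nakayama f) = 0 := by
      rcases neg_one_pow_eq_or ℤ (q.2.val * q.2.val) with h4 | h4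
      · simpa [koszul, h4] using h2.symm
      · simpa [koszul, h4] using h2.symm
    rw [h3, smul_zero]

/-- The order `θ` of the Nakayama automorphism. -/
noncomputable def θ : ℕ := orderOf D.nakayama

theorem exists_dual (b : Fin D.rank) :
    ∃ v : F, ∀ c : Fin D.rank, D.tr (v * D.basis c) = if b = c then 1 else 0 := by
  classical
  have : Module.Free k F := Module.Free.of_basis D.basis
  have : Module.Finite k F := Module.Finite.of_basis D.basis
  have hp : D.toDual.toLinearMap.IsPerfPair :=
    LinearMap.IsPerfPair.of_bijective _ D.toDual.bijective
  obtain ⟨g, hg⟩ := hp.bijective_right.surjective (D.basis.coord b)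
  obtain ⟨p, hp⟩ := D.basis_homogeneous b
  refine ⟨koszul p p • g, fun c => ?_⟩
  obtain ⟨q, hq⟩ := D.basis_homogeneous c
  have h1 : D.toDual (D.basis c) g = D.basis.coord b (D.basis c) := by
    rw [← hg]; rfl
  rw [D.toDual_apply_left hq, Module.Basis.coord_apply, Module.Basis.repr_self,
    Finsupp.single_apply] at h1
  rw [smul_mul_assoc, map_zsmul]
  by_cases h : b = c
  · subst h
    rw [if_pos rfl] at h1 ⊢
    have h2 : koszul p p = koszul q q := by
      by_cases hpq : p.2 = q.2
      · simp only [koszul, hpq]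
      · have h3 : p ≠ q := fun h => hpq (by rw [h])
        have h4 : D.basis b = 0 := by
          have h5 := DirectSum.decompose_of_mem_ne D.grade hp h3
          rw [← h5, DirectSum.decompose_of_mem_same D.grade hq]
        rw [h4] at h1
        simp only [mul_zero, map_zero, smul_zero] at h1
        have h6 : Subsingleton k := subsingleton_of_zero_eq_one h1
        have := Module.subsingleton k F
        obtain ⟨ε, hε⟩ := D.isGreatest.1
        exact absurd (Subsingleton.elim _ _) hε
    rw [h2, h1]
  · rw [if_neg (Ne.symm h)] at h1
    rw [if_neg h]
    have h3 : D.tr (g * D.basis c) = 0 := by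
      rcases neg_one_pow_eq_or ℤ (q.2.val * q.2.val) with h4 | h4
      · simpa [koszul, h4] using h1
      · simpa [koszul, h4] using h1
    rw [h3, smul_zero]

/-- The left dual basis `B^∨`, characterised by `tr (b^∨ c) = δ_{b,c}`. -/
noncomputable def dualBasis (b : Fin D.rank) : F := (D.exists_dual b).choose

theorem tr_dualBasis_mul (b c : Fin D.rank) :
    D.tr (D.dualBasis b * D.basis c) = if b = c then 1 else 0 :=
  (D.exists_dual b).choose_spec c

/-- `F^{(m)} = {f | g f = (-1)^(f̄ ḡ) f ψ^m(g) for all g}`.  For a general element `f` the condition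
is extended by linearity, i.e. it is imposed on every homogeneous component of `f`. -/
def twistedCenter (m : ℕ) : Set F :=
  {f | ∀ p q, ∀ g ∈ D.grade q,
    g * (DirectSum.decompose D.grade f p : F) =
      koszul p q • ((DirectSum.decompose D.grade f p : F) * (D.nakayama ^ m) g)}

/-- `F_ψ^{(m)} = F^{(m)} ∩ F_ψ`, where `F_ψ` is the set of fixed points of `ψ`. -/
def fixedTwistedCenter (m : ℕ) : Set F := D.twistedCenter m ∩ {f | D.nakayama f = f}

end FrobeniusSuperalgebra

/-- Generators of the affine wreath product algebra: `x_i`, the elements `f_i` for `f ∈ F`, and the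
permutations. Positions are numbered `0, …, n - 1`. -/
inductive Gen (F : Type*) (n : ℕ) : Type _
  | x (i : Fin n) : Gen F n
  | f (i : Fin n) (a : F) : Gen F n
  | perm (π : Equiv.Perm (Fin n)) : Gen F n

section Affine

variable {k F : Type*} [CommRing k] [Ring F] [Algebra k F] (D : FrobeniusSuperalgebra k F)

open FreeAlgebra in
/-- The defining relations of `𝒜_n(F)`. The first relation presents `k[x_1, …, x_n]`; the next four
present the tensor power `F^{⊗ n}` of superalgebras, generated by `n` copies of `F` that
supercommute with each other; the next two present the group algebra of `S_n`.  The relations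
between these three algebras follow, the relations with `F^{⊗ n}` being imposed on its
generators `f_i`: note `ψ_i(f_i) = ψ(f)_i`, `ψ_i(f_j) = f_j` for `j ≠ i`, and that the
superpermutation action satisfies `π • f_i = f_{π(i)}`. -/
inductive Rel (n : ℕ) : FreeAlgebra k (Gen F n) → FreeAlgebra k (Gen F n) → Prop
  | x_comm (i j : Fin n) :
      Rel n (ι k (.x i) * ι k (.x j)) (ι k (.x j) * ι k (.x i))
  | f_add (i : Fin n) (a b : F) :
      Rel n (ι k (.f i (a + b))) (ι k (.f i a) + ι k (.f i b))
  | f_mul (i : Fin n) (a b : F) :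
      Rel n (ι k (.f i (a * b))) (ι k (.f i a) * ι k (.f i b))
  | f_algebraMap (i : Fin n) (r : k) :
      Rel n (ι k (.f i (algebraMap k F r))) (algebraMap k _ r)
  | f_supercomm (i j : Fin n) (hij : i ≠ j) (p q : ℕ × ZMod 2) (a b : F)
      (ha : a ∈ D.grade p) (hb : b ∈ D.grade q) :
      Rel n (ι k (.f i a) * ι k (.f j b)) (koszul p q • (ι k (.f j b) * ι k (.f i a)))
  | perm_one : Rel n (ι k (.perm 1)) 1
  | perm_mul (π σ : Equiv.Perm (Fin n)) :
      Rel n (ι k (.perm (π * σ))) (ι k (.perm π) * ι k (.perm σ))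
  | f_x_same (i : Fin n) (a : F) :
      Rel n (ι k (.f i a) * ι k (.x i)) (ι k (.x i) * ι k (.f i (D.nakayama a)))
  | f_x_ne (i j : Fin n) (hij : j ≠ i) (a : F) :
      Rel n (ι k (.f j a) * ι k (.x i)) (ι k (.x i) * ι k (.f j a))
  | s_x_ne (i i' j : Fin n) (hi : i'.val = i.val + 1) (hj : j ≠ i) (hj' : j ≠ i') :
      Rel n (ι k (.perm (Equiv.swap i i')) * ι k (.x j))
        (ι k (.x j) * ι k (.perm (Equiv.swap i i')))
  | s_x (i i' : Fin n) (hi : i'.val = i.val + 1) :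
      Rel n (ι k (.perm (Equiv.swap i i')) * ι k (.x i))
        (ι k (.x i') * ι k (.perm (Equiv.swap i i')) -
          ∑ b, ι k (.f i (D.basis b)) * ι k (.f i' (D.dualBasis b)))
  | perm_f (π : Equiv.Perm (Fin n)) (i : Fin n) (a : F) :
      Rel n (ι k (.perm π) * ι k (.f i a)) (ι k (.f (π i) a) * ι k (.perm π))

/-- The affine wreath product algebra `𝒜_n(F)`. For `n = 0` it is `k`. -/
abbrev Affine (n : ℕ) : Type _ := RingQuot (Rel D n)

namespace Affine

/-- The image of a generator in `𝒜_n(F)`. -/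
def gen {n : ℕ} (g : Gen F n) : Affine D n := RingQuot.mkAlgHom k (Rel D n) (FreeAlgebra.ι k g)

/-- Extension of a permutation of the first `n` positions by fixing the last position. -/
noncomputable def extendPerm {n : ℕ} : Equiv.Perm (Fin n) →* Equiv.Perm (Fin (n + 1)) :=
  Equiv.Perm.viaEmbeddingHom Fin.castSuccEmb

theorem extendPerm_castSucc {n : ℕ} (π : Equiv.Perm (Fin n)) (i : Fin n) :
    extendPerm π i.castSucc = (π i).castSucc :=
  Equiv.Perm.viaEmbedding_apply π Fin.castSuccEmb i

theorem extendPerm_last {n : ℕ} (π : Equiv.Perm (Fin n)) :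
    extendPerm π (Fin.last n) = Fin.last n := by
  refine Equiv.Perm.viaEmbedding_apply_of_notMem π Fin.castSuccEmb _ ?_
  rintro ⟨i, hi⟩
  exact (Fin.castSucc_lt_last i).ne hi

theorem extendPerm_swap {n : ℕ} (i j : Fin n) :
    extendPerm (Equiv.swap i j) = Equiv.swap i.castSucc j.castSucc := by
  ext l
  refine Fin.lastCases ?_ (fun l => ?_) l
  · rw [extendPerm_last, Equiv.swap_apply_of_ne_of_ne (Fin.castSucc_lt_last i).ne'
      (Fin.castSucc_lt_last j).ne']
  · rw [extendPerm_castSucc]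
    simp only [Equiv.swap_apply_def, Fin.castSucc_inj]
    split_ifs <;> rfl

/-- The map on generators underlying `𝒜_n(F) → 𝒜_{n+1}(F)`. -/
noncomputable def inclGen {n : ℕ} : Gen F n → Gen F (n + 1)
  | .x i => .x i.castSucc
  | .f i a => .f i.castSucc a
  | .perm π => .perm (extendPerm π)

theorem mk_eq {n : ℕ} {a b : FreeAlgebra k (Gen F n)} (h : Rel D n a b) :
    RingQuot.mkAlgHom k (Rel D n) a = RingQuot.mkAlgHom k (Rel D n) b :=
  RingQuot.mkAlgHom_rel k h

/-- The natural homomorphism `𝒜_n(F) → 𝒜_{n+1}(F)`. -/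
noncomputable def incl (n : ℕ) : Affine D n →ₐ[k] Affine D (n + 1) :=
  RingQuot.liftAlgHom k ⟨FreeAlgebra.lift k fun g => gen D (inclGen g), by
    intro a b h
    cases h with
    | x_comm i j => simpa [gen, inclGen] using mk_eq D (Rel.x_comm i.castSucc j.castSucc)
    | f_add i a b => simpa [gen, inclGen] using mk_eq D (Rel.f_add i.castSucc a b)
    | f_mul i a b => simpa [gen, inclGen] using mk_eq D (Rel.f_mul i.castSucc a b)
    | f_algebraMap i r =>
      simpa [gen, inclGen] using mk_eq D (Rel.f_algebraMap i.castSucc r)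
    | f_supercomm i j hij p q a b ha hb =>
      simpa [gen, inclGen] using mk_eq D (Rel.f_supercomm i.castSucc j.castSucc
        (fun h => hij (Fin.castSucc_injective _ h)) p q a b ha hb)
    | perm_one => simpa [gen, inclGen] using mk_eq D (Rel.perm_one (n := n + 1))
    | perm_mul π σ =>
      simpa [gen, inclGen] using mk_eq D (Rel.perm_mul (extendPerm π) (extendPerm σ))
    | f_x_same i a => simpa [gen, inclGen] using mk_eq D (Rel.f_x_same i.castSucc a)
    | f_x_ne i j hij a =>
      simpa [gen, inclGen] using mk_eq D (Rel.f_x_ne i.castSucc j.castSucc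
        (fun h => hij (Fin.castSucc_injective _ h)) a)
    | s_x_ne i i' j hi hj hj' =>
      simpa [gen, inclGen, extendPerm_swap] using mk_eq D
        (Rel.s_x_ne i.castSucc i'.castSucc j.castSucc hi
          (fun h => hj (Fin.castSucc_injective _ h)) (fun h => hj' (Fin.castSucc_injective _ h)))
    | s_x i i' hi =>
      simpa [gen, inclGen, extendPerm_swap] using mk_eq D (Rel.s_x i.castSucc i'.castSucc hi)
    | perm_f π i a =>
      simpa [gen, inclGen, extendPerm_castSucc] using mk_eq D
        (Rel.perm_f (extendPerm π) i.castSucc a)⟩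

theorem incl_gen {n : ℕ} (g : Gen F n) : incl D n (gen D g) = gen D (inclGen g) := by
  simp [incl, gen]

end Affine

/-- The parameters of a cyclotomic quotient: numbers `e_m` and elements `c^{(m,j)}` of `F`.  Only the
values for `1 ≤ m ≤ θ` and `1 ≤ j ≤ e_m` are used. -/
structure CycParam (F : Type*) where
  e : ℕ → ℕ
  c : ℕ → ℕ → F

variable (C : CycParam F)

/-- The level `d = ∑_{m=1}^θ m e_m`. -/
noncomputable def level : ℕ := ∑ m ∈ Finset.Icc 1 D.θ, m * C.e m

/-- The element `∏_{m=1}^θ ∏_{j=1}^{e_m} (x_i^m - (c^{(m,j)})_i)` (product in this order); for `i` the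
first position this is `χ_C`. -/
noncomputable def chi {n : ℕ} (i : Fin n) : Affine D n :=
  ((List.range' 1 D.θ).map fun m => ((List.range' 1 (C.e m)).map fun j =>
    Affine.gen D (.x i) ^ m - Affine.gen D (.f i (C.c m j))).prod).prod

theorem incl_chi {n : ℕ} (i : Fin n) : Affine.incl D n (chi D C i) = chi D C i.castSucc := by
  simp [chi, map_list_prod, Function.comp_def, Affine.incl_gen, Affine.inclGen]

/-- The two-sided ideal of `𝒜_n(F)` generated by `χ_C` (zero if `n = 0`). -/
noncomputable def cycIdeal (n : ℕ) : TwoSidedIdeal (Affine D n) :=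
  TwoSidedIdeal.span {z | ∃ i : Fin n, i.val = 0 ∧ z = chi D C i}

/-- The cyclotomic wreath product algebra `𝒜_n^C(F)`. For `n = 0` it is `k`. -/
abbrev Cyc (n : ℕ) : Type _ := (cycIdeal D C n).ringCon.Quotient

namespace Cyc

/-- The image of a generator in `𝒜_n^C(F)`. -/
noncomputable def gen {n : ℕ} (g : Gen F n) : Cyc D C n :=
  (cycIdeal D C n).ringCon.mkₐ k (Affine.gen D g)

/-- The natural homomorphism `𝒜_n^C(F) → 𝒜_{n+1}^C(F)`, mapping `x_i ↦ x_i`, `f_i ↦ f_i`, `π ↦ π`. -/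
noncomputable def incl (n : ℕ) : Cyc D C n →ₐ[k] Cyc D C (n + 1) :=
  RingCon.liftₐ (cycIdeal D C n).ringCon
    (((cycIdeal D C (n + 1)).ringCon.mkₐ k).comp (Affine.incl D n)) (by
      have h1 : cycIdeal D C n ≤
          TwoSidedIdeal.ker (((cycIdeal D C (n + 1)).ringCon.mkₐ k).comp (Affine.incl D n)) := by
        refine TwoSidedIdeal.span_le.2 ?_
        rintro _ ⟨i, hi, rfl⟩
        rw [SetLike.mem_coe, TwoSidedIdeal.mem_ker, AlgHom.comp_apply, incl_chi]
        refine (RingCon.eq _).2 ?_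
        rw [← TwoSidedIdeal.mem_iff]
        exact TwoSidedIdeal.subset_span ⟨i.castSucc, hi, rfl⟩
      exact fun _ _ h => TwoSidedIdeal.ringCon_le_iff.1 h1 h)

theorem incl_gen {n : ℕ} (g : Gen F n) :
    incl D C n (gen D C g) = gen D C (Affine.inclGen g) := by
  rw [gen, gen, ← Affine.incl_gen]
  rfl

/-- Products of homogeneous generators of `𝒜_n^C(F)`, with their (degree, parity), where
`|x_i| = δ`, `|f_i| = |f|`, `|π| = 0` and `x_i`, `π` are even. -/
inductive IsMonomial (n : ℕ) : ℕ × ZMod 2 → Cyc D C n → Prop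
  | one : IsMonomial n 0 1
  | x (i : Fin n) : IsMonomial n (D.δ, 0) (gen D C (.x i))
  | f (i : Fin n) (p : ℕ × ZMod 2) (a : F) (ha : a ∈ D.grade p) :
      IsMonomial n p (gen D C (.f i a))
  | perm (π : Equiv.Perm (Fin n)) : IsMonomial n 0 (gen D C (.perm π))
  | mul (p q : ℕ × ZMod 2) (y z : Cyc D C n) (hy : IsMonomial n p y) (hz : IsMonomial n q z) :
      IsMonomial n (p + q) (y * z)

/-- The homogeneous pieces of the graded superalgebra `𝒜_n^C(F)`. -/
noncomputable def grade (n : ℕ) (p : ℕ × ZMod 2) : Submodule k (Cyc D C n) :=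
  Submodule.span k {z | IsMonomial D C n p z}

/-- The summands of the decomposition of `𝒜_{n+1}^C(F)`: `some a` stands for
`x_{n+1}^a F_{n+1} 𝒜_n^C(F)` with `0 ≤ a < d`, and `none` stands for
`𝒜_n^C(F) s_n 𝒜_n^C(F)` (zero if `n = 0`). -/
noncomputable def summand (n : ℕ) : Option (Fin (level D C)) → Submodule k (Cyc D C (n + 1))
  | some a => Submodule.span k {z | ∃ (f : F) (y : Cyc D C n),
      z = gen D C (.x (Fin.last n)) ^ a.val * gen D C (.f (Fin.last n) f) * incl D C n y}
  | none => Submodule.span k {z | ∃ (i : Fin n) (_ : i.val + 1 = n) (y y' : Cyc D C n),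
      z = incl D C n y * gen D C (.perm (Equiv.swap i.castSucc (Fin.last n))) * incl D C n y'}

/-- `τ` is the projection onto the summand `x_{n+1}^{d-1} F_{n+1} 𝒜_n^C(F)` along the other summands,
followed by the map `x_{n+1}^{d-1} f_{n+1} y ↦ tr(f) y`. -/
structure IsTrace (n : ℕ) (τ : Cyc D C (n + 1) →ₗ[k] Cyc D C n) : Prop where
  top : ∀ (f : F) (y : Cyc D C n),
    τ (gen D C (.x (Fin.last n)) ^ (level D C - 1) * gen D C (.f (Fin.last n) f) * incl D C n y) =
      D.tr f • y
  lower : ∀ a : Fin (level D C), a.val + 1 < level D C → ∀ z ∈ summand D C n (some a), τ z = 0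
  swap : ∀ z ∈ summand D C n none, τ z = 0

end Cyc

end Affine

/-- Let `ι : B → A` be a homomorphism of graded superalgebras over `k`. `A` is a Frobenius extension
of `B` with (even) trace map `τ : A → B` of degree `-m`: `τ` is a homogeneous homomorphism of
`(B, B)`-bimodules for which there are finite dual bases `u_i`, `v_i` of homogeneous elements of `A`,
i.e. `a = ∑ u_i τ(v_i a) = ∑ τ(a u_i) v_i` for all `a`.  (Equivalently, `A` is finitely generated and
projective as a `B`-module and `a ↦ (z ↦ (-1)^(ā z̄) τ(z a))` is an isomorphism from `A` onto
`HOM_B(A, B)`.) -/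
structure IsFrobeniusExtension {k A B : Type*} [CommRing k] [Ring A] [Ring B] [Algebra k A]
    [Algebra k B] (gradeA : ℕ × ZMod 2 → Submodule k A) (gradeB : ℕ × ZMod 2 → Submodule k B)
    (ι : B →ₐ[k] A) (τ : A →ₗ[k] B) (m : ℕ) : Prop where
  map_mul_left : ∀ (b : B) (a : A), τ (ι b * a) = b * τ a
  map_mul_right : ∀ (a : A) (b : B), τ (a * ι b) = τ a * b
  map_grade : ∀ (l : ℕ) (ε : ZMod 2), ∀ a ∈ gradeA (l + m, ε), τ a ∈ gradeB (l, ε)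
  map_grade_low : ∀ (l : ℕ) (ε : ZMod 2), l < m → ∀ a ∈ gradeA (l, ε), τ a = 0
  exists_dual_bases : ∃ (N : ℕ) (p q : Fin N → ℕ × ZMod 2) (u v : Fin N → A),
    (∀ i, u i ∈ gradeA (p i)) ∧ (∀ i, v i ∈ gradeA (q i)) ∧ (∀ i, p i + q i = (m, 0)) ∧
    (∀ a, ∑ i, u i * ι (τ (v i * a)) = a) ∧ (∀ a, ∑ i, ι (τ (a * u i)) * v i = a)

end AffineWreath

open AffineWreath

/-! ### Koszul signs -/

namespace AffineWreath

/-! The proof revolves around the elements `(j, n+1) x_{n+1}^a b_{n+1}` with `a < d` and `b` in the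
basis of `F`. They generate `𝒜_{n+1}^C` as a right module over `𝒜_n^C`, and the trace should read
off the part with `j = n+1`, `a = d - 1`, applying `tr` to the factor in `F`. Two things are at
stake: such a functional must exist at all (which is a freeness statement), and its Gram matrix on
these generators must be invertible.

Existence. The elements `y_i = x_i - ∑_{q<i} (∑ b_q b^∨_i)(i q)` are permuted by `S_N`, at the price
of no longer commuting; commutativity of the `x_i` becomes the relation `Integrable` between pairs
of them. In this form a representation of `𝒜_{n+1}(F)` can be induced from `A = 𝒜_n^C(F)`: it lives
on `n + 1` copies of `F[x] ⊗ A`, one for each coset of `S_n` in `S_{n+1}`, and on the last copy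
`x_{n+1}` is multiplication by the variable (`x_last_inj`). By equivariance the relation need only
be tested on that copy (`dunklRep_integrable`). The cyclotomic ideal is contained in the span of the
products `π χ z` (`mem_chiSpan_of_mem_cycIdeal`). Since `χ(y_q)` vanishes in `A` for `q ≤ n`, the
ideal maps the module into the range of one operator `chiRight`, whose leading term is
multiplication by `x^d`. Division with remainder (`isCompl_filt_chiRight`) makes the vectors of
degree less than `d` a complement of that range. Acting on a cyclic vector, taking the remainder and
reading the coefficient of `x^{d-1}` on the last copy gives the functional (`exists_preTrace`).

Spanning. Moving `s_n` past a power of `x_n` or `x_{n+1}` costs only terms with smaller powers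
(`s_x_pow`, `s_x'_pow`). This yields the decomposition into the stated summands with degrees under
control (`grade_le_fullPart`), then generation by the coset elements (`cosetSpan_eq_top`), and it
shows that `𝒜_n s_n 𝒜_n` is a combination of the coset elements which the functional kills. So the
functional is the required trace, and injectivity of `𝒜_n^C → 𝒜_{n+1}^C` follows at once.

Frobenius property. Multiplication by `x_{n+1}^{d-1-a}` and by a suitably twisted `b^∨` reads off a
coefficient up to a unitriangular error (`apply_preDual_mul_basisElt`). Directness of the sum and a
left dual family (`exists_dual`) follow by back substitution. The dual basis identity on the other
side comes from the fact that a surjective endomorphism of a finitely generated module over a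
commutative ring is injective. -/

theorem koszul_eq_one_or (p q : ℕ × ZMod 2) : koszul p q = 1 ∨ koszul p q = -1 :=
  neg_one_pow_eq_or ℤ _

theorem koszul_mul_self (p q : ℕ × ZMod 2) : koszul p q * koszul p q = 1 := by
  rcases koszul_eq_one_or p q with h | h <;> rw [h] <;> rfl

theorem koszul_symm (p q : ℕ × ZMod 2) : koszul p q = koszul q p := by
  simp only [koszul, mul_comm]

theorem koszul_congr {p q p' q' : ℕ × ZMod 2} (h : p.2 = p'.2) (h' : q.2 = q'.2) :
    koszul p q = koszul p' q' := by
  simp only [koszul, h, h']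

theorem koszul_add_right (p q r : ℕ × ZMod 2) :
    koszul p (q + r) = koszul p q * koszul p r := by
  have : ∀ a b c : ZMod 2, (-1 : ℤ) ^ (a.val * (b + c).val) =
      (-1) ^ (a.val * b.val) * (-1) ^ (a.val * c.val) := by decide
  exact this _ _ _

theorem koszul_add_left (p q r : ℕ × ZMod 2) :
    koszul (p + q) r = koszul p r * koszul q r := by
  rw [koszul_symm, koszul_add_right, koszul_symm p, koszul_symm q]

theorem koszul_even_right (p : ℕ × ZMod 2) {q : ℕ × ZMod 2} (h : q.2 = 0) : koszul p q = 1 := by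
  simp [koszul, h]

theorem koszul_even_left {p : ℕ × ZMod 2} (q : ℕ × ZMod 2) (h : p.2 = 0) : koszul p q = 1 := by
  simp [koszul, h]

theorem smul_koszul_cancel {M : Type*} [AddCommGroup M] (p q : ℕ × ZMod 2) (m : M) :
    koszul p q • koszul p q • m = m := by
  rw [smul_smul, koszul_mul_self, one_smul]

theorem zmod_two_eq_of_add_eq_zero {a b : ZMod 2} (h : a + b = 0) : a = b := by
  revert a b; decide

/-! ### The trace pairing, dual bases and the Nakayama automorphism -/

namespace FrobeniusSuperalgebra

variable {k F : Type*} [CommRing k] [Ring F] [Algebra k F] (D : FrobeniusSuperalgebra k F)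

theorem nontrivial_base (D : FrobeniusSuperalgebra k F) : Nontrivial k := by
  by_contra h
  rw [not_nontrivial_iff_subsingleton] at h
  have := Module.subsingleton k F
  obtain ⟨ε, hε⟩ := D.isGreatest.1
  exact hε (Subsingleton.elim _ _)

theorem tr_mul_eq_zero_of_ne {p q : ℕ × ZMod 2} {f g : F} (hf : f ∈ D.grade p)
    (hg : g ∈ D.grade q) (hpq : p + q ≠ (D.δ, 0)) : D.tr (f * g) = 0 :=
  D.tr_eq_zero _ hpq _ (SetLike.mul_mem_graded hf hg)

/-- Every functional on the finite free module `F` has the form `toDual f`, and functionals separate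
points. The signs in `toDual` are harmless because the basis is homogeneous. -/
theorem eq_zero_of_tr_mul_basis {g : F} (h : ∀ c, D.tr (g * D.basis c) = 0) : g = 0 := by
  have := Module.Free.of_basis D.basis
  have := Module.Finite.of_basis D.basis
  refine (Module.forall_dual_apply_eq_zero_iff k g).1 fun φ => ?_
  obtain ⟨f, rfl⟩ := D.toDual.surjective φ
  have h0 : (LinearMap.flip D.toDual.toLinearMap) g = 0 := by
    refine D.basis.ext fun c => ?_
    obtain ⟨p, hp⟩ := D.basis_homogeneous c
    simp [D.toDual_apply_left hp, h]
  exact LinearMap.congr_fun h0 f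

theorem tr_dualBasis_mul_eq (b : Fin D.rank) (f : F) :
    D.tr (D.dualBasis b * f) = D.basis.repr f b := by
  have h : D.tr ∘ₗ LinearMap.mulLeft k (D.dualBasis b) = D.basis.coord b := by
    refine D.basis.ext fun c => ?_
    simp [tr_dualBasis_mul, Finsupp.single_apply, eq_comm]
  exact LinearMap.congr_fun h f

theorem sum_tr_smul_basis (f : F) : ∑ b, D.tr (D.dualBasis b * f) • D.basis b = f := by
  simp only [tr_dualBasis_mul_eq]
  exact D.basis.sum_repr f

theorem sum_tr_smul_dualBasis (f : F) : ∑ b, D.tr (f * D.basis b) • D.dualBasis b = f := by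
  refine sub_eq_zero.1 (D.eq_zero_of_tr_mul_basis fun c => ?_)
  simp [sub_mul, Finset.sum_mul, tr_dualBasis_mul]

theorem eq_zero_of_tr_mul_left {f : F} (h : ∀ g, D.tr (g * f) = 0) : f = 0 := by
  rw [← D.sum_tr_smul_basis f]
  simp [h]

theorem eq_zero_of_tr_homogeneous_mul {f : F}
    (h : ∀ q, ∀ g ∈ D.grade q, D.tr (g * f) = 0) : f = 0 := by
  refine D.eq_zero_of_tr_mul_left fun g => ?_
  induction g using DirectSum.Decomposition.inductionOn D.grade with
  | zero => simp
  | homogeneous m => exact h _ _ m.2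
  | add a b ha hb => rw [add_mul, map_add, ha, hb, add_zero]

/-- The degree and parity of a basis element. -/
noncomputable def deg (b : Fin D.rank) : ℕ × ZMod 2 := (D.basis_homogeneous b).choose

theorem basis_mem (b : Fin D.rank) : D.basis b ∈ D.grade (D.deg b) :=
  (D.basis_homogeneous b).choose_spec

/-- The trace lives in the single degree `(δ, 0)`, so against a homogeneous `g` only the component
of complementary degree contributes. -/
theorem tr_mul_component_right {r q : ℕ × ZMod 2} {g : F} (hg : g ∈ D.grade r)
    (h : r + q = (D.δ, 0)) (f : F) :
    D.tr (g * (DirectSum.decompose D.grade f q : F)) = D.tr (g * f) := by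
  induction f using DirectSum.Decomposition.inductionOn D.grade with
  | zero => simp
  | @homogeneous s m =>
    by_cases hs : s = q
    · subst hs; rw [DirectSum.decompose_of_mem_same D.grade m.2]
    · rw [DirectSum.decompose_of_mem_ne D.grade m.2 hs, mul_zero, map_zero,
        D.tr_mul_eq_zero_of_ne hg m.2]
      exact fun h' => hs (add_left_cancel (h'.trans h.symm))
  | add a b ha hb =>
    simp only [DirectSum.decompose_add, DirectSum.add_apply, Submodule.coe_add, mul_add, map_add,
      ha, hb]

theorem tr_component_mul_left {r q : ℕ × ZMod 2} {g : F} (hg : g ∈ D.grade r)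
    (h : q + r = (D.δ, 0)) (f : F) :
    D.tr ((DirectSum.decompose D.grade f q : F) * g) = D.tr (f * g) := by
  induction f using DirectSum.Decomposition.inductionOn D.grade with
  | zero => simp
  | @homogeneous s m =>
    by_cases hs : s = q
    · subst hs; rw [DirectSum.decompose_of_mem_same D.grade m.2]
    · rw [DirectSum.decompose_of_mem_ne D.grade m.2 hs, zero_mul, map_zero,
        D.tr_mul_eq_zero_of_ne m.2 hg]
      exact fun h' => hs (add_right_cancel (h'.trans h.symm))
  | add a b ha hb =>
    simp only [DirectSum.decompose_add, DirectSum.add_apply, Submodule.coe_add, add_mul, map_add,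
      ha, hb]

theorem mem_grade_of_components {f : F} {p : ℕ × ZMod 2}
    (h : ∀ q ≠ p, (DirectSum.decompose D.grade f q : F) = 0) : f ∈ D.grade p := by
  classical
  rw [← DirectSum.sum_support_decompose D.grade f]
  refine Submodule.sum_mem _ fun q _ => ?_
  by_cases hq : q = p
  · subst hq; exact (DirectSum.decompose D.grade f q).2
  · rw [h q hq]; exact Submodule.zero_mem _

/-- If no degree were complementary to that of `b`, then `b^∨ b` would have trace `0` instead of
`1`. -/
theorem exists_deg_add (b : Fin D.rank) : ∃ q, q + D.deg b = (D.δ, 0) := by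
  classical
  have := D.nontrivial_base
  by_contra! h
  have h1 := D.tr_dualBasis_mul b b
  rw [if_pos rfl, ← DirectSum.sum_support_decompose D.grade (D.dualBasis b), Finset.sum_mul,
    map_sum, Finset.sum_eq_zero] at h1
  · exact zero_ne_one h1
  · intro q _
    exact D.tr_mul_eq_zero_of_ne (DirectSum.decompose D.grade (D.dualBasis b) q).2
      (D.basis_mem b) (h q)

/-- The degree and parity of a dual basis element. -/
noncomputable def dualDeg (b : Fin D.rank) : ℕ × ZMod 2 := (D.exists_deg_add b).choose

theorem dualDeg_add_deg (b : Fin D.rank) : D.dualDeg b + D.deg b = (D.δ, 0) :=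
  (D.exists_deg_add b).choose_spec

theorem deg_add_dualDeg (b : Fin D.rank) : D.deg b + D.dualDeg b = (D.δ, 0) := by
  rw [add_comm, dualDeg_add_deg]

theorem dualDeg_parity (b : Fin D.rank) : (D.dualDeg b).2 = (D.deg b).2 :=
  zmod_two_eq_of_add_eq_zero (congrArg Prod.snd (D.dualDeg_add_deg b))

/-- A component of `b^∨` in any other degree pairs to zero with every basis element, hence vanishes
by nondegeneracy. -/
theorem dualBasis_mem (b : Fin D.rank) : D.dualBasis b ∈ D.grade (D.dualDeg b) := by
  refine D.mem_grade_of_components fun q hq => D.eq_zero_of_tr_mul_basis fun c => ?_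
  by_cases h : q + D.deg c = (D.δ, 0)
  · rw [D.tr_component_mul_left (D.basis_mem c) h, tr_dualBasis_mul, if_neg]
    rintro rfl
    exact hq (add_right_cancel (h.trans (D.dualDeg_add_deg b).symm))
  · exact D.tr_mul_eq_zero_of_ne (Subtype.mem _) (D.basis_mem c) h

theorem toDual_nakayama (f g : F) : D.toDual (D.nakayama f) g = D.tr (f * g) := by
  simp [nakayama]

/-- Both traces see only the part of `f` with the parity of `g`, so the sign can be written in terms
of `g` alone and `f` need not be homogeneous. -/
theorem tr_mul_nakayama' {q : ℕ × ZMod 2} (f : F) {g : F} (hg : g ∈ D.grade q) :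
    D.tr (g * D.nakayama f) = koszul q q • D.tr (f * g) := by
  rw [← D.toDual_nakayama f g, D.toDual_apply_right hg, smul_koszul_cancel]

theorem eq_nakayama {f f' : F}
    (h : ∀ q, ∀ g ∈ D.grade q, D.tr (g * f') = koszul q q • D.tr (f * g)) :
    f' = D.nakayama f := by
  refine sub_eq_zero.1 (D.eq_zero_of_tr_homogeneous_mul fun q g hg => ?_)
  rw [mul_sub, map_sub, h q g hg, D.tr_mul_nakayama' f hg, sub_self]

theorem nakayama_mem {p : ℕ × ZMod 2} {f : F} (hf : f ∈ D.grade p) :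
    D.nakayama f ∈ D.grade p := by
  refine D.mem_grade_of_components fun q hq =>
    D.eq_zero_of_tr_homogeneous_mul fun r g hg => ?_
  by_cases h : r + q = (D.δ, 0)
  · rw [D.tr_mul_component_right hg h, D.tr_mul_nakayama' f hg, D.tr_mul_eq_zero_of_ne hf hg,
      smul_zero]
    intro h'
    have h2 : q + r = p + r := by rw [add_comm q, h, h']
    exact hq (add_right_cancel h2)
  · exact D.tr_mul_eq_zero_of_ne hg (Subtype.mem _) h

theorem nakayama_pow_mem {p : ℕ × ZMod 2} {f : F} (m : ℕ) (hf : f ∈ D.grade p) :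
    (D.nakayama ^ m) f ∈ D.grade p := by
  induction m with
  | zero => simpa
  | succ m ih => rw [pow_succ']; exact D.nakayama_mem ih

theorem nakayama_one : D.nakayama 1 = 1 := by
  symm
  refine D.eq_nakayama fun q g hg => ?_
  rw [mul_one, one_mul]
  by_cases h : q = (D.δ, 0)
  · rw [h, koszul_even_left _ rfl, one_smul]
  · rw [D.tr_eq_zero q h g hg, smul_zero]

/-- Moving first `b` and then `a` around the trace shows that `ψ(a) ψ(b)` has the property that
characterises `ψ(a b)`. -/
theorem nakayama_mul (a b : F) : D.nakayama (a * b) = D.nakayama a * D.nakayama b := by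
  induction a using DirectSum.Decomposition.inductionOn D.grade with
  | zero => simp
  | add a a' ha ha' => rw [add_mul, map_add, map_add, add_mul, ha, ha']
  | @homogeneous p a =>
    induction b using DirectSum.Decomposition.inductionOn D.grade with
    | zero => simp
    | add b b' hb hb' => rw [mul_add, map_add, map_add, mul_add, hb, hb']
    | @homogeneous r b =>
      symm
      refine D.eq_nakayama fun q g hg => ?_
      rw [← mul_assoc, D.tr_mul_nakayama' _ (SetLike.mul_mem_graded hg (D.nakayama_mem a.2)),
        ← mul_assoc, D.tr_mul_nakayama' _ (SetLike.mul_mem_graded b.2 hg), smul_smul, mul_assoc]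
      -- The accumulated signs agree only when the three parities add up to zero; in every other
      -- degree the trace itself vanishes.
      by_cases h : p + (r + q) = (D.δ, 0)
      · congr 1
        have h2 : p.2 + (r.2 + q.2) = 0 := congrArg Prod.snd h
        have : ∀ x y z : ZMod 2, x + (y + z) = 0 → (-1 : ℤ) ^ ((z + x).val * (z + x).val) *
          (-1) ^ ((y + z).val * (y + z).val) = (-1) ^ (z.val * z.val) := by decide
        exact this _ _ _ h2
      · rw [D.tr_mul_eq_zero_of_ne a.2 (SetLike.mul_mem_graded b.2 hg) h, smul_zero, smul_zero]

theorem nakayama_pow_mul (m : ℕ) (a b : F) :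
    (D.nakayama ^ m) (a * b) = (D.nakayama ^ m) a * (D.nakayama ^ m) b := by
  induction m with
  | zero => simp
  | succ m ih => simp only [pow_succ', Module.End.mul_apply, ih, nakayama_mul]

theorem nakayama_pow_one (m : ℕ) : (D.nakayama ^ m) 1 = 1 := by
  induction m with
  | zero => simp
  | succ m ih => simp only [pow_succ', Module.End.mul_apply, ih, nakayama_one]

/-! ### Identities for the tensor `∑ b ⊗ b^∨` -/

section Teleport

variable {R : Type*} [AddCommGroup R] [Module k R] (β : F →ₗ[k] F →ₗ[k] R)

/-- Both sides expand into the same double sum with coefficients `tr(c^∨ a b)`. An arbitrary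
bilinear `β` stands in for the tensor product, so the identity can be applied to products of two
copies of `F` in any algebra. -/
theorem sum_mul_basis (a : F) :
    ∑ b, β (a * D.basis b) (D.dualBasis b) = ∑ b, β (D.basis b) (D.dualBasis b * a) := by
  have h1 : ∀ b, β (a * D.basis b) (D.dualBasis b) =
      ∑ c, D.tr (D.dualBasis c * a * D.basis b) • β (D.basis c) (D.dualBasis b) := fun b => by
    conv_lhs => rw [← D.sum_tr_smul_basis (a * D.basis b)]
    simp [mul_assoc]
  have h2 : ∀ b, β (D.basis b) (D.dualBasis b * a) =
      ∑ c, D.tr (D.dualBasis b * a * D.basis c) • β (D.basis b) (D.dualBasis c) := fun b => by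
    conv_lhs => rw [← D.sum_tr_smul_dualBasis (D.dualBasis b * a)]
    simp [mul_assoc]
  simp only [h1, h2]
  exact Finset.sum_comm

/-- The expansion coefficients on the two sides are `tr(a b^∨ c)` and `tr(b^∨ c ψ(a))`, which agree
up to sign by the defining property of `ψ`. -/
theorem sum_koszul_mul_dualBasis {p : ℕ × ZMod 2} {a : F} (ha : a ∈ D.grade p) :
    ∑ b, koszul p (D.deg b) • β (D.basis b) (a * D.dualBasis b) =
      ∑ b, koszul p (D.deg b) • β (D.basis b * D.nakayama a) (D.dualBasis b) := by
  have h1 : ∀ b, koszul p (D.deg b) • β (D.basis b) (a * D.dualBasis b) =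
      ∑ c, (koszul p (D.deg b) • D.tr (a * D.dualBasis b * D.basis c)) •
        β (D.basis b) (D.dualBasis c) := fun b => by
    conv_lhs => rw [← D.sum_tr_smul_dualBasis (a * D.dualBasis b)]
    simp [Finset.smul_sum, mul_smul, Int.cast_smul_eq_zsmul]
  have h2 : ∀ b, koszul p (D.deg b) • β (D.basis b * D.nakayama a) (D.dualBasis b) =
      ∑ c, (koszul p (D.deg b) • D.tr (D.dualBasis c * (D.basis b * D.nakayama a))) •
        β (D.basis c) (D.dualBasis b) := fun b => by
    conv_lhs => rw [← D.sum_tr_smul_basis (D.basis b * D.nakayama a)]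
    simp [Finset.smul_sum, mul_smul, Int.cast_smul_eq_zsmul]
  simp only [h1, h2]
  rw [Finset.sum_comm]
  refine Finset.sum_congr rfl fun b _ => Finset.sum_congr rfl fun c _ => ?_
  congr 1
  have hm := SetLike.mul_mem_graded (D.dualBasis_mem c) (D.basis_mem b)
  rw [← mul_assoc, D.tr_mul_nakayama' _ hm, mul_assoc]
  by_cases h : p + (D.dualDeg c + D.deg b) = (D.δ, 0)
  · rw [smul_smul]
    congr 1
    have h2 : p.2 + ((D.dualDeg c).2 + (D.deg b).2) = 0 := congrArg Prod.snd h
    rw [D.dualDeg_parity] at h2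
    have h3 : ∀ x y z : ZMod 2, x + (y + z) = 0 → (-1 : ℤ) ^ (x.val * y.val) =
      (-1) ^ (x.val * z.val) * (-1) ^ ((y + z).val * (y + z).val) := by decide
    have h4 := h3 _ _ _ h2
    rw [← D.dualDeg_parity c] at h4
    simp only [koszul, Prod.snd_add]
    rw [← h4, D.dualDeg_parity]
  · rw [D.tr_mul_eq_zero_of_ne ha hm h, smul_zero, smul_zero, smul_zero]

/-- Expanding in the basis, both sides have the coefficients `tr(b^∨ ψ(c^∨))`. The identity says
that exchanging the two legs of `∑ b ⊗ b^∨` amounts to applying `ψ` to the second one. -/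
theorem sum_basis_nakayama_dualBasis :
    ∑ b, β (D.basis b) (D.nakayama (D.dualBasis b)) =
      ∑ b, koszul (D.deg b) (D.deg b) • β (D.dualBasis b) (D.basis b) := by
  have h1 : ∀ b, koszul (D.deg b) (D.deg b) • β (D.dualBasis b) (D.basis b) =
      ∑ c, D.tr (D.dualBasis b * D.nakayama (D.dualBasis c)) • β (D.basis c) (D.basis b) := by
    intro b
    conv_lhs => rw [← D.sum_tr_smul_basis (D.dualBasis b)]
    simp only [map_sum, map_smul, LinearMap.sum_apply, LinearMap.smul_apply, Finset.smul_sum]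
    refine Finset.sum_congr rfl fun c _ => ?_
    rw [D.tr_mul_nakayama' _ (D.dualBasis_mem b),
      koszul_congr (D.dualDeg_parity b) (D.dualDeg_parity b), smul_assoc]
  simp only [h1]
  rw [Finset.sum_comm]
  refine Finset.sum_congr rfl fun c _ => ?_
  conv_lhs => rw [← D.sum_tr_smul_basis (D.nakayama (D.dualBasis c))]
  simp

end Teleport

end FrobeniusSuperalgebra

end AffineWreath

/-! ### Realisations of wreath products and Dunkl-type elements -/

namespace AffineWreath

variable {k F : Type*} [CommRing k] [Ring F] [Algebra k F]

/-- A family of copies of `F` in `R` which supercommute with each other. -/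
structure TensorRep (D : FrobeniusSuperalgebra k F) (ι R : Type*) [Ring R] [Algebra k R] where
  f : ι → F →ₐ[k] R
  supercomm : ∀ i j, i ≠ j → ∀ p q a b, a ∈ D.grade p → b ∈ D.grade q →
    f i a * f j b = koszul p q • (f j b * f i a)

/-- A family of supercommuting copies of `F` in `R`, permuted by units of `R`. -/
structure WreathRep (D : FrobeniusSuperalgebra k F) (ι R : Type*) [Ring R] [Algebra k R] extends
    TensorRep D ι R where
  perm : Equiv.Perm ι →* R
  perm_f : ∀ π i a, perm π * f i a = f (π i) a * perm π

variable {D : FrobeniusSuperalgebra k F} {ι R : Type*} [Ring R] [Algebra k R]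

namespace TensorRep

variable (W : TensorRep D ι R)

/-- The bilinear map `(a, b) ↦ a_i b_j`. -/
noncomputable def mulBilin (i j : ι) : F →ₗ[k] F →ₗ[k] R :=
  (LinearMap.mul k R).compl₁₂ (W.f i).toLinearMap (W.f j).toLinearMap

@[simp]
theorem mulBilin_apply (i j : ι) (a b : F) : W.mulBilin i j a b = W.f i a * W.f j b := rfl

/-- The element `∑ b_i b^∨_j`. -/
noncomputable def tel (i j : ι) : R := ∑ b, W.f i (D.basis b) * W.f j (D.dualBasis b)

theorem f_mul_tel (i j : ι) (a : F) : W.f i a * W.tel i j = W.tel i j * W.f j a := by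
  have := D.sum_mul_basis (W.mulBilin i j) a
  simp only [mulBilin_apply, map_mul] at this
  simp only [tel, Finset.mul_sum, Finset.sum_mul, ← mul_assoc, this]

theorem commute_even {i j : ι} (hij : i ≠ j) {p q : ℕ × ZMod 2} {a b : F} (ha : a ∈ D.grade p)
    (hb : b ∈ D.grade q) (hp : p.2 = 0) : Commute (W.f i a) (W.f j b) := by
  have := W.supercomm i j hij p q a b ha hb
  rwa [koszul_even_left _ hp, one_smul] at this

theorem ext_homogeneous {S : Type*} [AddCommGroup S] [Module k S] {g h : F →ₗ[k] S}
    (H : ∀ p, ∀ a ∈ D.grade p, g a = h a) (a : F) : g a = h a := by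
  induction a using DirectSum.Decomposition.inductionOn D.grade with
  | zero => simp
  | homogeneous m => exact H _ _ m.2
  | add a b ha hb => rw [map_add, map_add, ha, hb]

/-- Passing `a` over `b` and over `b^∨` costs the same sign twice, as these two have the same
parity. -/
theorem f_comm_tel {i j l : ι} (hi : l ≠ i) (hj : l ≠ j) (a : F) :
    W.f l a * W.tel i j = W.tel i j * W.f l a := by
  refine ext_homogeneous (D := D) (g := LinearMap.mulRight k (W.tel i j) ∘ₗ (W.f l).toLinearMap)
    (h := LinearMap.mulLeft k (W.tel i j) ∘ₗ (W.f l).toLinearMap) (fun p a ha => ?_) a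
  simp only [LinearMap.comp_apply, LinearMap.mulRight_apply, LinearMap.mulLeft_apply,
    AlgHom.toLinearMap_apply, tel, Finset.mul_sum, Finset.sum_mul]
  refine Finset.sum_congr rfl fun b _ => ?_
  rw [← mul_assoc, W.supercomm l i hi p _ a _ ha (D.basis_mem b), smul_mul_assoc, mul_assoc,
    W.supercomm l j hj p _ a _ ha (D.dualBasis_mem b), mul_smul_comm,
    koszul_congr rfl (D.dualDeg_parity b), smul_koszul_cancel, mul_assoc]

theorem f_mul_tel' {i j : ι} (hij : i ≠ j) (a : F) :
    W.f j a * W.tel i j = W.tel i j * W.f i (D.nakayama a) := by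
  refine ext_homogeneous (D := D) (g := LinearMap.mulRight k (W.tel i j) ∘ₗ (W.f j).toLinearMap)
    (h := LinearMap.mulLeft k (W.tel i j) ∘ₗ (W.f i).toLinearMap ∘ₗ D.nakayama)
    (fun p a ha => ?_) a
  have := D.sum_koszul_mul_dualBasis (W.mulBilin i j) ha
  simp only [LinearMap.comp_apply, LinearMap.mulRight_apply, LinearMap.mulLeft_apply,
    AlgHom.toLinearMap_apply, tel, Finset.mul_sum, Finset.sum_mul]
  simp only [mulBilin_apply, map_mul] at this
  refine Eq.trans (Finset.sum_congr rfl fun b _ => ?_) (this.trans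
    (Finset.sum_congr rfl fun b _ => ?_))
  · rw [← mul_assoc, W.supercomm j i hij.symm p _ a _ ha (D.basis_mem b), smul_mul_assoc,
      mul_assoc]
  · rw [mul_assoc, W.supercomm i j hij p _ _ _ (D.nakayama_mem ha) (D.dualBasis_mem b),
      mul_smul_comm, koszul_congr rfl (D.dualDeg_parity b), smul_koszul_cancel, mul_assoc]

theorem sum_f_nakayama {i j : ι} (hij : i ≠ j) :
    ∑ b, W.f i (D.basis b) * W.f j (D.nakayama (D.dualBasis b)) = W.tel j i := by
  have := D.sum_basis_nakayama_dualBasis (W.mulBilin i j)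
  simp only [mulBilin_apply] at this
  rw [this, tel]
  refine Finset.sum_congr rfl fun b _ => ?_
  rw [W.supercomm i j hij _ _ _ _ (D.dualBasis_mem b) (D.basis_mem b),
    koszul_congr (D.dualDeg_parity b) rfl, smul_koszul_cancel]

end TensorRep

namespace WreathRep

variable (W : WreathRep D ι R)

theorem perm_swap_mul_self [DecidableEq ι] (i j : ι) :
    W.perm (Equiv.swap i j) * W.perm (Equiv.swap i j) = 1 := by
  rw [← map_mul, Equiv.swap_mul_self, map_one]

theorem perm_tel (π : Equiv.Perm ι) (i j : ι) :
    W.perm π * W.tel i j = W.tel (π i) (π j) * W.perm π := by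
  simp only [TensorRep.tel, Finset.mul_sum, Finset.sum_mul]
  refine Finset.sum_congr rfl fun b _ => ?_
  rw [← mul_assoc, W.perm_f, mul_assoc, W.perm_f, mul_assoc]

variable [DecidableEq ι]

/-- The element `(∑ b_q b^∨_i) (i q)`. -/
noncomputable def exch (i q : ι) : R := W.tel q i * W.perm (Equiv.swap i q)

theorem perm_exch (π : Equiv.Perm ι) (i q : ι) :
    W.perm π * W.exch i q = W.exch (π i) (π q) * W.perm π := by
  rw [exch, exch, ← mul_assoc, W.perm_tel, mul_assoc, mul_assoc, ← map_mul, ← map_mul,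
    Equiv.mul_swap_eq_swap_mul]

/-- The only delicate case is `l = q`: the transposition moves the element to position `i` and the
teleporter brings it back to `q`. -/
theorem f_exch_of_ne {i q l : ι} (hi : l ≠ i) (hq : i ≠ q) (a : F) :
    W.f l a * W.exch i q = W.exch i q * W.f l a := by
  rw [exch, mul_assoc, W.perm_f]
  by_cases h : l = q
  · subst h
    rw [Equiv.swap_apply_right, ← mul_assoc, W.f_mul_tel, mul_assoc]
  · rw [Equiv.swap_apply_of_ne_of_ne hi h, ← mul_assoc, W.f_comm_tel h hi, mul_assoc]

/-- Here the return trip through the teleporter costs one `ψ`. Thus `exch i q` commutes past the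
copies of `F` exactly as `x_i` does, and subtracting such terms from `x_i` preserves these
relations. -/
theorem f_exch_same {i q : ι} (hq : i ≠ q) (a : F) :
    W.f i a * W.exch i q = W.exch i q * W.f i (D.nakayama a) := by
  rw [exch, mul_assoc, W.perm_f, Equiv.swap_apply_left, ← mul_assoc, W.f_mul_tel' hq.symm,
    mul_assoc]

end WreathRep

/-- A family of supercommuting copies of `F` in `R`, permuted by units of `R`, together with
elements `y_i` that are permuted by these units. -/
structure DunklRep (D : FrobeniusSuperalgebra k F) (ι R : Type*) [Ring R] [Algebra k R] extends
    WreathRep D ι R where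
  y : ι → R
  perm_y : ∀ π i, perm π * y i = y (π i) * perm π
  f_y_same : ∀ i a, f i a * y i = y i * f i (D.nakayama a)
  f_y_ne : ∀ i j, j ≠ i → ∀ a, f j a * y i = y i * f j a

namespace DunklRep

variable (W : DunklRep D ι R)

/-- Pulling `y_j` out to the left turns `b^∨` into `ψ(b^∨)`, and `sum_f_nakayama` absorbs this `ψ`
by exchanging the two positions. -/
theorem tel_y {i j : ι} (hij : i ≠ j) : W.tel i j * W.y j = W.y j * W.tel j i := by
  rw [← W.sum_f_nakayama hij, TensorRep.tel, Finset.sum_mul, Finset.mul_sum]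
  refine Finset.sum_congr rfl fun b _ => ?_
  rw [mul_assoc, W.f_y_same, ← mul_assoc, W.f_y_ne _ _ hij, mul_assoc]

variable [DecidableEq ι]

theorem exch_y {i j : ι} (hij : i ≠ j) : W.exch i j * W.y j = W.y i * W.exch j i := by
  rw [WreathRep.exch, mul_assoc, W.perm_y, Equiv.swap_apply_right, ← mul_assoc,
    W.tel_y hij.symm, mul_assoc, WreathRep.exch, Equiv.swap_comm]

theorem commute_y_exch {i j q : ι} (hij : i ≠ j) (hiq : i ≠ q) :
    Commute (W.y i) (W.exch j q) := by
  have h1 : Commute (W.y i) (W.tel q j) := by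
    refine Commute.sum_right _ _ _ fun b _ => Commute.mul_right ?_ ?_
    · exact (W.f_y_ne _ _ hiq.symm _).symm
    · exact (W.f_y_ne _ _ hij.symm _).symm
  refine h1.mul_right ?_
  have := W.perm_y (Equiv.swap j q) i
  rw [Equiv.swap_apply_of_ne_of_ne hij hiq] at this
  exact this.symm

/-- The commutation relation for the `y_i` equivalent to the commutativity of the `x_i`. -/
def Integrable (i j : ι) : Prop := Commute (W.y i) (W.y j + W.exch j i)

/-- `exch_y` carries the two exchange terms of one commutator into those of the other. -/
theorem Integrable.symm {W : DunklRep D ι R} {i j : ι} (hij : i ≠ j) (h : W.Integrable i j) :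
    W.Integrable j i := by
  have h' : W.y i * (W.y j + W.exch j i) = (W.y j + W.exch j i) * W.y i := h
  change W.y j * (W.y i + W.exch i j) = (W.y i + W.exch i j) * W.y j
  rw [mul_add, add_mul] at *
  rw [← W.exch_y hij.symm, W.exch_y hij]
  exact h'.symm

/-- The sum of the `(∑ b_q b^∨_i) (i q)` for `q < i`. -/
noncomputable def jm {N : ℕ} (W : WreathRep D (Fin N) R) (i : Fin N) : R :=
  ∑ q ∈ Finset.univ.filter (· < i), W.exch i q

section Fin

variable {N : ℕ} (W : WreathRep D (Fin N) R)

theorem f_jm_of_ne {i l : Fin N} (hi : l ≠ i) (a : F) : W.f l a * jm W i = jm W i * W.f l a := by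
  rw [jm, Finset.mul_sum, Finset.sum_mul]
  refine Finset.sum_congr rfl fun q hq => W.f_exch_of_ne hi ?_ a
  exact (Finset.mem_filter.1 hq).2.ne'

theorem f_jm_same (i : Fin N) (a : F) :
    W.f i a * jm W i = jm W i * W.f i (D.nakayama a) := by
  rw [jm, Finset.mul_sum, Finset.sum_mul]
  refine Finset.sum_congr rfl fun q hq => W.f_exch_same ?_ a
  exact (Finset.mem_filter.1 hq).2.ne'

theorem perm_jm {π : Equiv.Perm (Fin N)} {i : Fin N} (h : ∀ q, π q < π i ↔ q < i) :
    W.perm π * jm W i = jm W (π i) * W.perm π := by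
  rw [jm, Finset.mul_sum, jm, Finset.sum_mul]
  refine Finset.sum_equiv π (by simp [h]) fun _ _ => W.perm_exch _ _ _

/-- `jm j` commutes with the copies of `F` in positions below `j` and with permutations of these
positions. All ingredients of `jm i` are of this kind. -/
theorem commute_jm_jm {i j : Fin N} (h : i < j) : Commute (jm W i) (jm W j) := by
  refine Commute.sum_left _ _ _ fun q hq => ?_
  have hq : q < i := (Finset.mem_filter.1 hq).2
  have hf : ∀ l, l < j → ∀ a, Commute (W.f l a) (jm W j) := fun l hl a => f_jm_of_ne W hl.ne a
  refine Commute.mul_left (Commute.sum_left _ _ _ fun b _ =>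
    (hf q (hq.trans h) _).mul_left (hf i h _)) ?_
  have h1 : Equiv.swap i q j = j := Equiv.swap_apply_of_ne_of_ne h.ne' (hq.trans h).ne'
  have h2 := perm_jm W (π := Equiv.swap i q) (i := j) fun r => by
    rw [h1, Equiv.swap_apply_def]
    split_ifs with h3 h4
    · rw [h3]; exact iff_of_true (hq.trans h) h
    · rw [h4]; exact iff_of_true h (hq.trans h)
    · rfl
  rwa [h1] at h2

end Fin

section Fin

variable {N : ℕ} (W : DunklRep D (Fin N) R)

theorem commute_jm_y {i j : Fin N} (h : i < j) : Commute (jm W.toWreathRep i) (W.y j) :=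
  Commute.sum_left _ _ _ fun _ hq =>
    (W.commute_y_exch h.ne' ((Finset.mem_filter.1 hq).2.trans h).ne').symm

/-- Among the terms of `jm j` only the one for `q = i` fails to commute with `y_i`. This is why
commutativity of `x_i` and `x_j` involves no more than `y_i`, `y_j` and `exch j i`. -/
theorem y_add_jm {i j : Fin N} (h : i < j) : ∃ r, Commute (W.y i) r ∧
    W.y j + jm W.toWreathRep j = (W.y j + W.exch j i) + r := by
  refine ⟨∑ q ∈ (Finset.univ.filter (· < j)).erase i, W.exch j q,
    Commute.sum_right _ _ _ fun q hq => ?_, ?_⟩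
  · exact W.commute_y_exch h.ne (Finset.mem_erase.1 hq).1.symm
  · rw [jm, add_assoc, Finset.add_sum_erase _ (fun q => W.exch j q) (by simpa using h)]

theorem commute_add_jm (hW : ∀ i j, i ≠ j → W.Integrable i j) (i j : Fin N) :
    Commute (W.y i + jm W.toWreathRep i) (W.y j + jm W.toWreathRep j) := by
  have key : ∀ {i j : Fin N}, i < j →
      Commute (W.y i + jm W.toWreathRep i) (W.y j + jm W.toWreathRep j) := by
    intro i j h
    refine Commute.add_left ?_ ((W.commute_jm_y h).add_right (commute_jm_jm _ h))
    obtain ⟨r, hr, h2⟩ := W.y_add_jm h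
    rw [h2]
    exact Commute.add_right (hW i j h.ne) hr
  rcases lt_trichotomy i j with h | h | h
  · exact key h
  · rw [h]
  · exact (key h).symm

theorem integrable_of_commute
    (hW : ∀ i j, Commute (W.y i + jm W.toWreathRep i) (W.y j + jm W.toWreathRep j))
    {i j : Fin N} (hij : i ≠ j) : W.Integrable i j := by
  have key : ∀ {i j : Fin N}, i < j → W.Integrable i j := by
    intro i j h
    obtain ⟨r, hr, h2⟩ := W.y_add_jm h
    have h3 : Commute (W.y i) (W.y j + jm W.toWreathRep j) := by
      have := (hW i j).sub_left ((W.commute_jm_y h).add_right (commute_jm_jm _ h))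
      rwa [add_sub_cancel_right] at this
    rw [h2] at h3
    have := h3.sub_right hr
    rwa [add_sub_cancel_right] at this
  rcases lt_or_gt_of_ne hij with h | h
  · exact key h
  · exact (key h).symm h.ne

end Fin

end DunklRep

/-! ### Passing between the generators `x_i` and the elements `y_i` -/

/-- A realisation of the defining relations of `𝒜_N(F)` in `R`. -/
structure AffineRep (D : FrobeniusSuperalgebra k F) (N : ℕ) (R : Type*) [Ring R] [Algebra k R]
    extends WreathRep D (Fin N) R where
  x : Fin N → R
  x_comm : ∀ i j, x i * x j = x j * x i
  f_x_same : ∀ i a, f i a * x i = x i * f i (D.nakayama a)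
  f_x_ne : ∀ i j, j ≠ i → ∀ a, f j a * x i = x i * f j a
  s_x_ne : ∀ i i' j : Fin N, i'.val = i.val + 1 → j ≠ i → j ≠ i' →
    perm (Equiv.swap i i') * x j = x j * perm (Equiv.swap i i')
  s_x : ∀ i i' : Fin N, i'.val = i.val + 1 →
    perm (Equiv.swap i i') * x i = x i' * perm (Equiv.swap i i') - toTensorRep.tel i i'

/-- The relations between permutations and the `x_i` are imposed for adjacent transpositions only.
-/
theorem perm_induction {N : ℕ} {P : Equiv.Perm (Fin N) → Prop} (one : P 1)
    (mul : ∀ π σ, P π → P σ → P (π * σ))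
    (swap : ∀ i i' : Fin N, i'.val = i.val + 1 → P (Equiv.swap i i')) (π) : P π := by
  cases N with
  | zero => rwa [Subsingleton.elim π 1]
  | succ n =>
    have h : π ∈ Submonoid.closure
        (Set.range fun i : Fin n ↦ Equiv.swap i.castSucc i.succ) := by
      rw [Equiv.Perm.mclosure_swap_castSucc_succ]; trivial
    induction h using Submonoid.closure_induction with
    | mem x hx =>
      obtain ⟨i, rfl⟩ := hx
      exact swap _ _ (by simp)
    | one => exact one
    | mul x y _ _ hx hy => exact mul _ _ hx hy

namespace DunklRep

variable {N : ℕ} (W : DunklRep D (Fin N) R)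

/-- No position separates `i` from `i'`, so both lie on the same side of `j`. -/
theorem swap_lt_iff {i i' j : Fin N} (h : i'.val = i.val + 1) (hi : j ≠ i) (hi' : j ≠ i')
    (q : Fin N) : Equiv.swap i i' q < j ↔ q < j := by
  have h1 : j.val ≠ i.val := fun h => hi (Fin.ext h)
  have h2 : j.val ≠ i'.val := fun h => hi' (Fin.ext h)
  rw [Equiv.swap_apply_def]
  split_ifs with h3 h4
  · subst h3; simp only [Fin.lt_def]; omega
  · subst h4; simp only [Fin.lt_def]; omega
  · rfl

/-- The sum for `i'` has exactly one term more than the sum for `i`, namely `q = i`. By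
`exch_mul_swap` this term accounts for the correction `∑ b_i b^∨_{i'}` in the relation between `s_i`
and `x_i`. -/
theorem perm_swap_jm {N : ℕ} (W : WreathRep D (Fin N) R) {i i' : Fin N}
    (h : i'.val = i.val + 1) : W.perm (Equiv.swap i i') * jm W i =
      (jm W i' - W.exch i' i) * W.perm (Equiv.swap i i') := by
  have h1 : Finset.univ.filter (· < i') = insert i (Finset.univ.filter (· < i)) := by
    ext q
    simp only [Finset.mem_filter, Finset.mem_univ, true_and, Finset.mem_insert, Fin.lt_def,
      Fin.ext_iff]
    omega
  rw [jm, jm, h1, Finset.sum_insert (by simp), add_sub_cancel_left, Finset.mul_sum,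
    Finset.sum_mul]
  refine Finset.sum_congr rfl fun q hq => ?_
  have hq : q < i := (Finset.mem_filter.1 hq).2
  rw [W.perm_exch, Equiv.swap_apply_left, Equiv.swap_apply_of_ne_of_ne hq.ne]
  rintro rfl
  simp only [Fin.lt_def] at hq; omega

theorem exch_mul_swap {N : ℕ} (W : WreathRep D (Fin N) R) (i i' : Fin N) :
    W.exch i' i * W.perm (Equiv.swap i i') = W.tel i i' := by
  rw [WreathRep.exch, mul_assoc, Equiv.swap_comm, W.perm_swap_mul_self, mul_one]

/-- The realisation of `𝒜_N(F)` with `x_i = y_i + ∑_{q < i} (∑ b_q b^∨_i) (i q)`. -/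
noncomputable def toAffineRep (hW : ∀ i j, i ≠ j → W.Integrable i j) : AffineRep D N R where
  toWreathRep := W.toWreathRep
  x i := W.y i + jm W.toWreathRep i
  x_comm i j := W.commute_add_jm hW i j
  f_x_same i a := by rw [mul_add, add_mul, W.f_y_same, f_jm_same]
  f_x_ne i j h a := by rw [mul_add, add_mul, W.f_y_ne i j h, f_jm_of_ne _ h]
  s_x_ne i i' j h hi hi' := by
    have h1 : Equiv.swap i i' j = j := Equiv.swap_apply_of_ne_of_ne hi hi'
    have h2 := perm_jm W.toWreathRep (π := Equiv.swap i i') (i := j) (by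
      rw [h1]; exact swap_lt_iff h hi hi')
    rw [mul_add, add_mul, W.perm_y, h2, h1]
  s_x i i' h := by
    rw [mul_add, W.perm_y, perm_swap_jm _ h, sub_mul, exch_mul_swap, Equiv.swap_apply_left,
      add_mul, add_sub_assoc]

end DunklRep

namespace AffineRep

variable {N : ℕ} (W : AffineRep D N R)

/-- The elements `y_i = x_i - ∑_{q < i} (∑ b_q b^∨_i) (i q)` are permuted by `S_N`. -/
noncomputable def toDunklRep : DunklRep D (Fin N) R where
  toWreathRep := W.toWreathRep
  y i := W.x i - DunklRep.jm W.toWreathRep i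
  perm_y := by
    refine perm_induction (by simp) (fun π σ hπ hσ i => ?_) fun i i' h => ?_
    · rw [map_mul, mul_assoc, hσ, ← mul_assoc, hπ, mul_assoc, Equiv.Perm.mul_apply]
    · have h1 : W.perm (Equiv.swap i i') * (W.x i - DunklRep.jm W.toWreathRep i) =
          (W.x i' - DunklRep.jm W.toWreathRep i') * W.perm (Equiv.swap i i') := by
        rw [mul_sub, W.s_x i i' h, DunklRep.perm_swap_jm _ h, sub_mul, sub_mul,
          DunklRep.exch_mul_swap]
        abel
      intro j
      by_cases hi : j = i
      · rw [hi, h1, Equiv.swap_apply_left]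
      by_cases hi' : j = i'
      · rw [hi', Equiv.swap_apply_right]
        -- Conjugating the identity for `i` by the involution `s` gives the one for `i'`.
        have h2 := congrArg (fun r => W.perm (Equiv.swap i i') * r * W.perm (Equiv.swap i i')) h1
        simp only [← mul_assoc, W.perm_swap_mul_self, one_mul] at h2
        simp only [mul_assoc, W.perm_swap_mul_self, mul_one] at h2
        exact h2.symm
      have h3 : Equiv.swap i i' j = j := Equiv.swap_apply_of_ne_of_ne hi hi'
      have h2 := DunklRep.perm_jm W.toWreathRep (π := Equiv.swap i i') (i := j) (by
        rw [h3]; exact DunklRep.swap_lt_iff h hi hi')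
      rw [mul_sub, sub_mul, h2, h3, W.s_x_ne i i' j h hi hi']
  f_y_same i a := by rw [mul_sub, sub_mul, W.f_x_same, DunklRep.f_jm_same]
  f_y_ne i j h a := by rw [mul_sub, sub_mul, W.f_x_ne i j h, DunklRep.f_jm_of_ne _ h]

theorem toDunklRep_integrable {i j : Fin N} (hij : i ≠ j) : W.toDunklRep.Integrable i j := by
  refine W.toDunklRep.integrable_of_commute (fun i j => ?_) hij
  simp only [toDunklRep, sub_add_cancel]
  exact W.x_comm i j

/-- Such a permutation carries the sum in `jm i` term by term into the one in `jm (π i)`, so `x_i`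
is moved just like `y_i`. In particular `S_n` commutes with `x_{n+1}`. -/
theorem perm_x_of_forall_lt {π : Equiv.Perm (Fin N)} {i : Fin N} (h : ∀ q, π q < π i ↔ q < i) :
    W.perm π * W.x i = W.x (π i) * W.perm π := by
  have h1 := W.toDunklRep.perm_y π i
  have h2 := DunklRep.perm_jm W.toWreathRep h
  change W.perm π * (W.x i - DunklRep.jm W.toWreathRep i) =
    (W.x (π i) - DunklRep.jm W.toWreathRep (π i)) * W.perm π at h1
  rw [mul_sub, sub_mul, h2] at h1
  exact sub_left_inj.1 h1

/-- Transport along an algebra homomorphism. -/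
def map {S : Type*} [Ring S] [Algebra k S] (φ : R →ₐ[k] S) : AffineRep D N S where
  f i := φ.comp (W.f i)
  supercomm i j hij p q a b ha hb := by
    simp only [AlgHom.comp_apply, ← map_mul, W.supercomm i j hij p q a b ha hb, map_zsmul]
  perm := (φ : R →* S).comp W.perm
  perm_f π i a := by
    simpa using congrArg φ (W.perm_f π i a)
  x i := φ (W.x i)
  x_comm i j := by simpa using congrArg φ (W.x_comm i j)
  f_x_same i a := by simpa using congrArg φ (W.f_x_same i a)
  f_x_ne i j h a := by simpa using congrArg φ (W.f_x_ne i j h a)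
  s_x_ne i i' j h hi hi' := by simpa using congrArg φ (W.s_x_ne i i' j h hi hi')
  s_x i i' h := by simpa [TensorRep.tel] using congrArg φ (W.s_x i i' h)

/-- The value on a generator. -/
def onGen : Gen F N → R
  | .x i => W.x i
  | .f i a => W.f i a
  | .perm π => W.perm π

/-- The homomorphism from the affine wreath product algebra. -/
noncomputable def lift : Affine D N →ₐ[k] R :=
  RingQuot.liftAlgHom k ⟨FreeAlgebra.lift k W.onGen, by
    intro a b h
    cases h with
    | x_comm i j => simpa [onGen] using W.x_comm i j
    | f_add i a b => simp [onGen]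
    | f_mul i a b => simp [onGen]
    | f_algebraMap i r => simp [onGen]
    | f_supercomm i j hij p q a b ha hb =>
      simpa [onGen] using W.supercomm i j hij p q a b ha hb
    | perm_one => simp [onGen]
    | perm_mul π σ => simp [onGen]
    | f_x_same i a => simpa [onGen] using W.f_x_same i a
    | f_x_ne i j hij a => simpa [onGen] using W.f_x_ne i j hij a
    | s_x_ne i i' j hi hj hj' => simpa [onGen] using W.s_x_ne i i' j hi hj hj'
    | s_x i i' hi => simpa [onGen, TensorRep.tel] using W.s_x i i' hi
    | perm_f π i a => simpa [onGen] using W.perm_f π i a⟩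

@[simp]
theorem lift_gen (g : Gen F N) : W.lift (Affine.gen D g) = W.onGen g := by
  simp [lift, Affine.gen]

end AffineRep

/-! ### The tautological realisation in the affine wreath product algebra -/

namespace Affine

variable (D) in
/-- The tautological realisation. -/
noncomputable def rep (n : ℕ) : AffineRep D n (Affine D n) where
  f i := AlgHom.ofLinearMap
    { toFun := fun a => gen D (.f i a)
      map_add' := fun a b => by simpa [gen] using mk_eq D (Rel.f_add i a b)
      map_smul' := fun r a => by
        have h1 := mk_eq D (Rel.f_mul (D := D) i (algebraMap k F r) a)
        have h2 := mk_eq D (Rel.f_algebraMap (D := D) i r)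
        simp only [map_mul, AlgHom.commutes] at h1 h2
        simp only [gen, Algebra.smul_def, RingHom.id_apply, h1, h2] }
    (by simpa [gen] using mk_eq D (Rel.f_algebraMap (D := D) i 1))
    (fun a b => by simpa [gen] using mk_eq D (Rel.f_mul i a b))
  supercomm i j hij p q a b ha hb := by
    simpa [gen] using mk_eq D (Rel.f_supercomm i j hij p q a b ha hb)
  perm :=
    { toFun := fun π => gen D (.perm π)
      map_one' := by simpa [gen] using mk_eq D Rel.perm_one
      map_mul' := fun π σ => by simpa [gen] using mk_eq D (Rel.perm_mul π σ) }
  perm_f π i a := by simpa [gen] using mk_eq D (Rel.perm_f π i a)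
  x i := gen D (.x i)
  x_comm i j := by simpa [gen] using mk_eq D (Rel.x_comm i j)
  f_x_same i a := by simpa [gen] using mk_eq D (Rel.f_x_same i a)
  f_x_ne i j h a := by simpa [gen] using mk_eq D (Rel.f_x_ne i j h a)
  s_x_ne i i' j h hi hi' := by simpa [gen] using mk_eq D (Rel.s_x_ne i i' j h hi hi')
  s_x i i' h := by simpa [gen, TensorRep.tel] using mk_eq D (Rel.s_x i i' h)

theorem algHom_ext {n : ℕ} {φ φ' : Affine D n →ₐ[k] R}
    (h : ∀ g, φ (gen D g) = φ' (gen D g)) : φ = φ' := by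
  refine RingQuot.ringQuot_ext' k _ _ (FreeAlgebra.hom_ext (funext fun g => ?_))
  exact h g

theorem adjoin_gen (n : ℕ) : Algebra.adjoin k (Set.range (gen D (n := n))) = ⊤ := by
  rw [eq_top_iff]
  rintro z -
  obtain ⟨w, rfl⟩ := RingQuot.mkAlgHom_surjective k (Rel D n) z
  induction w using FreeAlgebra.induction with
  | grade0 r => rw [AlgHom.commutes]; exact Subalgebra.algebraMap_mem _ r
  | grade1 g => exact Algebra.subset_adjoin ⟨g, rfl⟩
  | mul a b ha hb => rw [map_mul]; exact Subalgebra.mul_mem _ ha hb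
  | add a b ha hb => rw [map_add]; exact Subalgebra.add_mem _ ha hb

end Affine

end AffineWreath

/-! ### Parity automorphisms and the cyclotomic polynomial -/

namespace AffineWreath

variable {k F : Type*} [CommRing k] [Ring F] [Algebra k F]

theorem semiconjBy_list_prod {R α : Type*} [Monoid R] {r : R} (l : List α) {a b : α → R}
    (h : ∀ i ∈ l, SemiconjBy r (a i) (b i)) :
    SemiconjBy r (l.map a).prod (l.map b).prod := by
  induction l with
  | nil => exact SemiconjBy.one_right r
  | cons i l ih =>
    simp only [List.map_cons, List.prod_cons]
    exact (h i (by simp)).mul_right (ih fun j hj => h j (by simp [hj]))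

namespace FrobeniusSuperalgebra

variable (D : FrobeniusSuperalgebra k F)

/-- The linear map which multiplies elements of degree and parity `p` by `w p`. -/
noncomputable def weight (w : ℕ × ZMod 2 → k) : F →ₗ[k] F :=
  DirectSum.toModule k _ F (fun p => w p • (D.grade p).subtype) ∘ₗ
    (DirectSum.decomposeLinearEquiv D.grade).toLinearMap

theorem weight_apply (w : ℕ × ZMod 2 → k) {p : ℕ × ZMod 2} {a : F} (ha : a ∈ D.grade p) :
    D.weight w a = w p • a := by
  lift a to D.grade p using ha
  simp [weight]

/-- The parity automorphism. -/
noncomputable def parity : F →ₐ[k] F :=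
  AlgHom.ofLinearMap (D.weight fun p => (koszul (0, 1) p : k))
    (by rw [D.weight_apply _ (SetLike.GradedOne.one_mem (A := D.grade)),
        koszul_even_right _ rfl, Int.cast_one, one_smul])
    (by
      intro a b
      induction a using DirectSum.Decomposition.inductionOn D.grade with
      | zero => simp
      | add a a' ha ha' => rw [add_mul, map_add, map_add, add_mul, ha, ha']
      | @homogeneous p a =>
        induction b using DirectSum.Decomposition.inductionOn D.grade with
        | zero => simp
        | add b b' hb hb' => rw [mul_add, map_add, map_add, mul_add, hb, hb']
        | @homogeneous q b =>
          rw [D.weight_apply _ (SetLike.mul_mem_graded a.2 b.2), D.weight_apply _ a.2,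
            D.weight_apply _ b.2, koszul_add_right, smul_mul_smul_comm, Int.cast_mul])

theorem parity_apply {p : ℕ × ZMod 2} {a : F} (ha : a ∈ D.grade p) :
    D.parity a = koszul (0, 1) p • a := by
  rw [← Int.cast_smul_eq_zsmul k]
  exact D.weight_apply _ ha

theorem parity_mem {p : ℕ × ZMod 2} {a : F} (ha : a ∈ D.grade p) : D.parity a ∈ D.grade p := by
  rw [D.parity_apply ha]
  exact zsmul_mem ha _

theorem parity_even {p : ℕ × ZMod 2} {a : F} (ha : a ∈ D.grade p) (hp : p.2 = 0) :
    D.parity a = a := by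
  rw [D.parity_apply ha, koszul_even_right _ hp, one_smul]

theorem parity_nakayama (a : F) : D.parity (D.nakayama a) = D.nakayama (D.parity a) := by
  refine TensorRep.ext_homogeneous (D := D) (g := D.parity.toLinearMap ∘ₗ D.nakayama)
    (h := D.nakayama ∘ₗ D.parity.toLinearMap) (fun p a ha => ?_) a
  simp only [LinearMap.comp_apply, AlgHom.toLinearMap_apply]
  rw [D.parity_apply (D.nakayama_mem ha), D.parity_apply ha, map_zsmul]

/-- The projection to the even (`ε = 0`) or odd (`ε = 1`) part. -/
noncomputable def parityProj (ε : ZMod 2) : F →ₗ[k] F := D.weight fun p => if p.2 = ε then 1 else 0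

end FrobeniusSuperalgebra

variable {D : FrobeniusSuperalgebra k F} {R : Type*} [Ring R] [Algebra k R]

/-- The element `∏_{m=1}^θ ∏_{j=1}^{e_m} (y^m - c^{(m,j)})` for `y : R` and a map `F → R`. -/
noncomputable def chiEval (D : FrobeniusSuperalgebra k F) (C : CycParam F) (φ : F → R) (y : R) :
    R :=
  ((List.range' 1 D.θ).map fun m => ((List.range' 1 (C.e m)).map fun j =>
    y ^ m - φ (C.c m j)).prod).prod

theorem chi_eq_chiEval (C : CycParam F) {n : ℕ} (i : Fin n) :
    chi D C i = chiEval D C ((Affine.rep D n).f i) ((Affine.rep D n).x i) := rfl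

theorem semiconjBy_chiEval (C : CycParam F) {S : Type*} [Ring S] {φ φ' : F → S} {y y' r : S}
    (hφ : ∀ m ∈ Finset.Icc 1 D.θ, ∀ j ∈ Finset.Icc 1 (C.e m),
      SemiconjBy r (φ (C.c m j)) (φ' (C.c m j))) (hy : SemiconjBy r y y') :
    SemiconjBy r (chiEval D C φ y) (chiEval D C φ' y') := by
  refine semiconjBy_list_prod _ fun m hm => semiconjBy_list_prod _ fun j hj => ?_
  rw [List.mem_range'_1] at hm hj
  exact (hy.pow_right m).sub_right
    (hφ m (by simp only [Finset.mem_Icc]; omega) j (by simp only [Finset.mem_Icc]; omega))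

theorem map_chiEval (C : CycParam F) {S : Type*} [Ring S] [Algebra k S] (h : R →ₐ[k] S)
    (φ : F → R) (y : R) : h (chiEval D C φ y) = chiEval D C (fun a => h (φ a)) (h y) := by
  simp [chiEval, map_list_prod, Function.comp_def]

theorem chiEval_congr (C : CycParam F) {S : Type*} [Ring S] {φ φ' : F → S} (y : S)
    (hφ : ∀ m ∈ Finset.Icc 1 D.θ, ∀ j ∈ Finset.Icc 1 (C.e m), φ (C.c m j) = φ' (C.c m j)) :
    chiEval D C φ y = chiEval D C φ' y := by
  have := semiconjBy_chiEval (D := D) C (φ := φ) (φ' := φ') (y := y) (y' := y) (r := 1)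
    (fun m hm j hj => by rw [hφ m hm j hj]; exact SemiconjBy.one_left _) (SemiconjBy.one_left _)
  simpa [SemiconjBy] using this

namespace AffineRep

variable {N : ℕ} (W : AffineRep D N R)

/-- The realisation with the copies of `F` twisted by the parity automorphism. -/
noncomputable def parityTwist : AffineRep D N R where
  f i := (W.f i).comp D.parity
  supercomm i j hij p q a b ha hb :=
    W.supercomm i j hij p q _ _ (D.parity_mem ha) (D.parity_mem hb)
  perm := W.perm
  perm_f π i a := W.perm_f π i _
  x := W.x
  x_comm := W.x_comm
  f_x_same i a := by
    simp only [AlgHom.comp_apply, W.f_x_same, D.parity_nakayama]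
  f_x_ne i j h a := W.f_x_ne i j h _
  s_x_ne := W.s_x_ne
  s_x i i' h := by
    rw [W.s_x i i' h]
    congr 1
    refine Finset.sum_congr rfl fun b _ => ?_
    simp only [AlgHom.comp_apply]
    rw [D.parity_apply (D.basis_mem b), D.parity_apply (D.dualBasis_mem b),
      koszul_congr rfl (D.dualDeg_parity b), map_zsmul, map_zsmul, smul_mul_smul_comm,
      koszul_mul_self, one_smul]

theorem lift_chi (C : CycParam F) (i : Fin N) :
    W.lift (chi D C i) = chiEval D C (W.f i) (W.x i) := by
  rw [chi_eq_chiEval, map_chiEval]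
  congr 1
  · funext a; exact W.lift_gen (.f i a)
  · exact W.lift_gen (.x i)

/-- No position precedes the first, so the correction sum is empty and the cyclotomic relation is a
relation for `y_1`. -/
theorem x_first {i : Fin N} (hi : i.val = 0) : W.x i = W.toDunklRep.y i := by
  have : DunklRep.jm W.toWreathRep i = 0 := by
    refine Finset.sum_eq_zero fun q hq => ?_
    have : q < i := (Finset.mem_filter.1 hq).2
    simp only [Fin.lt_def] at this; omega
  simp [toDunklRep, this]

end AffineRep

theorem DunklRep.perm_chiEval {ι : Type*} (W : DunklRep D ι R) (C : CycParam F)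
    (π : Equiv.Perm ι) (i : ι) :
    W.perm π * chiEval D C (W.f i) (W.y i) =
      chiEval D C (W.f (π i)) (W.y (π i)) * W.perm π :=
  semiconjBy_chiEval C (fun _ _ _ _ => W.perm_f _ _ _) (W.perm_y _ _)

namespace Cyc

variable (C : CycParam F)

variable (D) in
/-- The canonical projection. -/
noncomputable def mk (n : ℕ) : Affine D n →ₐ[k] Cyc D C n := (cycIdeal D C n).ringCon.mkₐ k

theorem mk_surjective (n : ℕ) : Function.Surjective (mk D C n) :=
  RingCon.mkₐ_surjective _

theorem mk_eq_zero {n : ℕ} {z : Affine D n} : mk D C n z = 0 ↔ z ∈ cycIdeal D C n := by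
  rw [TwoSidedIdeal.mem_iff]
  exact RingCon.eq (cycIdeal D C n).ringCon

variable (D) in
/-- The tautological realisation. -/
noncomputable def rep (n : ℕ) : AffineRep D n (Cyc D C n) := (Affine.rep D n).map (mk D C n)

theorem chiEval_eq_zero {n : ℕ} {i : Fin n} (hi : i.val = 0) :
    chiEval D C ((rep D C n).f i) ((rep D C n).x i) = 0 := by
  have h : mk D C n (chi D C i) = 0 :=
    (mk_eq_zero C).2 (TwoSidedIdeal.subset_span ⟨i, hi, rfl⟩)
  rw [chi_eq_chiEval, map_chiEval] at h
  exact h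

/-- The `y_i` are conjugate under transpositions, so the relation `χ(y_1) = 0` spreads to every
position. This is the form in which it enters the induced module. -/
theorem chiEval_dunkl_eq_zero {n : ℕ} (i : Fin n) :
    chiEval D C ((rep D C n).f i) ((rep D C n).toDunklRep.y i) = 0 := by
  let z : Fin n := ⟨0, i.pos⟩
  have h := (rep D C n).toDunklRep.perm_chiEval C (Equiv.swap z i) z
  rw [← AffineRep.x_first _ (i := z) rfl] at h
  change (rep D C n).perm _ * chiEval D C ((rep D C n).f z) _ = _ at h
  rw [chiEval_eq_zero C rfl, mul_zero, Equiv.swap_apply_left] at h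
  have h2 := congrArg (· * (rep D C n).perm (Equiv.swap z i)) h
  simp only [zero_mul, mul_assoc] at h2
  change 0 = _ * ((rep D C n).perm (Equiv.swap z i) * (rep D C n).perm (Equiv.swap z i)) at h2
  rw [WreathRep.perm_swap_mul_self, mul_one] at h2
  exact h2.symm

variable {C}

/-- The homomorphism from the cyclotomic quotient. -/
noncomputable def lift {n : ℕ} (W : AffineRep D n R)
    (hW : ∀ i : Fin n, i.val = 0 → chiEval D C (W.f i) (W.x i) = 0) : Cyc D C n →ₐ[k] R :=
  RingCon.liftₐ (cycIdeal D C n).ringCon W.lift (by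
    have h1 : cycIdeal D C n ≤ TwoSidedIdeal.ker W.lift := by
      refine TwoSidedIdeal.span_le.2 ?_
      rintro _ ⟨i, hi, rfl⟩
      rw [SetLike.mem_coe, TwoSidedIdeal.mem_ker, W.lift_chi]
      exact hW i hi
    exact fun _ _ h => TwoSidedIdeal.ringCon_le_iff.1 h1 h)

theorem lift_gen {n : ℕ} (W : AffineRep D n R) (hW) (g : Gen F n) :
    lift (C := C) W hW (gen D C g) = W.onGen g :=
  W.lift_gen g

variable (C) in
theorem adjoin_gen (n : ℕ) : Algebra.adjoin k (Set.range (gen D C (n := n))) = ⊤ := by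
  have h : Set.range (gen D C (n := n)) = mk D C n '' Set.range (Affine.gen D) := by
    rw [← Set.range_comp]; rfl
  rw [h, ← AlgHom.map_adjoin, Affine.adjoin_gen, Algebra.map_top, AlgHom.range_eq_top]
  exact mk_surjective C n

/-- The parity automorphism. -/
noncomputable def parity
    (hdeg : ∀ m ∈ Finset.Icc 1 D.θ, ∀ j ∈ Finset.Icc 1 (C.e m), C.c m j ∈ D.grade (m * D.δ, 0))
    (n : ℕ) : Cyc D C n →ₐ[k] Cyc D C n :=
  lift (rep D C n).parityTwist fun i hi => by
    rw [← chiEval_eq_zero C hi]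
    refine chiEval_congr C _ fun m hm j hj => ?_
    change (rep D C n).f i (D.parity (C.c m j)) = _
    rw [D.parity_even (hdeg m hm j hj) rfl]

end Cyc

end AffineWreath

/-! ### The module `F[x] ⊗ A` -/

namespace AffineWreath

open TensorProduct

variable {k F : Type*} [CommRing k] [Ring F] [Algebra k F]

namespace FrobeniusSuperalgebra

variable (D : FrobeniusSuperalgebra k F)

/-- The powers of the Nakayama automorphism as algebra homomorphisms. -/
noncomputable def nakayamaPow (m : ℕ) : F →ₐ[k] F :=
  AlgHom.ofLinearMap (D.nakayama ^ m) (D.nakayama_pow_one m) (D.nakayama_pow_mul m)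

theorem nakayamaPow_apply (m : ℕ) (a : F) : D.nakayamaPow m a = (D.nakayama ^ m) a := rfl

theorem parityProj_comp (ε η : ZMod 2) :
    D.parityProj ε ∘ₗ D.parityProj η = if ε = η then D.parityProj ε else 0 := by
  refine LinearMap.ext fun a => ?_
  refine TensorRep.ext_homogeneous (D := D) (fun p a ha => ?_) a
  rw [LinearMap.comp_apply, parityProj, parityProj, D.weight_apply _ ha, map_smul,
    D.weight_apply _ ha]
  by_cases h : ε = η
  · subst h
    rw [if_pos rfl, D.weight_apply _ ha]
    split_ifs <;> simp
  · rw [if_neg h]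
    split_ifs with h1 h2
    · exact absurd (h2.symm.trans h1) h
    all_goals simp

theorem parityProj_add : D.parityProj 0 + D.parityProj 1 = LinearMap.id := by
  refine LinearMap.ext fun a => ?_
  refine TensorRep.ext_homogeneous (D := D) (fun p a ha => ?_) a
  rw [LinearMap.add_apply, parityProj, parityProj, D.weight_apply _ ha, D.weight_apply _ ha,
    LinearMap.id_apply]
  have : p.2 = 0 ∨ p.2 = 1 := by
    have : ∀ e : ZMod 2, e = 0 ∨ e = 1 := by decide
    exact this _
  rcases this with h | h <;> simp [h]

end FrobeniusSuperalgebra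

variable {D : FrobeniusSuperalgebra k F}

/-- A parity automorphism of a realisation. -/
structure AffineRep.IsParity {n : ℕ} {A : Type*} [Ring A] [Algebra k A] (U : AffineRep D n A)
    (γ : A →ₐ[k] A) : Prop where
  x : ∀ i, γ (U.x i) = U.x i
  f : ∀ i a, γ (U.f i a) = U.f i (D.parity a)
  perm : ∀ π, γ (U.perm π) = U.perm π

/-- Diagonal endomorphisms of finitely supported functions. -/
noncomputable def finsuppDiag (k V : Type*) [CommRing k] [AddCommGroup V] [Module k V] :
    (ℕ → Module.End k V) →ₐ[k] Module.End k (ℕ →₀ V) where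
  toFun O := Finsupp.lsum k fun m => Finsupp.lsingle m ∘ₗ O m
  map_one' := by ext; simp
  map_mul' _ _ := by ext; simp
  map_zero' := by ext; simp
  map_add' _ _ := by ext; simp
  commutes' r := by ext m v : 2; simp [Algebra.algebraMap_eq_smul_one]

@[simp]
theorem finsuppDiag_single {k V : Type*} [CommRing k] [AddCommGroup V] [Module k V]
    (O : ℕ → Module.End k V) (m : ℕ) (v : V) :
    finsuppDiag k V O (Finsupp.single m v) = Finsupp.single m (O m v) := by
  simp [finsuppDiag]

theorem finsuppDiag_apply {k V : Type*} [CommRing k] [AddCommGroup V] [Module k V]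
    (O : ℕ → Module.End k V) (l : ℕ →₀ V) (m : ℕ) : finsuppDiag k V O l m = O m (l m) := by
  induction l using Finsupp.induction_linear with
  | zero => simp
  | add a b ha hb => rw [map_add, Finsupp.add_apply, ha, hb, Finsupp.add_apply, map_add]
  | single m' v =>
    rw [finsuppDiag_single]
    by_cases h : m' = m
    · subst h; simp
    · simp [Finsupp.single_eq_of_ne' h]

/-- Diagonal endomorphisms of functions on a finite set. -/
noncomputable def piDiag (k ι L : Type*) [CommRing k] [AddCommGroup L] [Module k L] :
    (ι → Module.End k L) →ₐ[k] Module.End k (ι → L) where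
  toFun O := LinearMap.pi fun j => O j ∘ₗ LinearMap.proj j
  map_one' := rfl
  map_mul' _ _ := rfl
  map_zero' := rfl
  map_add' _ _ := rfl
  commutes' _ := rfl

@[simp]
theorem piDiag_apply {k ι L : Type*} [CommRing k] [AddCommGroup L] [Module k L]
    (O : ι → Module.End k L) (m : ι → L) (j : ι) : piDiag k ι L O m j = O j (m j) := rfl

/-- The action of `A` on `F ⊗ A` by left multiplication on the second factor (with signs). -/
noncomputable def tensorAction (D : FrobeniusSuperalgebra k F) {A : Type*} [Ring A] [Algebra k A]
    (γ : A →ₐ[k] A) : A →ₐ[k] Module.End k (F ⊗[k] A) :=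
  AlgHom.ofLinearMap
    (TensorProduct.mapBilinear (RingHom.id k) F A F A (D.parityProj 0) ∘ₗ LinearMap.mul k A +
      TensorProduct.mapBilinear (RingHom.id k) F A F A (D.parityProj 1) ∘ₗ LinearMap.mul k A ∘ₗ γ.toLinearMap)
    (by
      have h : ∀ a : A, LinearMap.mul k A 1 a = a := by simp
      refine TensorProduct.ext' fun f a => ?_
      have := LinearMap.congr_fun D.parityProj_add f
      simp only [LinearMap.add_apply, LinearMap.id_apply] at this
      simp [← TensorProduct.add_tmul, this])
    (by
      intro a b
      refine TensorProduct.ext' fun f c => ?_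
      have h := fun ε η => LinearMap.congr_fun (D.parityProj_comp ε η) f
      simp only [LinearMap.comp_apply] at h
      simp [h, mul_assoc])

section Model

variable {n : ℕ} {A : Type*} [Ring A] [Algebra k A]

theorem tensorAction_tmul (γ : A →ₐ[k] A) (a : A) (f : F) (b : A) :
    tensorAction D γ a (f ⊗ₜ b) = D.parityProj 0 f ⊗ₜ (a * b) + D.parityProj 1 f ⊗ₜ (γ a * b) := by
  simp [tensorAction]

theorem tensorAction_of_fixed (γ : A →ₐ[k] A) {a : A} (h : γ a = a) (f : F) (b : A) :
    tensorAction D γ a (f ⊗ₜ b) = f ⊗ₜ (a * b) := by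
  rw [tensorAction_tmul, h, ← TensorProduct.add_tmul]
  congr 1
  exact LinearMap.congr_fun D.parityProj_add f

/-- The parity of `a` is expressed by how `γ` scales it; no grading on `A` is required. -/
theorem tensorAction_homogeneous (γ : A →ₐ[k] A) {p q : ℕ × ZMod 2} {a : A}
    (h : γ a = koszul (0, 1) q • a) {f : F} (hf : f ∈ D.grade p) (b : A) :
    tensorAction D γ a (f ⊗ₜ b) = koszul p q • (f ⊗ₜ (a * b)) := by
  rw [tensorAction_tmul, h, FrobeniusSuperalgebra.parityProj, FrobeniusSuperalgebra.parityProj,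
    D.weight_apply _ hf, D.weight_apply _ hf]
  have : p.2 = 0 ∨ p.2 = 1 := by
    have : ∀ e : ZMod 2, e = 0 ∨ e = 1 := by decide
    exact this _
  rcases this with h | h
  · rw [koszul_even_left _ h]
    simp [h]
  · rw [koszul_congr (p' := (0, 1)) (q' := q) h rfl]
    rcases koszul_eq_one_or (0, 1) q with h' | h' <;> simp [h, h', TensorProduct.tmul_neg]

variable (D A) in
/-- The `F`-module `F[x] ⊗ A`. -/
abbrev PolyModule : Type _ := ℕ →₀ (F ⊗[k] A)

namespace PolyModule

variable (k F A) in
/-- Multiplication by the variable. -/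
noncomputable def shift : Module.End k (ℕ →₀ (F ⊗[k] A)) := Finsupp.lmapDomain _ k (· + 1)

@[simp]
theorem shift_single (m : ℕ) (v : F ⊗[k] A) :
    shift k F A (Finsupp.single m v) = Finsupp.single (m + 1) v := by
  simp [shift]

variable (D A) in
/-- The action of `F`. -/
noncomputable def fAct : F →ₐ[k] Module.End k (ℕ →₀ (F ⊗[k] A)) :=
  (finsuppDiag k (F ⊗[k] A)).comp <| AlgHom.pi fun m =>
    (AlgHom.ofLinearMap (LinearMap.rTensorHom A ∘ₗ LinearMap.mul k F)
      (by ext; simp) (by intro a b; ext; simp [mul_assoc])).comp (D.nakayamaPow m)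

theorem fAct_single (a : F) (m : ℕ) (f : F) (b : A) :
    fAct D A a (Finsupp.single m (f ⊗ₜ b)) =
      Finsupp.single m (((D.nakayama ^ m) a * f) ⊗ₜ b) := by
  simp [fAct, FrobeniusSuperalgebra.nakayamaPow_apply]

variable (D) in
/-- The action of `A`. -/
noncomputable def aAct (γ : A →ₐ[k] A) : A →ₐ[k] Module.End k (ℕ →₀ (F ⊗[k] A)) :=
  (finsuppDiag k (F ⊗[k] A)).comp <| AlgHom.pi fun _ => tensorAction D γ

theorem aAct_single (γ : A →ₐ[k] A) (a : A) (m : ℕ) (v : F ⊗[k] A) :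
    aAct D γ a (Finsupp.single m v) = Finsupp.single m (tensorAction D γ a v) := by
  simp [aAct]

theorem end_ext {S : Type*} [AddCommGroup S] [Module k S] {O O' : (ℕ →₀ (F ⊗[k] A)) →ₗ[k] S}
    (h : ∀ m p, ∀ f ∈ D.grade p, ∀ b : A,
      O (Finsupp.single m (f ⊗ₜ b)) = O' (Finsupp.single m (f ⊗ₜ b))) : O = O' := by
  refine Finsupp.lhom_ext' fun m => TensorProduct.ext' fun f b => ?_
  refine TensorRep.ext_homogeneous (D := D)
    (g := O ∘ₗ Finsupp.lsingle m ∘ₗ (TensorProduct.mk k F A).flip b)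
    (h := O' ∘ₗ Finsupp.lsingle m ∘ₗ (TensorProduct.mk k F A).flip b) (fun p a ha => ?_) f
  exact h m p a ha b

/-- On the coefficient of `x^m` the element `f` acts through `ψ^m(f)`, so one more power of the
variable costs one more `ψ`. -/
theorem fAct_shift (a : F) :
    fAct D A a * shift k F A = shift k F A * fAct D A (D.nakayama a) := by
  refine end_ext (D := D) fun m p f _ b => ?_
  simp only [Module.End.mul_apply, shift_single, fAct_single, pow_succ]

theorem aAct_shift (γ : A →ₐ[k] A) (a : A) :
    aAct D γ a * shift k F A = shift k F A * aAct D γ a := by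
  refine end_ext (D := D) fun m p f _ b => ?_
  simp only [Module.End.mul_apply, shift_single, aAct_single]

theorem fAct_aAct (γ : A →ₐ[k] A) {p q : ℕ × ZMod 2} {a : F} (ha : a ∈ D.grade p) {u : A}
    (hu : γ u = koszul (0, 1) q • u) :
    fAct D A a * aAct D γ u = koszul p q • (aAct D γ u * fAct D A a) := by
  refine end_ext (D := D) fun m r f hf b => ?_
  simp only [Module.End.mul_apply, aAct_single, tensorAction_homogeneous γ hu hf, fAct_single,
    LinearMap.smul_apply,
    tensorAction_homogeneous γ hu (SetLike.mul_mem_graded (D.nakayama_pow_mem m ha) hf),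
    ← Finsupp.smul_single, map_zsmul]
  rw [smul_smul, koszul_add_left, ← mul_assoc, koszul_mul_self, one_mul]

theorem aAct_fAct (γ : A →ₐ[k] A) {p q : ℕ × ZMod 2} {a : F} (ha : a ∈ D.grade p) {u : A}
    (hu : γ u = koszul (0, 1) q • u) :
    aAct D γ u * fAct D A a = koszul p q • (fAct D A a * aAct D γ u) := by
  refine end_ext (D := D) fun m r f hf b => ?_
  simp only [Module.End.mul_apply, aAct_single, tensorAction_homogeneous γ hu hf, fAct_single,
    LinearMap.smul_apply,
    tensorAction_homogeneous γ hu (SetLike.mul_mem_graded (D.nakayama_pow_mem m ha) hf),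
    ← Finsupp.smul_single, map_zsmul]
  rw [smul_smul, koszul_add_left]

theorem fAct_aAct_of_fixed (γ : A →ₐ[k] A) (a : F) {u : A} (hu : γ u = u) :
    fAct D A a * aAct D γ u = aAct D γ u * fAct D A a := by
  refine end_ext (D := D) fun m r f hf b => ?_
  simp only [Module.End.mul_apply, aAct_single, tensorAction_of_fixed γ hu, fAct_single]

end PolyModule

open PolyModule

variable {U : AffineRep D n A} {γ : A →ₐ[k] A}

/-- The action of `n + 1` copies of `F` on `F[x] ⊗ A`. -/
noncomputable def polyTensorRep (hγ : U.IsParity γ) :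
    TensorRep D (Fin (n + 1)) (Module.End k (ℕ →₀ (F ⊗[k] A))) where
  f i := Fin.lastCases (fAct D A) (fun i => (aAct D γ).comp (U.f i)) i
  supercomm i j hij p q a b ha hb := by
    have key : ∀ i : Fin n, ∀ p q a b, a ∈ D.grade p → b ∈ D.grade q →
        fAct D A a * aAct D γ (U.f i b) = koszul p q • (aAct D γ (U.f i b) * fAct D A a) :=
      fun i p q a b ha hb => fAct_aAct γ ha (by rw [hγ.f, D.parity_apply hb, map_zsmul])
    induction i using Fin.lastCases with
    | last =>
      induction j using Fin.lastCases with
      | last => exact absurd rfl hij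
      | cast j => simpa using key j p q a b ha hb
    | cast i =>
      induction j using Fin.lastCases with
      | last =>
        simp only [Fin.lastCases_castSucc, Fin.lastCases_last, AlgHom.comp_apply]
        rw [koszul_symm]
        exact aAct_fAct γ hb (by rw [hγ.f, D.parity_apply ha, map_zsmul])
      | cast j =>
        simp only [Fin.lastCases_castSucc, AlgHom.comp_apply, ← map_mul]
        rw [U.supercomm i j (fun h => hij (by rw [h])) p q a b ha hb, map_zsmul]

section

variable (hγ : U.IsParity γ)

@[simp]
theorem polyTensorRep_last (a : F) : (polyTensorRep hγ).f (Fin.last n) a = fAct D A a := by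
  simp [polyTensorRep]

@[simp]
theorem polyTensorRep_castSucc (i : Fin n) (a : F) :
    (polyTensorRep hγ).f i.castSucc a = aAct D γ (U.f i a) := by
  simp [polyTensorRep]

theorem aAct_tel (i j : Fin n) :
    aAct D γ (U.tel i j) = (polyTensorRep hγ).tel i.castSucc j.castSucc := by
  simp [TensorRep.tel]

/-- `x_i` and the permutations are fixed by `γ`. For the teleporters inside `y_i` the signs cancel
in pairs, as seen by `f_comm_tel` for the `n + 1` copies of `F`. -/
theorem fAct_aAct_y (hγ : U.IsParity γ) (a : F) (i : Fin n) :
    fAct D A a * aAct D γ (U.toDunklRep.y i) = aAct D γ (U.toDunklRep.y i) * fAct D A a := by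
  have h1 : ∀ q ∈ Finset.univ.filter (· < i), Commute (fAct D A a) (aAct D γ (U.exch i q)) := by
    intro q _
    rw [WreathRep.exch, map_mul, aAct_tel hγ]
    refine Commute.mul_right ?_ (fAct_aAct_of_fixed γ a (hγ.perm _))
    have := (polyTensorRep hγ).f_comm_tel (i := q.castSucc) (j := i.castSucc) (l := Fin.last n)
      (Fin.castSucc_lt_last _).ne' (Fin.castSucc_lt_last _).ne' a
    rwa [polyTensorRep_last] at this
  have h2 : Commute (fAct D A a) (aAct D γ (DunklRep.jm U.toWreathRep i)) := by
    rw [DunklRep.jm, map_sum]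
    exact Commute.sum_right _ _ _ h1
  have h3 : Commute (fAct D A a) (aAct D γ (U.x i)) := fAct_aAct_of_fixed γ a (hγ.x i)
  change Commute _ (aAct D γ (U.x i - DunklRep.jm U.toWreathRep i))
  rw [map_sub]
  exact Commute.sub_right (R := Module.End k (ℕ →₀ (F ⊗[k] A))) h3 h2

theorem polyPerm_f (π : Equiv.Perm (Fin n)) (i : Fin (n + 1)) (a : F) :
    aAct D γ (U.perm π) * (polyTensorRep hγ).f i a =
      (polyTensorRep hγ).f (Affine.extendPerm π i) a * aAct D γ (U.perm π) := by
  induction i using Fin.lastCases with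
  | last =>
    rw [Affine.extendPerm_last, polyTensorRep_last, fAct_aAct_of_fixed γ a (hγ.perm π)]
  | cast i =>
    rw [Affine.extendPerm_castSucc, polyTensorRep_castSucc, polyTensorRep_castSucc, ← map_mul,
      U.perm_f, map_mul]

theorem polyPerm_tel (π : Equiv.Perm (Fin n)) (i j : Fin (n + 1)) :
    aAct D γ (U.perm π) * (polyTensorRep hγ).tel i j =
      (polyTensorRep hγ).tel (Affine.extendPerm π i) (Affine.extendPerm π j) *
        aAct D γ (U.perm π) := by
  simp only [TensorRep.tel, Finset.mul_sum, Finset.sum_mul]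
  refine Finset.sum_congr rfl fun b _ => ?_
  rw [← mul_assoc, polyPerm_f, mul_assoc, polyPerm_f, mul_assoc]

end

end Model

end AffineWreath

/-! ### Coset representatives and the induced module -/

namespace AffineWreath

open TensorProduct PolyModule

variable {k F : Type*} [CommRing k] [Ring F] [Algebra k F] {D : FrobeniusSuperalgebra k F}

namespace Affine

theorem extendPerm_injective {n : ℕ} : Function.Injective (extendPerm (n := n)) := by
  intro π σ h
  ext i
  have := congrArg (fun g => g i.castSucc) h
  simp only [extendPerm_castSucc] at this
  exact congrArg Fin.val (Fin.castSucc_injective _ this)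

theorem exists_extendPerm {n : ℕ} {g : Equiv.Perm (Fin (n + 1))}
    (hg : g (Fin.last n) = Fin.last n) : ∃ h, extendPerm h = g := by
  have key : ∀ g : Equiv.Perm (Fin (n + 1)), g (Fin.last n) = Fin.last n →
      ∀ i : Fin n, g i.castSucc ≠ Fin.last n := fun g hg i h =>
    (Fin.castSucc_lt_last i).ne (g.injective (h.trans hg.symm))
  have hg' : g⁻¹ (Fin.last n) = Fin.last n := by rw [Equiv.Perm.inv_eq_iff_eq, hg]
  refine ⟨⟨fun i => (g i.castSucc).castPred (key g hg i),
    fun i => (g⁻¹ i.castSucc).castPred (key g⁻¹ hg' i), fun i => ?_, fun i => ?_⟩, ?_⟩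
  · apply Fin.castSucc_injective; simp
  · apply Fin.castSucc_injective; simp
  · ext j
    induction j using Fin.lastCases with
    | last => rw [extendPerm_last, hg]
    | cast j => rw [extendPerm_castSucc]; simp

/-- The transpositions `(j, n)`, which represent the cosets of `S_n` in `S_{n+1}`. -/
def coset {n : ℕ} (j : Fin (n + 1)) : Equiv.Perm (Fin (n + 1)) := Equiv.swap j (Fin.last n)

@[simp]
theorem coset_self {n : ℕ} (j : Fin (n + 1)) : coset j j = Fin.last n := Equiv.swap_apply_left _ _

@[simp]
theorem coset_apply_last {n : ℕ} (j : Fin (n + 1)) : coset j (Fin.last n) = j :=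
  Equiv.swap_apply_right _ _

@[simp]
theorem coset_last (n : ℕ) : coset (Fin.last n) = 1 := Equiv.swap_self _

theorem coset_of_ne {n : ℕ} {j : Fin (n + 1)} {p : Fin n} (h : p.castSucc ≠ j) :
    coset j p.castSucc = p.castSucc :=
  Equiv.swap_apply_of_ne_of_ne h (Fin.castSucc_lt_last p).ne

@[simp]
theorem coset_mul_self {n : ℕ} (j : Fin (n + 1)) : coset j * coset j = 1 :=
  Equiv.swap_mul_self _ _

@[simp]
theorem coset_mul_self_mul {n : ℕ} (j : Fin (n + 1)) (g : Equiv.Perm (Fin (n + 1))) :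
    coset j * (coset j * g) = g := by
  rw [← mul_assoc, coset_mul_self, one_mul]

@[simp]
theorem coset_coset {n : ℕ} (j i : Fin (n + 1)) : coset j (coset j i) = i :=
  Equiv.swap_apply_self _ _ _

/-- The product fixes the last position: it goes to `j`, then to `σ j`, then back. Hence it comes
from `S_n`. -/
theorem exists_cocycle {n : ℕ} (σ : Equiv.Perm (Fin (n + 1))) (j : Fin (n + 1)) :
    ∃ h, extendPerm h = coset (σ j) * σ * coset j :=
  exists_extendPerm (by simp)

/-- The permutation `h` with `σ (j, n) = (σ(j), n) h`. -/
noncomputable def cocycle {n : ℕ} (σ : Equiv.Perm (Fin (n + 1))) (j : Fin (n + 1)) :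
    Equiv.Perm (Fin n) := (exists_cocycle σ j).choose

theorem extendPerm_cocycle {n : ℕ} (σ : Equiv.Perm (Fin (n + 1))) (j : Fin (n + 1)) :
    extendPerm (cocycle σ j) = coset (σ j) * σ * coset j := (exists_cocycle σ j).choose_spec

theorem cocycle_eq {n : ℕ} {σ : Equiv.Perm (Fin (n + 1))} {j : Fin (n + 1)}
    {h : Equiv.Perm (Fin n)} (H : coset (σ j) * σ * coset j = extendPerm h) : cocycle σ j = h :=
  extendPerm_injective ((extendPerm_cocycle σ j).trans H)

theorem cocycle_one {n : ℕ} (j : Fin (n + 1)) : cocycle 1 j = 1 :=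
  cocycle_eq (by simp)

theorem cocycle_mul {n : ℕ} (σ τ : Equiv.Perm (Fin (n + 1))) (j : Fin (n + 1)) :
    cocycle (σ * τ) j = cocycle σ (τ j) * cocycle τ j :=
  cocycle_eq (by rw [map_mul, extendPerm_cocycle, extendPerm_cocycle]; simp [mul_assoc])

theorem coset_extendPerm {n : ℕ} (g : Equiv.Perm (Fin n)) (j : Fin (n + 1)) :
    coset (extendPerm g j) * extendPerm g = extendPerm g * coset j := by
  rw [coset, coset, Equiv.mul_swap_eq_swap_mul, extendPerm_last]

theorem cocycle_extendPerm {n : ℕ} (g : Equiv.Perm (Fin n)) (j : Fin (n + 1)) :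
    cocycle (extendPerm g) j = g :=
  cocycle_eq (by rw [coset_extendPerm, mul_assoc, coset_mul_self, mul_one])

theorem cocycle_coset {n : ℕ} (j : Fin (n + 1)) : cocycle (coset j) (Fin.last n) = 1 :=
  cocycle_eq (by simp)

end Affine

open AffineWreath.Affine

namespace DunklRep

variable {ι R : Type*} [Ring R] [Algebra k R] [DecidableEq ι] (W : DunklRep D ι R)

/-- The obstruction to integrability. -/
noncomputable def obstruction (i j : ι) : R :=
  W.y i * (W.y j + W.exch j i) - (W.y j + W.exch j i) * W.y i

theorem integrable_iff {i j : ι} : W.Integrable i j ↔ W.obstruction i j = 0 :=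
  sub_eq_zero.symm

theorem obstruction_symm {i j : ι} (hij : i ≠ j) : W.obstruction j i = -W.obstruction i j := by
  rw [obstruction, obstruction, mul_add, add_mul, mul_add, add_mul, W.exch_y hij,
    W.exch_y hij.symm]
  abel

/-- This equivariance reduces integrability on the induced module to vectors in a single coset copy.
-/
theorem perm_obstruction (π : Equiv.Perm ι) (i j : ι) :
    W.perm π * W.obstruction i j = W.obstruction (π i) (π j) * W.perm π := by
  have h : W.perm π * (W.y j + W.exch j i) =
      (W.y (π j) + W.exch (π j) (π i)) * W.perm π := by
    rw [mul_add, add_mul, W.perm_y, W.perm_exch]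
  rw [obstruction, obstruction, mul_sub, sub_mul, ← mul_assoc, W.perm_y, mul_assoc, h, mul_assoc,
    ← mul_assoc (W.perm π), h, mul_assoc, W.perm_y, mul_assoc]

end DunklRep

section Model

variable {n : ℕ} {A : Type*} [Ring A] [Algebra k A] {U : AffineRep D n A} {γ : A →ₐ[k] A}
  (hγ : U.IsParity γ)

variable (k F A n) in
/-- The module underlying the induced representation. -/
abbrev IndModule : Type _ := Fin (n + 1) → ℕ →₀ (F ⊗[k] A)

namespace IndModule

/-- The action of permutations on the induced module. -/
noncomputable def permAct (U : AffineRep D n A) (γ : A →ₐ[k] A) (σ : Equiv.Perm (Fin (n + 1))) :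
    Module.End k (IndModule k F n A) :=
  LinearMap.pi fun j => aAct D γ (U.perm (cocycle σ (σ⁻¹ j))) ∘ₗ LinearMap.proj (σ⁻¹ j)

theorem permAct_apply (σ : Equiv.Perm (Fin (n + 1))) (m : IndModule k F n A) (j : Fin (n + 1)) :
    permAct U γ σ m (σ j) = aAct D γ (U.perm (cocycle σ j)) (m j) := by
  simp [permAct]

theorem ext_perm (σ : Equiv.Perm (Fin (n + 1))) {m m' : IndModule k F n A}
    (h : ∀ j, m (σ j) = m' (σ j)) : m = m' := by
  funext j
  obtain ⟨j, rfl⟩ := σ.surjective j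
  exact h j

/-- The induced representation of the wreath product. -/
noncomputable def wreathRep : WreathRep D (Fin (n + 1)) (Module.End k (IndModule k F n A)) where
  f i := (piDiag k (Fin (n + 1)) (ℕ →₀ (F ⊗[k] A))).comp <|
    AlgHom.pi fun j => (polyTensorRep hγ).f (coset j i)
  supercomm i j hij p q a b ha hb := by
    refine LinearMap.ext fun m => funext fun l => ?_
    have := LinearMap.congr_fun ((polyTensorRep hγ).supercomm (coset l i) (coset l j)
      (fun h => hij ((coset l).injective h)) p q a b ha hb) (m l)
    exact this
  perm :=
    { toFun := permAct U γ
      map_one' := by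
        refine LinearMap.ext fun m => funext fun j => ?_
        have := permAct_apply (U := U) (γ := γ) 1 m j
        rw [Equiv.Perm.one_apply, cocycle_one, map_one, map_one] at this
        exact this
      map_mul' := fun σ τ => by
        refine LinearMap.ext fun m => ext_perm (σ * τ) fun j => ?_
        rw [permAct_apply, Module.End.mul_apply, Equiv.Perm.mul_apply, permAct_apply,
          permAct_apply, cocycle_mul, map_mul, map_mul, Module.End.mul_apply] }
  perm_f σ i a := by
    refine LinearMap.ext fun m => ext_perm σ fun j => ?_
    change permAct U γ σ _ (σ j) = (polyTensorRep hγ).f (coset (σ j) (σ i)) a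
      (permAct U γ σ m (σ j))
    rw [permAct_apply, permAct_apply]
    have h := LinearMap.congr_fun (polyPerm_f hγ (cocycle σ j) (coset j i) a) (m j)
    rw [extendPerm_cocycle] at h
    simpa using h

theorem wreathRep_f_apply (i : Fin (n + 1)) (a : F) (m : IndModule k F n A) (j : Fin (n + 1)) :
    (wreathRep hγ).f i a m j = (polyTensorRep hγ).f (coset j i) a (m j) := rfl

theorem wreathRep_perm_apply (σ : Equiv.Perm (Fin (n + 1))) (m : IndModule k F n A)
    (j : Fin (n + 1)) :
    (wreathRep hγ).perm σ m (σ j) = aAct D γ (U.perm (cocycle σ j)) (m j) :=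
  permAct_apply _ _ _

theorem wreathRep_perm_extendPerm (g : Equiv.Perm (Fin n)) (m : IndModule k F n A)
    (j : Fin (n + 1)) :
    (wreathRep hγ).perm (extendPerm g) m (extendPerm g j) = aAct D γ (U.perm g) (m j) := by
  rw [wreathRep_perm_apply, cocycle_extendPerm]

theorem wreathRep_tel_apply (i i' : Fin (n + 1)) (m : IndModule k F n A) (j : Fin (n + 1)) :
    (wreathRep hγ).tel i i' m j = (polyTensorRep hγ).tel (coset j i) (coset j i') (m j) := by
  simp [TensorRep.tel, wreathRep_f_apply]

/-- The action of `y_{n+1}`. -/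
noncomputable def yLast : Module.End k (IndModule k F n A) :=
  LinearMap.pi fun j => Fin.lastCases (shift k F A ∘ₗ LinearMap.proj (Fin.last n))
    (fun q => aAct D γ (U.toDunklRep.y q) ∘ₗ LinearMap.proj q.castSucc -
      (polyTensorRep hγ).tel (Fin.last n) q.castSucc ∘ₗ LinearMap.proj (Fin.last n)) j

@[simp]
theorem yLast_last (m : IndModule k F n A) :
    yLast hγ m (Fin.last n) = shift k F A (m (Fin.last n)) := by
  simp [yLast]

@[simp]
theorem yLast_castSucc (m : IndModule k F n A) (q : Fin n) :
    yLast hγ m q.castSucc = aAct D γ (U.toDunklRep.y q) (m q.castSucc) -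
      (polyTensorRep hγ).tel (Fin.last n) q.castSucc (m (Fin.last n)) := by
  simp [yLast]

/-- Commutation with the stabiliser `S_n` of the last position is what makes the conjugates of
`yLast` a family indexed by positions. -/
theorem perm_yLast (g : Equiv.Perm (Fin n)) :
    (wreathRep hγ).perm (extendPerm g) * yLast hγ =
      yLast hγ * (wreathRep hγ).perm (extendPerm g) := by
  refine LinearMap.ext fun m => ext_perm (extendPerm g) fun j => ?_
  rw [Module.End.mul_apply, Module.End.mul_apply, wreathRep_perm_extendPerm]
  have hl := wreathRep_perm_extendPerm hγ g m (Fin.last n)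
  rw [extendPerm_last] at hl
  induction j using Fin.lastCases with
  | last =>
    rw [extendPerm_last, yLast_last, yLast_last, hl]
    exact LinearMap.congr_fun (aAct_shift γ _) _
  | cast q =>
    have hq := wreathRep_perm_extendPerm hγ g m q.castSucc
    have ht := LinearMap.congr_fun (polyPerm_tel hγ g (Fin.last n) q.castSucc) (m (Fin.last n))
    rw [extendPerm_castSucc] at hq
    rw [extendPerm_last] at ht
    have hy := congrArg (aAct D γ) (U.toDunklRep.perm_y g q)
    rw [map_mul, map_mul] at hy
    have hy := LinearMap.congr_fun hy (m q.castSucc)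
    simp only [Module.End.mul_apply, extendPerm_castSucc] at ht hy ⊢
    rw [yLast_castSucc, yLast_castSucc, map_sub, ht, hq, hl]
    exact congrArg₂ (· - ·) hy rfl

theorem f_last_yLast (a : F) :
    (wreathRep hγ).f (Fin.last n) a * yLast hγ =
      yLast hγ * (wreathRep hγ).f (Fin.last n) (D.nakayama a) := by
  refine LinearMap.ext fun m => funext fun j => ?_
  rw [Module.End.mul_apply, Module.End.mul_apply, wreathRep_f_apply, coset_apply_last]
  induction j using Fin.lastCases with
  | last =>
    rw [yLast_last, yLast_last, wreathRep_f_apply, coset_last, Equiv.Perm.one_apply,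
      polyTensorRep_last, polyTensorRep_last]
    exact LinearMap.congr_fun (fAct_shift a) _
  | cast q =>
    rw [yLast_castSucc, yLast_castSucc, wreathRep_f_apply, wreathRep_f_apply, coset_last,
      coset_apply_last, Equiv.Perm.one_apply, map_sub]
    have h1 := LinearMap.congr_fun ((polyTensorRep hγ).f_mul_tel'
      (Fin.castSucc_lt_last q).ne' a) (m (Fin.last n))
    have h2 := congrArg (aAct D γ) (U.toDunklRep.f_y_same q a)
    rw [map_mul, map_mul] at h2
    have h2 := LinearMap.congr_fun h2 (m q.castSucc)
    rw [polyTensorRep_castSucc, polyTensorRep_castSucc]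
    rw [polyTensorRep_castSucc] at h1
    exact congrArg₂ (· - ·) h2 h1

/-- On the copy indexed by `p` itself the element acts as `f_{n+1}`: it commutes with `y_p`, and the
teleporter term moves it between positions `n + 1` and `p`. On every other copy it misses both
positions of the teleporter. -/
theorem f_castSucc_yLast (p : Fin n) (a : F) :
    (wreathRep hγ).f p.castSucc a * yLast hγ = yLast hγ * (wreathRep hγ).f p.castSucc a := by
  refine LinearMap.ext fun m => funext fun j => ?_
  rw [Module.End.mul_apply, Module.End.mul_apply, wreathRep_f_apply]
  induction j using Fin.lastCases with
  | last =>
    rw [yLast_last, yLast_last, wreathRep_f_apply, coset_last, Equiv.Perm.one_apply,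
      polyTensorRep_castSucc]
    exact LinearMap.congr_fun (aAct_shift γ _) _
  | cast q =>
    rw [yLast_castSucc, yLast_castSucc, wreathRep_f_apply, wreathRep_f_apply, coset_last,
      Equiv.Perm.one_apply, map_sub]
    by_cases h : p = q
    · subst h
      rw [coset_self]
      have h1 := LinearMap.congr_fun ((polyTensorRep hγ).f_mul_tel (Fin.last n) p.castSucc a)
        (m (Fin.last n))
      have h2 := LinearMap.congr_fun (fAct_aAct_y hγ a p) (m p.castSucc)
      refine congrArg₂ (· - ·) ?_ h1
      rw [polyTensorRep_last]
      exact h2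
    · have hpq : p.castSucc ≠ q.castSucc := fun h' => h (Fin.castSucc_injective _ h')
      rw [coset_of_ne hpq]
      have h1 := LinearMap.congr_fun ((polyTensorRep hγ).f_comm_tel (l := p.castSucc)
        (i := Fin.last n) (j := q.castSucc) (Fin.castSucc_lt_last p).ne hpq a) (m (Fin.last n))
      have h2 := congrArg (aAct D γ) (U.toDunklRep.f_y_ne q p h a)
      rw [map_mul, map_mul] at h2
      have h2 := LinearMap.congr_fun h2 (m q.castSucc)
      refine congrArg₂ (· - ·) ?_ h1
      rw [polyTensorRep_castSucc]
      exact h2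

theorem perm_coset_mul_self (i : Fin (n + 1)) :
    (wreathRep hγ).perm (coset i) * (wreathRep hγ).perm (coset i) = 1 := by
  rw [← map_mul, coset_mul_self, map_one]

/-- The induced representation. -/
noncomputable def dunklRep : DunklRep D (Fin (n + 1)) (Module.End k (IndModule k F n A)) where
  toWreathRep := wreathRep hγ
  y i := (wreathRep hγ).perm (coset i) * yLast hγ * (wreathRep hγ).perm (coset i)
  perm_y π i := by
    obtain ⟨g, hg⟩ := exists_cocycle π i
    -- Both ways of comparing `π` with the coset representatives involve the same `g` from `S_n`,
    -- which passes through `yLast` in between.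
    have h1 : π * coset i = coset (π i) * extendPerm g := by rw [hg]; simp [mul_assoc]
    have h2 : extendPerm g * coset i = coset (π i) * π := by rw [hg]; simp [mul_assoc]
    rw [← mul_assoc, ← mul_assoc, ← map_mul, h1, map_mul, mul_assoc _ _ (yLast hγ), perm_yLast,
      mul_assoc, mul_assoc, ← map_mul, h2, map_mul]
    simp only [mul_assoc]
  f_y_same i a := by
    have h1 := (wreathRep hγ).perm_f (coset i) (Fin.last n)
    have h2 := (wreathRep hγ).perm_f (coset i) i
    rw [coset_apply_last] at h1
    rw [coset_self] at h2
    rw [← mul_assoc, ← mul_assoc, ← h1, mul_assoc _ _ (yLast hγ), f_last_yLast, mul_assoc,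
      mul_assoc, ← h2]
    simp only [mul_assoc]
  f_y_ne i j hij a := by
    have h1 := (wreathRep hγ).perm_f (coset i) (coset i j)
    have h2 := (wreathRep hγ).perm_f (coset i) j
    rw [coset_coset] at h1
    have h3 : coset i j ≠ Fin.last n := fun h => hij ((coset i).injective (h.trans (coset_self i).symm))
    obtain ⟨p, hp⟩ := Fin.exists_castSucc_eq.2 h3
    rw [← hp] at h1 h2
    rw [← mul_assoc, ← mul_assoc, ← h1, mul_assoc _ _ (yLast hγ), f_castSucc_yLast, mul_assoc,
      mul_assoc, ← h2]
    simp only [mul_assoc]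

variable (k F n A) in
/-- The inclusion of `F[x] ⊗ A`. -/
noncomputable def inj : (ℕ →₀ (F ⊗[k] A)) →ₗ[k] IndModule k F n A :=
  LinearMap.single k (fun _ => ℕ →₀ (F ⊗[k] A)) (Fin.last n)

theorem inj_last (l : ℕ →₀ (F ⊗[k] A)) : inj k F n A l (Fin.last n) = l := by simp [inj]

theorem inj_castSucc (l : ℕ →₀ (F ⊗[k] A)) (q : Fin n) : inj k F n A l q.castSucc = 0 := by
  simp [inj, (Fin.castSucc_lt_last q).ne]

/-- Every coordinate of the induced module is thus a translate of the last one, so operators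
compatible with permutations are determined by their values on the image of `inj`. -/
theorem perm_coset_inj (j : Fin (n + 1)) (l : ℕ →₀ (F ⊗[k] A)) :
    (wreathRep hγ).perm (coset j) (inj k F n A l) = Pi.single j l := by
  refine ext_perm (coset j) fun i => ?_
  rw [wreathRep_perm_apply]
  by_cases hi : i = Fin.last n
  · subst hi
    rw [cocycle_coset, map_one, map_one, inj_last, coset_apply_last, Pi.single_eq_same]
    rfl
  · obtain ⟨q, rfl⟩ := Fin.exists_castSucc_eq.2 hi
    rw [inj_castSucc, map_zero, Pi.single_eq_of_ne]
    intro h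
    exact hi ((coset j).injective (h.trans (coset_apply_last j).symm))

theorem perm_coset_single (j : Fin (n + 1)) (l : ℕ →₀ (F ⊗[k] A)) :
    (wreathRep hγ).perm (coset j) (Pi.single j l) = inj k F n A l := by
  rw [← perm_coset_inj hγ, ← Module.End.mul_apply, perm_coset_mul_self, Module.End.one_apply]

theorem f_inj (i : Fin (n + 1)) (a : F) (l : ℕ →₀ (F ⊗[k] A)) :
    (wreathRep hγ).f i a (inj k F n A l) = inj k F n A ((polyTensorRep hγ).f i a l) := by
  funext j
  rw [wreathRep_f_apply]
  induction j using Fin.lastCases with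
  | last => rw [inj_last, inj_last, coset_last, Equiv.Perm.one_apply]
  | cast q => rw [inj_castSucc, inj_castSucc, map_zero]

theorem perm_inj (g : Equiv.Perm (Fin n)) (l : ℕ →₀ (F ⊗[k] A)) :
    (wreathRep hγ).perm (extendPerm g) (inj k F n A l) =
      inj k F n A (aAct D γ (U.perm g) l) := by
  refine ext_perm (extendPerm g) fun j => ?_
  rw [wreathRep_perm_extendPerm]
  induction j using Fin.lastCases with
  | last => rw [inj_last, extendPerm_last, inj_last]
  | cast q => rw [inj_castSucc, extendPerm_castSucc, inj_castSucc, map_zero]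

theorem tel_inj (i j : Fin (n + 1)) (l : ℕ →₀ (F ⊗[k] A)) :
    (wreathRep hγ).tel i j (inj k F n A l) = inj k F n A ((polyTensorRep hγ).tel i j l) := by
  simp [TensorRep.tel, f_inj]

theorem yLast_single (q : Fin n) (l : ℕ →₀ (F ⊗[k] A)) :
    yLast hγ (Pi.single q.castSucc l) =
      Pi.single q.castSucc (aAct D γ (U.toDunklRep.y q) l) := by
  have h0 : (Pi.single q.castSucc l : IndModule k F n A) (Fin.last n) = 0 :=
    Pi.single_eq_of_ne (Fin.castSucc_lt_last q).ne' _
  funext j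
  induction j using Fin.lastCases with
  | last =>
    rw [yLast_last, h0, map_zero, Pi.single_eq_of_ne (Fin.castSucc_lt_last q).ne']
  | cast p =>
    rw [yLast_castSucc, h0, map_zero, sub_zero]
    by_cases h : p = q
    · subst h; simp
    · have hpq : p.castSucc ≠ q.castSucc := fun h' => h (Fin.castSucc_injective _ h')
      rw [Pi.single_eq_of_ne hpq, Pi.single_eq_of_ne hpq, map_zero]

theorem y_castSucc_inj (p : Fin n) (l : ℕ →₀ (F ⊗[k] A)) :
    (dunklRep hγ).y p.castSucc (inj k F n A l) =
      inj k F n A (aAct D γ (U.toDunklRep.y p) l) := by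
  change (wreathRep hγ).perm (coset p.castSucc) (yLast hγ ((wreathRep hγ).perm (coset p.castSucc)
    (inj k F n A l))) = _
  rw [perm_coset_inj, yLast_single, perm_coset_single]

theorem exch_castSucc_inj (p q : Fin n) (l : ℕ →₀ (F ⊗[k] A)) :
    (wreathRep hγ).exch p.castSucc q.castSucc (inj k F n A l) =
      inj k F n A (aAct D γ (U.exch p q) l) := by
  rw [WreathRep.exch, Module.End.mul_apply, ← extendPerm_swap, perm_inj, tel_inj,
    WreathRep.exch, map_mul, aAct_tel hγ, Module.End.mul_apply]

theorem exch_last_inj (q : Fin n) (l : ℕ →₀ (F ⊗[k] A)) :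
    (wreathRep hγ).exch (Fin.last n) q.castSucc (inj k F n A l) =
      Pi.single q.castSucc ((polyTensorRep hγ).tel (Fin.last n) q.castSucc l) := by
  rw [WreathRep.exch, Module.End.mul_apply, Equiv.swap_comm]
  change (wreathRep hγ).tel _ _ ((wreathRep hγ).perm (coset q.castSucc) _) = _
  rw [perm_coset_inj]
  funext j
  rw [wreathRep_tel_apply]
  by_cases h : j = q.castSucc
  · subst h; rw [Pi.single_eq_same, Pi.single_eq_same, coset_self, coset_apply_last]
  · rw [Pi.single_eq_of_ne h, Pi.single_eq_of_ne h, map_zero]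

theorem filter_lt_last : (Finset.univ.filter (· < Fin.last n)) =
    Finset.univ.map Fin.castSuccEmb := by
  ext j
  induction j using Fin.lastCases with
  | last => simp [(Fin.castSucc_lt_last _).ne]
  | cast j => simp [Fin.castSucc_lt_last]

theorem filter_lt_castSucc (i : Fin n) : (Finset.univ.filter (· < i.castSucc)) =
    (Finset.univ.filter (· < i)).map Fin.castSuccEmb := by
  ext j
  induction j using Fin.lastCases with
  | last => simp [(Fin.castSucc_lt_last _).ne, (Fin.castSucc_lt_last _).le]
  | cast j => simp

/-- The teleporter terms subtracted in `yLast` cancel one by one against the summands of `jm` for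
the last position; they were put there for this purpose. -/
theorem x_last_inj (l : ℕ →₀ (F ⊗[k] A)) :
    ((dunklRep hγ).y (Fin.last n) + DunklRep.jm (wreathRep hγ) (Fin.last n)) (inj k F n A l) =
      inj k F n A (shift k F A l) := by
  have h1 : (dunklRep hγ).y (Fin.last n) = yLast hγ := by
    change (wreathRep hγ).perm (coset _) * yLast hγ * (wreathRep hγ).perm (coset _) = _
    rw [coset_last, map_one, one_mul, mul_one]
  rw [LinearMap.add_apply, h1, DunklRep.jm, filter_lt_last, Finset.sum_map, LinearMap.sum_apply]
  simp only [Fin.coe_castSuccEmb, exch_last_inj]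
  funext j
  rw [Pi.add_apply, Finset.sum_apply]
  induction j using Fin.lastCases with
  | last =>
    rw [yLast_last, inj_last, inj_last, Finset.sum_eq_zero, add_zero]
    exact fun q _ => Pi.single_eq_of_ne (Fin.castSucc_lt_last q).ne' _
  | cast p =>
    rw [yLast_castSucc, inj_last, inj_castSucc, inj_castSucc, map_zero, zero_sub,
      Finset.sum_eq_single p, Pi.single_eq_same, neg_add_cancel]
    · intro q _ hq
      exact Pi.single_eq_of_ne (fun h => hq (Fin.castSucc_injective _ h).symm) _
    · simp

theorem x_castSucc_inj (p : Fin n) (l : ℕ →₀ (F ⊗[k] A)) :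
    ((dunklRep hγ).y p.castSucc + DunklRep.jm (wreathRep hγ) p.castSucc) (inj k F n A l) =
      inj k F n A (aAct D γ (U.x p) l) := by
  have h : U.x p = U.toDunklRep.y p + DunklRep.jm U.toWreathRep p := by
    simp [AffineRep.toDunklRep]
  rw [LinearMap.add_apply, y_castSucc_inj, h, map_add, LinearMap.add_apply, map_add,
    DunklRep.jm, filter_lt_castSucc, Finset.sum_map, LinearMap.sum_apply, DunklRep.jm, map_sum,
    LinearMap.sum_apply, map_sum]
  simp only [Fin.coe_castSuccEmb, exch_castSucc_inj]

/-- For a pair `p, n + 1` it is enough that `y_p` commutes with `x_{n+1}` on such vectors, where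
these act through `A` and by the shift. For two positions up to `n` the relation is inherited from
`A`. The remaining order follows by antisymmetry. -/
theorem obstruction_inj {i j : Fin (n + 1)} (hij : i ≠ j) (l : ℕ →₀ (F ⊗[k] A)) :
    (dunklRep hγ).obstruction i j (inj k F n A l) = 0 := by
  have key : ∀ p : Fin n, (dunklRep hγ).obstruction p.castSucc (Fin.last n) (inj k F n A l) = 0 := by
    intro p
    obtain ⟨r, hr, h2⟩ := (dunklRep hγ).y_add_jm (Fin.castSucc_lt_last p)
    have h3 : (dunklRep hγ).obstruction p.castSucc (Fin.last n) =
        (dunklRep hγ).y p.castSucc *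
          ((dunklRep hγ).y (Fin.last n) + DunklRep.jm (wreathRep hγ) (Fin.last n)) -
        ((dunklRep hγ).y (Fin.last n) + DunklRep.jm (wreathRep hγ) (Fin.last n)) *
          (dunklRep hγ).y p.castSucc := by
      change _ = _ * ((dunklRep hγ).y (Fin.last n) +
          DunklRep.jm (dunklRep hγ).toWreathRep (Fin.last n)) -
        ((dunklRep hγ).y (Fin.last n) +
          DunklRep.jm (dunklRep hγ).toWreathRep (Fin.last n)) * _
      rw [h2, mul_add _ _ r, add_mul _ r, hr.eq, DunklRep.obstruction]
      abel
    rw [h3, LinearMap.sub_apply, Module.End.mul_apply, Module.End.mul_apply, x_last_inj,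
      y_castSucc_inj, y_castSucc_inj, x_last_inj, ← map_sub]
    have := LinearMap.congr_fun (aAct_shift γ (U.toDunklRep.y p) (D := D)) l
    simp only [Module.End.mul_apply] at this
    rw [this, sub_self, map_zero]
  induction i using Fin.lastCases with
  | last =>
    induction j using Fin.lastCases with
    | last => exact absurd rfl hij
    | cast q => rw [DunklRep.obstruction_symm _ hij.symm, LinearMap.neg_apply, key, neg_zero]
  | cast p =>
    induction j using Fin.lastCases with
    | last => exact key p
    | cast q =>
      have hpq : p ≠ q := fun h => hij (by rw [h])
      have h1 : U.toDunklRep.obstruction p q = 0 :=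
        U.toDunklRep.integrable_iff.1 (U.toDunklRep_integrable hpq)
      have h2 : ∀ l, ((dunklRep hγ).y q.castSucc + (wreathRep hγ).exch q.castSucc p.castSucc)
          (inj k F n A l) =
          inj k F n A (aAct D γ (U.toDunklRep.y q + U.toDunklRep.exch q p) l) := by
        intro l
        have h3 : aAct D γ (U.toDunklRep.y q + U.toDunklRep.exch q p) l =
            aAct D γ (U.toDunklRep.y q) l + aAct D γ (U.exch q p) l := by rw [map_add]; rfl
        rw [LinearMap.add_apply, y_castSucc_inj, exch_castSucc_inj, h3, map_add]
      change ((dunklRep hγ).y p.castSucc * ((dunklRep hγ).y q.castSucc +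
        (wreathRep hγ).exch q.castSucc p.castSucc) - ((dunklRep hγ).y q.castSucc +
        (wreathRep hγ).exch q.castSucc p.castSucc) * (dunklRep hγ).y p.castSucc)
        (inj k F n A l) = 0
      rw [LinearMap.sub_apply, Module.End.mul_apply, Module.End.mul_apply, h2, y_castSucc_inj,
        y_castSucc_inj, h2, ← Module.End.mul_apply, ← Module.End.mul_apply, ← map_mul, ← map_mul,
        sub_eq_zero.1 h1, sub_self]

/-- Each coordinate vector is a transposition applied to the image of `inj`, and the obstruction is
equivariant. -/
theorem dunklRep_integrable (i j : Fin (n + 1)) (hij : i ≠ j) : (dunklRep hγ).Integrable i j := by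
  rw [DunklRep.integrable_iff]
  refine LinearMap.pi_ext fun q l => ?_
  have h := (dunklRep hγ).perm_obstruction (coset q) (coset q i) (coset q j)
  rw [coset_coset, coset_coset] at h
  rw [← perm_coset_inj hγ q l, LinearMap.zero_apply]
  have h := LinearMap.congr_fun h (inj k F n A l)
  rw [Module.End.mul_apply, obstruction_inj hγ (fun h => hij ((coset q).injective h)),
    map_zero] at h
  exact h.symm

/-- The induced representation of the affine wreath product algebra. -/
noncomputable def affineRep : AffineRep D (n + 1) (Module.End k (IndModule k F n A)) :=
  (dunklRep hγ).toAffineRep (dunklRep_integrable hγ)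

/-- On the last copy the subalgebra generated by the first `n` positions acts through `A`, without
touching the polynomial variable. -/
theorem lift_incl (z : Affine D n) (l : ℕ →₀ (F ⊗[k] A)) :
    (affineRep hγ).lift (Affine.incl D n z) (inj k F n A l) =
      inj k F n A (aAct D γ (U.lift z) l) := by
  have hz : z ∈ Algebra.adjoin k (Set.range (Affine.gen D (n := n))) := by
    rw [Affine.adjoin_gen]; trivial
  induction hz using Algebra.adjoin_induction generalizing l with
  | mem g hg =>
    obtain ⟨g, rfl⟩ := hg
    rw [Affine.incl_gen, AffineRep.lift_gen, AffineRep.lift_gen]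
    cases g with
    | x i => exact x_castSucc_inj hγ i l
    | f i a => exact (f_inj hγ i.castSucc a l).trans (by rw [polyTensorRep_castSucc]; rfl)
    | perm π => exact perm_inj hγ π l
  | algebraMap r => simp
  | add a b _ _ ha hb => simp only [map_add, LinearMap.add_apply, ha, hb]
  | mul a b _ _ ha hb => simp only [map_mul, Module.End.mul_apply, ha, hb]

end IndModule

end Model

end AffineWreath

/-! ### A spanning set for the cyclotomic ideal -/

namespace AffineWreath

open TensorProduct PolyModule AffineWreath.Affine

variable {k F : Type*} [CommRing k] [Ring F] [Algebra k F] {D : FrobeniusSuperalgebra k F}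

section Ideal

variable {R : Type*} [Ring R] [Algebra k R]

/-- The conditions on the parameters of a cyclotomic quotient. -/
structure CycParam.Admissible (D : FrobeniusSuperalgebra k F) (C : CycParam F) : Prop where
  mem : ∀ m ∈ Finset.Icc 1 D.θ, ∀ j ∈ Finset.Icc 1 (C.e m), C.c m j ∈ D.grade (m * D.δ, 0)
  center : ∀ m ∈ Finset.Icc 1 D.θ, ∀ j ∈ Finset.Icc 1 (C.e m),
    C.c m j ∈ D.fixedTwistedCenter m

namespace CycParam.Admissible

variable {C : CycParam F} (hC : C.Admissible D)
  {m j : ℕ} (hm : m ∈ Finset.Icc 1 D.θ) (hj : j ∈ Finset.Icc 1 (C.e m))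
include hC hm hj

theorem nakayama : D.nakayama (C.c m j) = C.c m j := (hC.center m hm j hj).2

theorem mul_comm (a : F) : a * C.c m j = C.c m j * (D.nakayama ^ m) a := by
  refine TensorRep.ext_homogeneous (D := D) (g := LinearMap.mulRight k (C.c m j))
    (h := LinearMap.mulLeft k (C.c m j) ∘ₗ (D.nakayama ^ m)) (fun q a ha => ?_) a
  have h1 := (hC.center m hm j hj).1 (m * D.δ, 0) q a ha
  rw [DirectSum.decompose_of_mem_same D.grade (hC.mem m hm j hj), koszul_even_left _ rfl,
    one_smul] at h1
  exact h1

end CycParam.Admissible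

theorem exists_map_mul_list_prod {R S α : Type*} [Monoid R] (φ : S → R) (l : List α) {b : α → R}
    (h : ∀ i ∈ l, ∀ a, ∃ a', φ a * b i = b i * φ a') (a : S) :
    ∃ a', φ a * (l.map b).prod = (l.map b).prod * φ a' := by
  induction l generalizing a with
  | nil => exact ⟨a, by simp⟩
  | cons i l ih =>
    obtain ⟨a', ha'⟩ := h i (by simp) a
    obtain ⟨a'', ha''⟩ := ih (fun j hj => h j (by simp [hj])) a'
    refine ⟨a'', ?_⟩
    rw [List.map_cons, List.prod_cons, ← mul_assoc, ha', mul_assoc, ha'', mul_assoc]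

namespace AffineRep

variable {N : ℕ} (W : AffineRep D N R)

theorem f_x_pow_same (i : Fin N) (a : F) (m : ℕ) :
    W.f i a * W.x i ^ m = W.x i ^ m * W.f i ((D.nakayama ^ m) a) := by
  induction m generalizing a with
  | zero => simp
  | succ m ih =>
    rw [pow_succ', ← mul_assoc, W.f_x_same, mul_assoc, ih, mul_assoc, pow_succ (D.nakayama),
      Module.End.mul_apply]

variable {C : CycParam F}

/-- At the same position this uses `ψ(c) = c`; at different positions `x_l` commutes with all copies
of `F` involved. -/
theorem x_mul_chiEval (hC : C.Admissible D) (i l : Fin N) :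
    W.x l * chiEval D C (W.f i) (W.x i) = chiEval D C (W.f i) (W.x i) * W.x l := by
  refine semiconjBy_chiEval C (fun m hm j hj => ?_) (W.x_comm l i)
  by_cases h : i = l
  · subst h
    have := W.f_x_same i (C.c m j)
    rw [hC.nakayama hm hj] at this
    exact this.symm
  · exact (W.f_x_ne l i h _).symm

/-- At the same position `x^m` and `c^{(m,j)}` twist `a` by the same power `ψ^m`, so each factor of
`χ` passes. At other positions evenness of `c` gives plain commutation. -/
theorem f_mul_chiEval (hC : C.Admissible D) (i l : Fin N) (a : F) :
    ∃ a', W.f l a * chiEval D C (W.f i) (W.x i) = chiEval D C (W.f i) (W.x i) * W.f l a' := by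
  refine exists_map_mul_list_prod (W.f l) _ (fun m hm =>
    exists_map_mul_list_prod (W.f l) _ fun j hj a => ?_) a
  rw [List.mem_range'_1] at hm hj
  have hm : m ∈ Finset.Icc 1 D.θ := by simp only [Finset.mem_Icc]; omega
  have hj : j ∈ Finset.Icc 1 (C.e m) := by simp only [Finset.mem_Icc]; omega
  by_cases h : l = i
  · subst h
    refine ⟨(D.nakayama ^ m) a, ?_⟩
    rw [mul_sub, sub_mul, W.f_x_pow_same, ← map_mul, ← map_mul, hC.mul_comm hm hj]
  · refine ⟨a, ?_⟩
    have h1 : Commute (W.f l a) (W.x i ^ m) :=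
      Commute.pow_right (W.f_x_ne i l h a) m
    have h2 : W.f l a * W.f i (C.c m j) = W.f i (C.c m j) * W.f l a := by
      refine TensorRep.ext_homogeneous (D := D)
        (g := LinearMap.mulRight k (W.f i (C.c m j)) ∘ₗ (W.f l).toLinearMap)
        (h := LinearMap.mulLeft k (W.f i (C.c m j)) ∘ₗ (W.f l).toLinearMap) (fun p a ha => ?_) a
      exact (W.commute_even (Ne.symm h) (hC.mem m hm j hj) ha rfl).symm
    rw [mul_sub, sub_mul, h1.eq, h2]

/-- The span of all elements `π χ z`. -/
def chiSpan (C : CycParam F) (i : Fin N) : Submodule k R :=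
  Submodule.span k {r | ∃ π z, r = W.perm π * (chiEval D C (W.f i) (W.x i) * z)}

theorem perm_mul_mem_chiSpan (i : Fin N) (π : Equiv.Perm (Fin N)) {r : R}
    (hr : r ∈ W.chiSpan C i) : W.perm π * r ∈ W.chiSpan C i := by
  induction hr using Submodule.span_induction with
  | mem r hr =>
    obtain ⟨σ, z, rfl⟩ := hr
    exact Submodule.subset_span ⟨π * σ, z, by rw [map_mul, mul_assoc]⟩
  | zero => rw [mul_zero]; exact Submodule.zero_mem _
  | add a b _ _ ha hb => rw [mul_add]; exact Submodule.add_mem _ ha hb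
  | smul c a _ ha => rw [mul_smul_comm]; exact Submodule.smul_mem _ _ ha

theorem f_mul_mem_chiSpan (hC : C.Admissible D) (i l : Fin N) (a : F) {r : R}
    (hr : r ∈ W.chiSpan C i) : W.f l a * r ∈ W.chiSpan C i := by
  induction hr using Submodule.span_induction with
  | mem r hr =>
    obtain ⟨σ, z, rfl⟩ := hr
    have h1 := W.perm_f σ (σ⁻¹ l) a
    rw [show σ (σ⁻¹ l) = l from σ.apply_symm_apply l] at h1
    obtain ⟨a', ha'⟩ := W.f_mul_chiEval hC i (σ⁻¹ l) a
    refine Submodule.subset_span ⟨σ, W.f (σ⁻¹ l) a' * z, ?_⟩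
    rw [← mul_assoc, ← h1, mul_assoc, ← mul_assoc _ _ z, ha', mul_assoc]
  | zero => rw [mul_zero]; exact Submodule.zero_mem _
  | add a b _ _ ha hb => rw [mul_add]; exact Submodule.add_mem _ ha hb
  | smul c a _ ha => rw [mul_smul_comm]; exact Submodule.smul_mem _ _ ha

theorem jm_mul_mem_chiSpan (hC : C.Admissible D) (i l : Fin N) {r : R}
    (hr : r ∈ W.chiSpan C i) : DunklRep.jm W.toWreathRep l * r ∈ W.chiSpan C i := by
  rw [DunklRep.jm, Finset.sum_mul]
  refine Submodule.sum_mem _ fun q _ => ?_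
  rw [WreathRep.exch, TensorRep.tel, mul_assoc, Finset.sum_mul]
  refine Submodule.sum_mem _ fun b _ => ?_
  rw [mul_assoc]
  exact W.f_mul_mem_chiSpan hC _ _ _ (W.f_mul_mem_chiSpan hC _ _ _
    (W.perm_mul_mem_chiSpan _ _ hr))

/-- Permutations do not permute the `x_l`, but they do permute the `y_l`. The difference consists of
the terms `jm`, which are built from copies of `F` and permutations and have been treated before. -/
theorem x_mul_mem_chiSpan (hC : C.Admissible D) (i l : Fin N) {r : R}
    (hr : r ∈ W.chiSpan C i) : W.x l * r ∈ W.chiSpan C i := by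
  induction hr using Submodule.span_induction with
  | mem r hr =>
    obtain ⟨σ, z, rfl⟩ := hr
    have hy := W.toDunklRep.perm_y σ (σ⁻¹ l)
    rw [show σ (σ⁻¹ l) = l from σ.apply_symm_apply l] at hy
    change W.perm σ * (W.x (σ⁻¹ l) - DunklRep.jm W.toWreathRep (σ⁻¹ l)) =
      (W.x l - DunklRep.jm W.toWreathRep l) * W.perm σ at hy
    have h1 : W.x l * W.perm σ = W.perm σ * W.x (σ⁻¹ l) -
        W.perm σ * DunklRep.jm W.toWreathRep (σ⁻¹ l) +
        DunklRep.jm W.toWreathRep l * W.perm σ := by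
      rw [← mul_sub, hy, sub_mul, sub_add_cancel]
    have h0 : ∀ z, chiEval D C (W.f i) (W.x i) * z ∈ W.chiSpan C i := fun z =>
      Submodule.subset_span ⟨1, z, by simp⟩
    rw [← mul_assoc, h1, add_mul, sub_mul]
    refine Submodule.add_mem _ (Submodule.sub_mem _ ?_ ?_) ?_
    · rw [mul_assoc, ← mul_assoc (W.x _), W.x_mul_chiEval hC, mul_assoc]
      exact Submodule.subset_span ⟨σ, _, rfl⟩
    · rw [mul_assoc]
      exact W.perm_mul_mem_chiSpan _ _ (W.jm_mul_mem_chiSpan hC _ _ (h0 z))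
    · rw [mul_assoc]
      exact W.jm_mul_mem_chiSpan hC _ _ (W.perm_mul_mem_chiSpan _ _ (h0 z))
  | zero => rw [mul_zero]; exact Submodule.zero_mem _
  | add a b _ _ ha hb => rw [mul_add]; exact Submodule.add_mem _ ha hb
  | smul c a _ ha => rw [mul_smul_comm]; exact Submodule.smul_mem _ _ ha

end AffineRep

theorem mul_mem_chiSpan {C : CycParam F} (hC : C.Admissible D) {N : ℕ} (i : Fin N)
    (z : Affine D N) {r : Affine D N} (hr : r ∈ (Affine.rep D N).chiSpan C i) :
    z * r ∈ (Affine.rep D N).chiSpan C i := by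
  have hz : z ∈ Algebra.adjoin k (Set.range (Affine.gen D (n := N))) := by
    rw [Affine.adjoin_gen]; trivial
  induction hz using Algebra.adjoin_induction generalizing r with
  | mem g hg =>
    obtain ⟨g, rfl⟩ := hg
    cases g with
    | x l => exact (Affine.rep D N).x_mul_mem_chiSpan hC i l hr
    | f l a => exact (Affine.rep D N).f_mul_mem_chiSpan hC i l a hr
    | perm π => exact (Affine.rep D N).perm_mul_mem_chiSpan i π hr
  | algebraMap c => rw [← Algebra.smul_def]; exact Submodule.smul_mem _ _ hr
  | add a b _ _ ha hb => rw [add_mul]; exact Submodule.add_mem _ (ha hr) (hb hr)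
  | mul a b _ _ ha hb => rw [mul_assoc]; exact ha (hb hr)

theorem mem_chiSpan_mul {C : CycParam F} {N : ℕ} (i : Fin N)
    (z : Affine D N) {r : Affine D N} (hr : r ∈ (Affine.rep D N).chiSpan C i) :
    r * z ∈ (Affine.rep D N).chiSpan C i := by
  induction hr using Submodule.span_induction with
  | mem r hr =>
    obtain ⟨σ, w, rfl⟩ := hr
    exact Submodule.subset_span ⟨σ, w * z, by simp only [mul_assoc]⟩
  | zero => rw [zero_mul]; exact Submodule.zero_mem _
  | add a b _ _ ha hb => rw [add_mul]; exact Submodule.add_mem _ ha hb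
  | smul c a _ ha => rw [smul_mul_assoc]; exact Submodule.smul_mem _ _ ha

/-- The span contains `χ` and is stable under multiplication from both sides. Having nothing but
permutations to the left of `χ` is what allows the action of the ideal to be controlled. -/
theorem mem_chiSpan_of_mem_cycIdeal {C : CycParam F} (hC : C.Admissible D) {n : ℕ}
    {z : Affine D (n + 1)} (hz : z ∈ cycIdeal D C (n + 1)) :
    z ∈ (Affine.rep D (n + 1)).chiSpan C 0 := by
  let I : TwoSidedIdeal (Affine D (n + 1)) :=
    TwoSidedIdeal.mk' ((Affine.rep D (n + 1)).chiSpan C 0 : Set (Affine D (n + 1)))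
      (Submodule.zero_mem _) (Submodule.add_mem _) (Submodule.neg_mem _)
      (fun h => mul_mem_chiSpan hC 0 _ h) (fun h => mem_chiSpan_mul 0 _ h)
  have h1 : cycIdeal D C (n + 1) ≤ I := by
    refine TwoSidedIdeal.span_le.2 ?_
    rintro _ ⟨i, hi, rfl⟩
    obtain rfl : i = 0 := Fin.ext hi
    rw [SetLike.mem_coe, TwoSidedIdeal.mem_mk']
    exact Submodule.subset_span ⟨1, 1, by rw [map_one, one_mul, mul_one, chi_eq_chiEval]⟩
  have h2 := h1 hz
  rwa [TwoSidedIdeal.mem_mk'] at h2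

end Ideal

end AffineWreath

/-! ### Degree filtration and division by `χ` on the induced module -/

namespace AffineWreath

open TensorProduct PolyModule AffineWreath.Affine

variable {k F : Type*} [CommRing k] [Ring F] [Algebra k F] {D : FrobeniusSuperalgebra k F}

theorem sum_range'_eq_level (D : FrobeniusSuperalgebra k F) (C : CycParam F) :
    ((List.range' 1 D.θ).map fun m => ((List.range' 1 (C.e m)).map fun _ => m).sum).sum =
      level D C := by
  simp only [List.map_const', List.sum_replicate, List.length_range', smul_eq_mul]
  rw [level, Nat.Icc_eq_range', Nat.add_sub_cancel]
  simp only [mul_comm]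
  rfl

section Model

variable {n : ℕ} {A : Type*} [Ring A] [Algebra k A] {U : AffineRep D n A} {γ : A →ₐ[k] A}
  (hγ : U.IsParity γ) (C : CycParam F)

namespace IndModule

variable (k F n A) in
/-- Elements of degree less than `m` in the variable. -/
def filt (m : ℕ) : Submodule k (IndModule k F n A) where
  carrier := {v | ∀ j a, m ≤ a → v j a = 0}
  zero_mem' _ _ _ := rfl
  add_mem' {v w} hv hw j a h := by
    rw [Pi.add_apply, Finsupp.add_apply, hv j a h, hw j a h, add_zero]
  smul_mem' r v hv j a h := by
    rw [Pi.smul_apply, Finsupp.smul_apply, hv j a h, smul_zero]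

theorem filt_mono {m m' : ℕ} (h : m ≤ m') : filt k F n A m ≤ filt k F n A m' :=
  fun _ hv j a ha => hv j a (h.trans ha)

theorem exists_mem_filt (v : IndModule k F n A) : ∃ m, v ∈ filt k F n A m := by
  refine ⟨(Finset.univ.sup fun j => (v j).support.sup id) + 1, fun j a ha => ?_⟩
  by_contra h
  have h1 : a ≤ (v j).support.sup id :=
    Finset.le_sup (f := id) (Finsupp.mem_support_iff.2 h)
  have h2 := h1.trans (Finset.le_sup (f := fun j => (v j).support.sup id) (Finset.mem_univ j))
  omega

theorem aAct_apply_eq_zero (u : A) {l : ℕ →₀ (F ⊗[k] A)} {a : ℕ} (h : l a = 0) :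
    aAct D γ u l a = 0 := by
  rw [aAct, AlgHom.comp_apply, finsuppDiag_apply, h, map_zero]

theorem fAct_apply_eq_zero (f : F) {l : ℕ →₀ (F ⊗[k] A)} {a : ℕ} (h : l a = 0) :
    fAct D A f l a = 0 := by
  rw [fAct, AlgHom.comp_apply, finsuppDiag_apply, h, map_zero]

theorem polyTensorRep_apply_eq_zero (i : Fin (n + 1)) (f : F) {l : ℕ →₀ (F ⊗[k] A)} {a : ℕ}
    (h : l a = 0) : (polyTensorRep hγ).f i f l a = 0 := by
  induction i using Fin.lastCases with
  | last => rw [polyTensorRep_last]; exact fAct_apply_eq_zero f h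
  | cast i => rw [polyTensorRep_castSucc]; exact aAct_apply_eq_zero _ h

theorem polyTel_apply_eq_zero (i j : Fin (n + 1)) {l : ℕ →₀ (F ⊗[k] A)} {a : ℕ}
    (h : l a = 0) : (polyTensorRep hγ).tel i j l a = 0 := by
  rw [TensorRep.tel, LinearMap.sum_apply, Finsupp.finsetSum_apply]
  exact Finset.sum_eq_zero fun b _ =>
    polyTensorRep_apply_eq_zero hγ _ _ (polyTensorRep_apply_eq_zero hγ _ _ h)

theorem perm_mem_filt (σ : Equiv.Perm (Fin (n + 1))) {m : ℕ} {v : IndModule k F n A}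
    (hv : v ∈ filt k F n A m) : (wreathRep hγ).perm σ v ∈ filt k F n A m := by
  intro j a ha
  obtain ⟨j, rfl⟩ := σ.surjective j
  rw [wreathRep_perm_apply]
  exact aAct_apply_eq_zero _ (hv j a ha)

theorem f_mem_filt (i : Fin (n + 1)) (f : F) {m : ℕ} {v : IndModule k F n A}
    (hv : v ∈ filt k F n A m) : (wreathRep hγ).f i f v ∈ filt k F n A m := by
  intro j a ha
  rw [wreathRep_f_apply]
  exact polyTensorRep_apply_eq_zero hγ _ _ (hv j a ha)

@[simp]
theorem shift_succ (l : ℕ →₀ (F ⊗[k] A)) (a : ℕ) : shift k F A l (a + 1) = l a :=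
  Finsupp.mapDomain_apply (add_left_injective 1) _ _

theorem shift_pow_add (d : ℕ) (l : ℕ →₀ (F ⊗[k] A)) (a : ℕ) :
    (shift k F A ^ d) l (a + d) = l a := by
  induction d with
  | zero => rfl
  | succ d ih => rw [pow_succ', Module.End.mul_apply, ← add_assoc, shift_succ, ih]

theorem shift_pow_single (d m : ℕ) (v : F ⊗[k] A) :
    (shift k F A ^ d) (Finsupp.single m v) = Finsupp.single (m + d) v := by
  induction d with
  | zero => rfl
  | succ d ih => rw [pow_succ', Module.End.mul_apply, ih, shift_single, add_assoc]

theorem inj_mem_filt {l : ℕ →₀ (F ⊗[k] A)} {m : ℕ} :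
    inj k F n A l ∈ filt k F n A m ↔ ∀ a, m ≤ a → l a = 0 := by
  refine ⟨fun h a ha => ?_, fun h j a ha => ?_⟩
  · have := h (Fin.last n) a ha
    rwa [inj_last] at this
  · induction j using Fin.lastCases with
    | last => rw [inj_last]; exact h a ha
    | cast q => rw [inj_castSucc]; rfl

theorem inj_shift_mem_filt {l : ℕ →₀ (F ⊗[k] A)} {m d : ℕ}
    (h : inj k F n A l ∈ filt k F n A m) :
    inj k F n A ((shift k F A ^ d) l) ∈ filt k F n A (m + d) := by
  rw [inj_mem_filt] at *
  intro a ha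
  obtain ⟨b, rfl⟩ := Nat.exists_eq_add_of_le' (Nat.le_of_add_left_le ha)
  rw [shift_pow_add]
  exact h b (by omega)

/-- `O` raises degrees by at most `d`, and its leading part is the `d`-th power of the variable on
the image of `inj`. -/
structure HasLead (d : ℕ) (O : Module.End k (IndModule k F n A)) : Prop where
  mem : ∀ m v, v ∈ filt k F n A m → O v ∈ filt k F n A (m + d)
  lead : ∀ m l, inj k F n A l ∈ filt k F n A (m + 1) →
    O (inj k F n A l) - inj k F n A ((shift k F A ^ d) l) ∈ filt k F n A (m + d)

theorem HasLead.one : HasLead 0 (1 : Module.End k (IndModule k F n A)) where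
  mem _ _ h := h
  lead m l _ := by simp

theorem HasLead.mul {d d' : ℕ} {O O' : Module.End k (IndModule k F n A)} (h : HasLead d O)
    (h' : HasLead d' O') : HasLead (d + d') (O * O') where
  mem m v hv := by
    rw [add_comm d, ← add_assoc]
    exact h.mem _ _ (h'.mem _ _ hv)
  lead m l hl := by
    -- The error of `O'` is raised by at most `d`, and `O` itself has the right leading part on the
    -- shifted vector; the two errors are then added.
    have h1 := h.mem _ _ (h'.lead m l hl)
    have h2 := h.lead (m + d') ((shift k F A ^ d') l) (by
      rw [add_right_comm]; exact inj_shift_mem_filt hl)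
    have h3 := Submodule.add_mem _ h1 h2
    rw [map_sub, sub_add_sub_cancel, ← Module.End.mul_apply (shift k F A ^ d), ← pow_add,
      add_assoc, add_comm d'] at h3
    exact h3

theorem HasLead.list_prod {α : Type*} (s : List α) {g : α → ℕ}
    {O : α → Module.End k (IndModule k F n A)} (h : ∀ i ∈ s, HasLead (g i) (O i)) :
    HasLead (s.map g).sum (s.map O).prod := by
  induction s with
  | nil => exact HasLead.one
  | cons i s ih =>
    rw [List.map_cons, List.map_cons, List.sum_cons, List.prod_cons]
    exact (h i (by simp)).mul (ih fun j hj => h j (by simp [hj]))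

theorem HasLead.pow {d : ℕ} {O : Module.End k (IndModule k F n A)} (h : HasLead d O) (m : ℕ) :
    HasLead (m * d) (O ^ m) := by
  induction m with
  | zero => rw [zero_mul, pow_zero]; exact HasLead.one
  | succ m ih => rw [pow_succ, add_mul, one_mul]; exact ih.mul h

theorem HasLead.sub {d : ℕ} (hd : 0 < d) {O O' : Module.End k (IndModule k F n A)}
    (h : HasLead d O) (h' : ∀ m v, v ∈ filt k F n A m → O' v ∈ filt k F n A m) :
    HasLead d (O - O') where
  mem m v hv := Submodule.sub_mem _ (h.mem _ _ hv) (filt_mono (by omega) (h' _ _ hv))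
  lead m l hl := by
    rw [LinearMap.sub_apply, sub_right_comm]
    exact Submodule.sub_mem _ (h.lead m l hl) (filt_mono (by omega) (h' _ _ hl))

/-- The actions of `A` and of the teleporters work coefficientwise and never raise the degree, so
only the shift does. -/
theorem yLast_hasLead : HasLead 1 (yLast hγ) where
  mem m v hv j a ha := by
    obtain ⟨b, rfl⟩ := Nat.exists_eq_add_of_le' (Nat.le_of_add_left_le ha)
    induction j using Fin.lastCases with
    | last => rw [yLast_last, shift_succ]; exact hv _ _ (by omega)
    | cast q =>
      rw [yLast_castSucc, Finsupp.sub_apply, aAct_apply_eq_zero _ (hv _ _ (by omega)),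
        polyTel_apply_eq_zero hγ _ _ (hv _ _ (by omega)), sub_zero]
  lead m l hl j a ha := by
    rw [Pi.sub_apply]
    induction j using Fin.lastCases with
    | last => rw [yLast_last, inj_last, inj_last, pow_one, sub_self]; rfl
    | cast q =>
      rw [yLast_castSucc, inj_last, inj_castSucc, inj_castSucc, map_zero, sub_zero, zero_sub,
        Finsupp.neg_apply, polyTel_apply_eq_zero hγ _ _ (inj_mem_filt.1 hl _ ha), neg_zero]

/-- The element `χ(y_{n+1})`. -/
noncomputable def chiLast : Module.End k (IndModule k F n A) :=
  chiEval D C ((wreathRep hγ).f (Fin.last n)) (yLast hγ)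

/-- In every factor `y^m - c` one has `m ≥ 1`, while `c` does not raise degrees, so the leading part
is that of `y^m`. These exponents add up to the level. -/
theorem chiLast_hasLead : HasLead (level D C) (chiLast hγ C) := by
  rw [← sum_range'_eq_level]
  refine HasLead.list_prod _ fun m hm => HasLead.list_prod _ fun j _ => ?_
  have := (yLast_hasLead hγ).pow m
  rw [mul_one] at this
  exact this.sub (List.mem_range'_1.1 hm).1 fun _ _ hv => f_mem_filt hγ _ _ hv

theorem chiEval_intertwine {M M' : Type*} [AddCommGroup M] [Module k M] [AddCommGroup M']
    [Module k M'] (e : M →ₗ[k] M') {φ : F → Module.End k M} {φ' : F → Module.End k M'}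
    {y : Module.End k M} {y' : Module.End k M'} (hφ : ∀ a l, φ' a (e l) = e (φ a l))
    (hy : ∀ l, y' (e l) = e (y l)) (l : M) :
    chiEval D C φ' y' (e l) = e (chiEval D C φ y l) := by
  have key : ∀ {α : Type} (s : List α) (O : α → Module.End k M) (O' : α → Module.End k M'),
      (∀ i ∈ s, ∀ l, O' i (e l) = e (O i l)) →
      ∀ l, (s.map O').prod (e l) = e ((s.map O).prod l) := by
    intro α s O O' h
    induction s with
    | nil => intro l; rfl
    | cons i s ih =>
      intro l
      simp only [List.map_cons, List.prod_cons, Module.End.mul_apply]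
      rw [ih (fun j hj => h j (by simp [hj])), h i (by simp)]
  have hpow : ∀ (m : ℕ) l, (y' ^ m) (e l) = e ((y ^ m) l) := by
    intro m
    induction m with
    | zero => intro l; rfl
    | succ m ih => intro l; rw [pow_succ, Module.End.mul_apply, hy, ih]; rfl
  refine key _ _ _ (fun m _ => key _ _ _ fun j _ l => ?_) l
  rw [LinearMap.sub_apply, LinearMap.sub_apply, hpow, hφ, map_sub]

/-- On the copy indexed by `q`, `yLast` acts as `y_q` and position `n + 1` as position `q`. The
operator is therefore `χ(y_q)`, which is zero in `A`. -/
theorem chiLast_single (hU : ∀ q, chiEval D C (U.f q) (U.toDunklRep.y q) = 0) (q : Fin n)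
    (l : ℕ →₀ (F ⊗[k] A)) : chiLast hγ C (Pi.single q.castSucc l) = 0 := by
  have h := chiEval_intertwine (D := D) C (LinearMap.single k (fun _ : Fin (n + 1) => ℕ →₀ (F ⊗[k] A)) q.castSucc)
    (φ := fun a => aAct D γ (U.f q a)) (φ' := (wreathRep hγ).f (Fin.last n))
    (y := aAct D γ (U.toDunklRep.y q)) (y' := yLast hγ) (fun a l => ?_)
    (fun l => yLast_single hγ q l) l
  · have h' := map_chiEval C (S := Module.End k (ℕ →₀ (F ⊗[k] A))) (aAct D γ) (U.f q)
      (U.toDunklRep.y q) (D := D)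
    rw [hU q, map_zero] at h'
    rw [← h', LinearMap.zero_apply, map_zero] at h
    exact h
  · funext j
    rw [wreathRep_f_apply, coset_apply_last]
    simp only [LinearMap.single_apply]
    by_cases hj : j = q.castSucc
    · subst hj
      rw [Pi.single_eq_same, Pi.single_eq_same, polyTensorRep_castSucc]
    · rw [Pi.single_eq_of_ne hj, Pi.single_eq_of_ne hj, map_zero]

theorem chiLast_apply (hU : ∀ q, chiEval D C (U.f q) (U.toDunklRep.y q) = 0)
    (v : IndModule k F n A) :
    chiLast hγ C v = chiLast hγ C (inj k F n A (v (Fin.last n))) := by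
  conv_lhs => rw [← Finset.univ_sum_single v, map_sum, Fin.sum_univ_castSucc]
  simp only [chiLast_single hγ C hU, Finset.sum_const_zero, zero_add]
  rfl

theorem perm_chiLast (g : Equiv.Perm (Fin n)) :
    (wreathRep hγ).perm (extendPerm g) * chiLast hγ C =
      chiLast hγ C * (wreathRep hγ).perm (extendPerm g) := by
  refine semiconjBy_chiEval C (fun m _ j _ => ?_) (perm_yLast hγ g)
  have := (wreathRep hγ).perm_f (extendPerm g) (Fin.last n) (C.c m j)
  rwa [extendPerm_last] at this

/-- The extension of `χ(y_{n+1})` to the induced module by right multiplication. -/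
noncomputable def chiRight : Module.End k (IndModule k F n A) :=
  ∑ j, (wreathRep hγ).perm (coset j) ∘ₗ chiLast hγ C ∘ₗ inj k F n A ∘ₗ LinearMap.proj j

theorem chiRight_apply (v : IndModule k F n A) :
    chiRight hγ C v = ∑ j, (wreathRep hγ).perm (coset j) (chiLast hγ C (inj k F n A (v j))) := by
  simp [chiRight]

/-- Split `σ` into a coset representative and an element of `S_n`; the latter commutes with
`chiLast`. Since `chiLast` sees only the last coordinate, the result is a value of `chiRight` on a
vector with one coordinate. -/
theorem perm_chiLast_mem_range (hU : ∀ q, chiEval D C (U.f q) (U.toDunklRep.y q) = 0)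
    (σ : Equiv.Perm (Fin (n + 1))) (v : IndModule k F n A) :
    (wreathRep hγ).perm σ (chiLast hγ C v) ∈ LinearMap.range (chiRight hγ C) := by
  obtain ⟨g, hg⟩ := exists_cocycle σ (Fin.last n)
  have h1 : σ = coset (σ (Fin.last n)) * extendPerm g := by rw [hg]; simp
  have h2 := LinearMap.congr_fun (perm_chiLast hγ C g) v
  rw [h1, map_mul, Module.End.mul_apply]
  rw [Module.End.mul_apply, Module.End.mul_apply] at h2
  rw [h2, chiLast_apply hγ C hU]
  refine ⟨Pi.single (σ (Fin.last n)) ((wreathRep hγ).perm (extendPerm g) v (Fin.last n)), ?_⟩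
  rw [chiRight_apply, Finset.sum_eq_single (σ (Fin.last n))]
  · rw [Pi.single_eq_same]
  · intro j _ hj
    rw [Pi.single_eq_of_ne hj, map_zero, map_zero, map_zero]
  · simp

theorem x_last_pow_inj (a : ℕ) (l : ℕ →₀ (F ⊗[k] A)) :
    ((affineRep hγ).x (Fin.last n) ^ a) (inj k F n A l) =
      inj k F n A ((shift k F A ^ a) l) := by
  induction a with
  | zero => rfl
  | succ a ih =>
    rw [pow_succ', Module.End.mul_apply, ih, pow_succ', Module.End.mul_apply]
    exact x_last_inj hγ _

theorem dunklRep_y_last : (dunklRep hγ).y (Fin.last n) = yLast hγ := by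
  change (wreathRep hγ).perm (coset _) * yLast hγ * (wreathRep hγ).perm (coset _) = _
  rw [coset_last, map_one, one_mul, mul_one]

/-- `x_1 = y_1` is the conjugate of `yLast` by the transposition exchanging the first and the last
position. -/
theorem chiEval_affineRep :
    chiEval D C ((affineRep hγ).f 0) ((affineRep hγ).x 0) =
      (wreathRep hγ).perm (coset 0) * chiLast hγ C * (wreathRep hγ).perm (coset 0) := by
  have h0 : (affineRep hγ).x 0 = (dunklRep hγ).y 0 := by
    change (dunklRep hγ).y 0 + DunklRep.jm (wreathRep hγ) 0 = _
    rw [DunklRep.jm, Finset.filter_false_of_mem (by simp), Finset.sum_empty, add_zero]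
  have h := (dunklRep hγ).perm_chiEval C (coset 0) (Fin.last n)
  rw [dunklRep_y_last, coset_apply_last] at h
  rw [h0]
  change (wreathRep hγ).perm (coset 0) * chiLast hγ C =
    chiEval D C ((affineRep hγ).f 0) ((dunklRep hγ).y 0) * (wreathRep hγ).perm (coset 0) at h
  rw [h, mul_assoc, perm_coset_mul_self, mul_one]

theorem lift_mem_range (hU : ∀ q, chiEval D C (U.f q) (U.toDunklRep.y q) = 0)
    {z : Affine D (n + 1)} (hz : z ∈ (Affine.rep D (n + 1)).chiSpan C 0)
    (v : IndModule k F n A) : (affineRep hγ).lift z v ∈ LinearMap.range (chiRight hγ C) := by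
  induction hz using Submodule.span_induction with
  | mem r hr =>
    obtain ⟨σ, w, rfl⟩ := hr
    have h1 : (affineRep hγ).lift ((Affine.rep D (n + 1)).perm σ) = (wreathRep hγ).perm σ :=
      (affineRep hγ).lift_gen (.perm σ)
    have h2 : (affineRep hγ).lift (chi D C 0) =
        (wreathRep hγ).perm (coset 0) * chiLast hγ C * (wreathRep hγ).perm (coset 0) := by
      rw [AffineRep.lift_chi, chiEval_affineRep]
    have h3 := perm_chiLast_mem_range hγ C hU (σ * coset 0)
      ((wreathRep hγ).perm (coset 0) ((affineRep hγ).lift w v))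
    rw [map_mul, Module.End.mul_apply] at h3
    rw [← chi_eq_chiEval, map_mul, map_mul, h1, h2]
    exact h3
  | zero => rw [map_zero]; exact Submodule.zero_mem _
  | add a b _ _ ha hb => rw [map_add]; exact Submodule.add_mem _ ha hb
  | smul c a _ ha => rw [map_smul]; exact Submodule.smul_mem _ _ ha

theorem chiRight_lead {m : ℕ} {v : IndModule k F n A} (hv : v ∈ filt k F n A (m + 1)) :
    chiRight hγ C v - (fun j => (shift k F A ^ level D C) (v j)) ∈
      filt k F n A (m + level D C) := by
  have h1 : (fun j => (shift k F A ^ level D C) (v j)) =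
      ∑ j, (wreathRep hγ).perm (coset j) (inj k F n A ((shift k F A ^ level D C) (v j))) := by
    simp only [perm_coset_inj]
    exact (Finset.univ_sum_single _).symm
  rw [chiRight_apply, h1, ← Finset.sum_sub_distrib]
  refine Submodule.sum_mem _ fun j _ => ?_
  rw [← map_sub]
  refine perm_mem_filt hγ _ ((chiLast_hasLead hγ C).lead m _ (inj_mem_filt.2 (hv j)))

/-- This is division with remainder by a monic polynomial of degree `d`, carried out on all coset
copies together. -/
theorem isCompl_filt_chiRight :
    IsCompl (filt k F n A (level D C)) (LinearMap.range (chiRight hγ C)) := by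
  constructor
  · rw [Submodule.disjoint_def]
    rintro _ hv ⟨u, rfl⟩
    -- The top coefficient of `u` would appear in `chiRight u` in degree at least `d`, where
    -- everything vanishes. The degree bound of `u` thus descends to zero.
    obtain ⟨m, hm⟩ := exists_mem_filt u
    suffices u = 0 by rw [this, map_zero]
    induction m with
    | zero => exact funext fun j => Finsupp.ext fun a => hm j a (Nat.zero_le a)
    | succ m ih =>
      refine ih fun j a ha => ?_
      have h1 := chiRight_lead hγ C hm j (a + level D C) (by omega)
      have h2 := hv j (a + level D C) (by omega)
      rw [Pi.sub_apply, Finsupp.sub_apply, h2, zero_sub, shift_pow_add] at h1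
      exact neg_eq_zero.1 h1
  · rw [codisjoint_iff, eq_top_iff]
    suffices key : ∀ m, ∀ v ∈ filt k F n A m,
        v ∈ filt k F n A (level D C) ⊔ LinearMap.range (chiRight hγ C) by
      rintro v -
      obtain ⟨m, hm⟩ := exists_mem_filt v
      exact key m v hm
    intro m
    induction m with
    | zero =>
      intro v hm
      exact Submodule.mem_sup_left (filt_mono (Nat.zero_le _) hm)
    | succ m ih =>
      intro v hm
      by_cases hmd : m + 1 ≤ level D C
      · exact Submodule.mem_sup_left (filt_mono hmd hm)
      obtain ⟨m', rfl⟩ := Nat.exists_eq_add_of_le' (Nat.lt_succ_iff.1 (not_le.1 hmd))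
      -- `w` is the leading term of `v` divided by `x^d`; subtracting `chiRight w` lowers the degree
      -- bound of `v`.
      let w : IndModule k F n A := fun j => Finsupp.single m' (v j (m' + level D C))
      have hw : w ∈ filt k F n A (m' + 1) := fun j a ha =>
        Finsupp.single_eq_of_ne (by omega)
      have h1 := ih _ (chiRight_lead hγ C hw)
      have h2 : v - (fun j => (shift k F A ^ level D C) (w j)) ∈
          filt k F n A (m' + level D C) := by
        intro j a ha
        simp only [w, shift_pow_single, Pi.sub_apply, Finsupp.sub_apply]
        by_cases h : a = m' + level D C
        · subst h; simp
        · rw [Finsupp.single_eq_of_ne (by omega), sub_zero]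
          exact hm j a (by omega)
      have h3 := ih _ h2
      have h4 : chiRight hγ C w ∈
          filt k F n A (level D C) ⊔ LinearMap.range (chiRight hγ C) :=
        Submodule.mem_sup_right ⟨w, rfl⟩
      have h5 := Submodule.add_mem _ (Submodule.sub_mem _ h4 h1) h3
      rwa [sub_sub_cancel, add_sub_cancel] at h5

end IndModule

end Model

/-! ### The functional on the cyclotomic quotient -/

open IndModule

namespace Cyc

variable {C : CycParam F}

theorem isParity_parity (hC : C.Admissible D) (n : ℕ) :
    (rep D C n).IsParity (parity hC.mem n) where
  x i := lift_gen _ _ (.x i)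
  f i a := lift_gen _ _ (.f i a)
  perm π := lift_gen _ _ (.perm π)

theorem rep_lift (n : ℕ) : (rep D C n).lift = mk D C n :=
  Affine.algHom_ext fun g => by
    rw [AffineRep.lift_gen]
    cases g <;> rfl

theorem incl_mk {n : ℕ} (z : Affine D n) :
    incl D C n (mk D C n z) = mk D C (n + 1) (Affine.incl D n z) := rfl

theorem tensorAction_one_tmul (n : ℕ) (γ : Cyc D C n →ₐ[k] Cyc D C n) (y : Cyc D C n) :
    tensorAction D γ y ((1 : F) ⊗ₜ[k] 1) = (1 : F) ⊗ₜ[k] y := by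
  have h : (1 : F) ∈ D.grade 0 := SetLike.GradedOne.one_mem
  rw [tensorAction_tmul, FrobeniusSuperalgebra.parityProj, FrobeniusSuperalgebra.parityProj,
    D.weight_apply _ h, D.weight_apply _ h]
  simp

/-- The remainder of `z · one` modulo the range of `chiRight` depends only on the class of `z`. For
coset elements `z · one` is a single monomial of degree less than `d`, hence its own remainder, and
all values can be read off. For level zero the truncated index `level - 1` does no harm, since no
`a` is admissible. -/
theorem exists_preTrace (hC : C.Admissible D) (n : ℕ) :
    ∃ τ : Cyc D C (n + 1) →ₗ[k] Cyc D C n, ∀ (j : Fin (n + 1)) (a : ℕ), a < level D C →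
      ∀ (f : F) (y : Cyc D C n),
      τ ((rep D C (n + 1)).perm (coset j) * ((rep D C (n + 1)).x (Fin.last n) ^ a *
        (rep D C (n + 1)).f (Fin.last n) f * incl D C n y)) =
      if j = Fin.last n ∧ a + 1 = level D C then D.tr f • y else 0 := by
  have hγ := isParity_parity hC n
  let π := (filt k F n (Cyc D C n) (level D C)).projectionOnto _ (isCompl_filt_chiRight hγ C)
  let tr' : (F ⊗[k] Cyc D C n) →ₗ[k] Cyc D C n :=
    (TensorProduct.lid k _).toLinearMap ∘ₗ D.tr.rTensor _
  let τM : IndModule k F n (Cyc D C n) →ₗ[k] Cyc D C n :=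
    tr' ∘ₗ Finsupp.lapply (level D C - 1) ∘ₗ LinearMap.proj (Fin.last n) ∘ₗ
      (Submodule.subtype _) ∘ₗ π
  -- The vector `1 ⊗ 1` in degree zero of the last copy; coset elements send it to pure monomials.
  let one : IndModule k F n (Cyc D C n) := inj k F n _ (Finsupp.single 0 (1 ⊗ₜ 1))
  let τA : Affine D (n + 1) →ₗ[k] Cyc D C n :=
    τM ∘ₗ LinearMap.applyₗ one ∘ₗ (affineRep hγ).lift.toLinearMap
  have hker : LinearMap.ker (mk D C (n + 1)).toLinearMap ≤ LinearMap.ker τA := by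
    intro z hz
    have hz := mem_chiSpan_of_mem_cycIdeal hC ((mk_eq_zero C).1 hz)
    have h1 := lift_mem_range hγ C (chiEval_dunkl_eq_zero C) hz one
    have h2 : π ((affineRep hγ).lift z one) = 0 :=
      (Submodule.projectionOnto_apply_eq_zero_iff _).2 h1
    change tr' (((π ((affineRep hγ).lift z one)) : IndModule k F n (Cyc D C n)) _ _) = 0
    rw [h2]
    exact map_zero _
  let e := (mk D C (n + 1)).toLinearMap.quotKerEquivOfSurjective (mk_surjective C (n + 1))
  refine ⟨(LinearMap.ker (mk D C (n + 1)).toLinearMap).liftQ τA hker ∘ₗ e.symm.toLinearMap,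
    fun j a ha f y => ?_⟩
  have heval : ∀ z, ((LinearMap.ker (mk D C (n + 1)).toLinearMap).liftQ τA hker ∘ₗ
      e.symm.toLinearMap) (mk D C (n + 1) z) = τA z := by
    intro z
    have : e.symm (mk D C (n + 1) z) = Submodule.Quotient.mk z := by
      rw [LinearEquiv.symm_apply_eq]; rfl
    rw [LinearMap.comp_apply, LinearEquiv.coe_coe, this]
    exact Submodule.liftQ_apply _ _ _
  obtain ⟨y, rfl⟩ := mk_surjective C n y
  let z : Affine D (n + 1) := (Affine.rep D (n + 1)).perm (coset j) *
    ((Affine.rep D (n + 1)).x (Fin.last n) ^ a *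
      (Affine.rep D (n + 1)).f (Fin.last n) f * Affine.incl D n y)
  have hz : (rep D C (n + 1)).perm (coset j) * ((rep D C (n + 1)).x (Fin.last n) ^ a *
      (rep D C (n + 1)).f (Fin.last n) f * incl D C n (mk D C n y)) = mk D C (n + 1) z := by
    simp only [z, map_mul, map_pow, incl_mk]
    rfl
  rw [hz, heval]
  have hx : ∀ l, ((affineRep hγ).x (Fin.last n) ^ a) (inj k F n _ l) =
      inj k F n _ ((shift k F (Cyc D C n) ^ a) l) := x_last_pow_inj hγ a
  have h1 : (affineRep hγ).lift z one =
      Pi.single j (Finsupp.single a (f ⊗ₜ mk D C n y)) := by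
    have e1 : (affineRep hγ).lift ((Affine.rep D (n + 1)).perm (coset j)) =
      (wreathRep hγ).perm (coset j) := (affineRep hγ).lift_gen (.perm _)
    have e2 : (affineRep hγ).lift ((Affine.rep D (n + 1)).x (Fin.last n)) =
      (affineRep hγ).x (Fin.last n) := (affineRep hγ).lift_gen (.x _)
    have e3 : (affineRep hγ).lift ((Affine.rep D (n + 1)).f (Fin.last n) f) =
      (wreathRep hγ).f (Fin.last n) f := (affineRep hγ).lift_gen (.f _ _)
    simp only [z, one, map_mul, map_pow, Module.End.mul_apply, e1, e2, e3]
    rw [lift_incl, rep_lift, aAct_single, tensorAction_one_tmul, f_inj, polyTensorRep_last,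
      fAct_single, pow_zero, Module.End.one_apply, mul_one, hx, shift_pow_single, zero_add,
      perm_coset_inj]
  have h2 : (Pi.single j (Finsupp.single a (f ⊗ₜ mk D C n y)) : IndModule k F n (Cyc D C n)) ∈
      filt k F n (Cyc D C n) (level D C) := by
    intro i b hb
    by_cases hi : i = j
    · subst hi
      rw [Pi.single_eq_same, Finsupp.single_eq_of_ne (by omega)]
    · rw [Pi.single_eq_of_ne hi]; rfl
  have h3 : τA z = tr' ((Pi.single j (Finsupp.single a (f ⊗ₜ mk D C n y)) :
      IndModule k F n (Cyc D C n)) (Fin.last n) (level D C - 1)) := by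
    change tr' (((π ((affineRep hγ).lift z one)) : IndModule k F n (Cyc D C n)) _ _) = _
    rw [h1, Submodule.projectionOnto_apply_of_mem_left _ h2]
  rw [h3]
  split_ifs with h
  · obtain ⟨rfl, h⟩ := h
    rw [Pi.single_eq_same, show level D C - 1 = a by omega, Finsupp.single_eq_same]
    simp [tr']
  · by_cases hj : Fin.last n = j
    · subst hj
      rw [Pi.single_eq_same, Finsupp.single_eq_of_ne (by
        intro h'; exact h ⟨rfl, by omega⟩), map_zero]
    · rw [Pi.single_eq_of_ne hj]
      exact map_zero _

end Cyc

end AffineWreath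

/-! ### Monic polynomials and commutation formulas -/

namespace AffineWreath

open AffineWreath.Affine

variable {k F : Type*} [CommRing k] [Ring F] [Algebra k F] {D : FrobeniusSuperalgebra k F}

namespace AffineRep

variable {N : ℕ} {R : Type*} [Ring R] [Algebra k R] (W : AffineRep D N R) {C : CycParam F}

/-- Polynomials in `x_i` of degree less than `m` with coefficients in `F`, homogeneous of degree
`m δ`. -/
def lowerPoly (i : Fin N) (m : ℕ) : Submodule k R :=
  Submodule.span k {z | ∃ a, a < m ∧ ∃ q, ∃ g ∈ D.grade q,
    (a * D.δ, 0) + q = (m * D.δ, 0) ∧ z = W.x i ^ a * W.f i g}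

theorem x_pow_mul_lowerPoly (i : Fin N) (m m' : ℕ) {u : R} (hu : u ∈ W.lowerPoly i m) :
    W.x i ^ m' * u ∈ W.lowerPoly i (m' + m) := by
  induction hu using Submodule.span_induction with
  | mem r hr =>
    obtain ⟨a, ha, q, g, hg, h, rfl⟩ := hr
    refine Submodule.subset_span ⟨m' + a, by omega, q, g, hg, ?_, by rw [pow_add, mul_assoc]⟩
    rw [add_mul, add_mul, Prod.ext_iff] at *
    simp only [Prod.fst_add, Prod.snd_add] at *
    exact ⟨by omega, h.2⟩
  | zero => rw [mul_zero]; exact Submodule.zero_mem _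
  | add a b _ _ ha hb => rw [mul_add]; exact Submodule.add_mem _ ha hb
  | smul c a _ ha => rw [mul_smul_comm]; exact Submodule.smul_mem _ _ ha

theorem lowerPoly_mul (i : Fin N) {m m' b : ℕ} (hb : b ≤ m') {q : ℕ × ZMod 2} {g : F}
    (hg : g ∈ D.grade q) (h : (b * D.δ, 0) + q = (m' * D.δ, 0)) {u : R}
    (hu : u ∈ W.lowerPoly i m) :
    u * (W.x i ^ b * W.f i g) ∈ W.lowerPoly i (m + m') := by
  induction hu using Submodule.span_induction with
  | mem r hr =>
    obtain ⟨a, ha, q', g', hg', h', rfl⟩ := hr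
    refine Submodule.subset_span ⟨a + b, by omega, q' + q, (D.nakayama ^ b) g' * g,
      SetLike.mul_mem_graded (D.nakayama_pow_mem b hg') hg, ?_, ?_⟩
    · rw [add_mul, add_mul, Prod.ext_iff] at *
      simp only [Prod.fst_add, Prod.snd_add, zero_add] at *
      exact ⟨by omega, by rw [h'.2, h.2, zero_add]⟩
    · rw [mul_assoc, ← mul_assoc (W.f i g'), W.f_x_pow_same, pow_add, map_mul]
      simp only [mul_assoc]
  | zero => rw [zero_mul]; exact Submodule.zero_mem _
  | add a b _ _ ha hb => rw [add_mul]; exact Submodule.add_mem _ ha hb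
  | smul c a _ ha => rw [smul_mul_assoc]; exact Submodule.smul_mem _ _ ha

/-- `P` is a homogeneous monic polynomial of degree `m` in `x_i`. -/
def IsMonicPoly (i : Fin N) (m : ℕ) (P : R) : Prop := P - W.x i ^ m ∈ W.lowerPoly i m

theorem IsMonicPoly.one (i : Fin N) : W.IsMonicPoly i 0 1 := by
  simp [IsMonicPoly]

/-- Of the three error terms of the product each still contains at least one factor of lower degree,
and moving coefficients past `x_i` merely applies powers of `ψ`. -/
theorem IsMonicPoly.mul {W : AffineRep D N R} {i : Fin N} {m m' : ℕ} {P P' : R}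
    (h : W.IsMonicPoly i m P) (h' : W.IsMonicPoly i m' P') :
    W.IsMonicPoly i (m + m') (P * P') := by
  have e : P * P' - W.x i ^ (m + m') = W.x i ^ m * (P' - W.x i ^ m') +
      (P - W.x i ^ m) * (W.x i ^ m' * W.f i 1) + (P - W.x i ^ m) * (P' - W.x i ^ m') := by
    rw [map_one, mul_one, pow_add]
    simp only [mul_sub, sub_mul]
    abel
  rw [IsMonicPoly, e]
  refine Submodule.add_mem _ (Submodule.add_mem _ (W.x_pow_mul_lowerPoly i _ _ h') ?_) ?_
  · exact W.lowerPoly_mul i le_rfl (SetLike.GradedOne.one_mem (A := D.grade)) (by simp) h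
  · have h' : P' - W.x i ^ m' ∈ W.lowerPoly i m' := h'
    generalize P' - W.x i ^ m' = u at h'
    induction h' using Submodule.span_induction with
    | mem r hr =>
      obtain ⟨a, ha, q', g', hg', h', rfl⟩ := hr
      exact W.lowerPoly_mul i ha.le hg' h' h
    | zero => rw [mul_zero]; exact Submodule.zero_mem _
    | add a b _ _ ha hb => rw [mul_add]; exact Submodule.add_mem _ ha hb
    | smul c a _ ha => rw [mul_smul_comm]; exact Submodule.smul_mem _ _ ha

theorem IsMonicPoly.list_prod {α : Type*} {i : Fin N} (s : List α) {g : α → ℕ} {P : α → R}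
    (h : ∀ j ∈ s, W.IsMonicPoly i (g j) (P j)) :
    W.IsMonicPoly i (s.map g).sum (s.map P).prod := by
  induction s with
  | nil => exact IsMonicPoly.one W i
  | cons j s ih =>
    rw [List.map_cons, List.map_cons, List.sum_cons, List.prod_cons]
    exact (h j (by simp)).mul (ih fun l hl => h l (by simp [hl]))

/-- Homogeneity is kept because `c^{(m,j)}` has degree `m δ`. In the quotient for one position this
rewrites `x_1^d` by lower powers of the same degree. -/
theorem chiEval_isMonicPoly (hC : C.Admissible D) (i : Fin N) :
    W.IsMonicPoly i (level D C) (chiEval D C (W.f i) (W.x i)) := by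
  rw [← sum_range'_eq_level]
  refine IsMonicPoly.list_prod W _ fun m hm => IsMonicPoly.list_prod W _ fun j hj => ?_
  rw [List.mem_range'_1] at hm hj
  rw [IsMonicPoly, sub_sub_cancel_left]
  refine Submodule.neg_mem _ (Submodule.subset_span ⟨0, hm.1, (m * D.δ, 0), C.c m j,
    hC.mem m (by simp only [Finset.mem_Icc]; omega) j (by simp only [Finset.mem_Icc]; omega),
    by simp, by simp⟩)

variable {i i' : Fin N} (h : i'.val = i.val + 1)
include h

theorem s_x' : W.perm (Equiv.swap i i') * W.x i' =
    W.x i * W.perm (Equiv.swap i i') + W.tel i' i := by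
  have h1 := congrArg (fun r => W.perm (Equiv.swap i i') * r * W.perm (Equiv.swap i i'))
    (W.s_x i i' h)
  have h2 := W.perm_tel (Equiv.swap i i') i i'
  rw [Equiv.swap_apply_left, Equiv.swap_apply_right] at h2
  simp only [mul_sub, sub_mul, h2, ← mul_assoc, W.perm_swap_mul_self, one_mul] at h1
  simp only [mul_assoc, W.perm_swap_mul_self, mul_one] at h1
  rw [h1, sub_add_cancel]

/-- Each step of the telescoping sum contributes one teleporter and uses up one power of `x`. All
errors therefore have total exponent `a - 1`, and this drop is the source of all later
triangularity. -/
theorem s_x_pow (a : ℕ) :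
    W.perm (Equiv.swap i i') * W.x i ^ a - W.x i' ^ a * W.perm (Equiv.swap i i') ∈
      Submodule.span k {z | ∃ p q, p + q + 1 = a ∧ z = W.x i' ^ q * W.tel i i' * W.x i ^ p} := by
  induction a with
  | zero => simp
  | succ a ih =>
    have e : W.perm (Equiv.swap i i') * W.x i ^ (a + 1) -
        W.x i' ^ (a + 1) * W.perm (Equiv.swap i i') =
        (W.perm (Equiv.swap i i') * W.x i ^ a - W.x i' ^ a * W.perm (Equiv.swap i i')) * W.x i +
          -(W.x i' ^ a * W.tel i i') := by
      have h1 := W.s_x i i' h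
      rw [pow_succ, pow_succ, sub_mul, mul_assoc (W.x i' ^ a), mul_assoc (W.x i' ^ a), h1,
        mul_sub, mul_assoc]
      abel
    rw [e]
    refine Submodule.add_mem _ ?_ (Submodule.neg_mem _ (Submodule.subset_span ⟨0, a, by omega,
      by rw [pow_zero, mul_one]⟩))
    generalize W.perm (Equiv.swap i i') * W.x i ^ a - W.x i' ^ a * W.perm (Equiv.swap i i') = u
      at ih
    induction ih using Submodule.span_induction with
    | mem r hr =>
      obtain ⟨p, q, hpq, rfl⟩ := hr
      exact Submodule.subset_span ⟨p + 1, q, by omega, by rw [pow_succ]; simp only [mul_assoc]⟩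
    | zero => rw [zero_mul]; exact Submodule.zero_mem _
    | add a b _ _ ha hb => rw [add_mul]; exact Submodule.add_mem _ ha hb
    | smul c a _ ha => rw [smul_mul_assoc]; exact Submodule.smul_mem _ _ ha

theorem s_x'_pow (a : ℕ) :
    W.perm (Equiv.swap i i') * W.x i' ^ a - W.x i ^ a * W.perm (Equiv.swap i i') ∈
      Submodule.span k {z | ∃ p q, p + q + 1 = a ∧ z = W.x i ^ p * W.tel i' i * W.x i' ^ q} := by
  induction a with
  | zero => simp
  | succ a ih =>
    have e : W.perm (Equiv.swap i i') * W.x i' ^ (a + 1) -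
        W.x i ^ (a + 1) * W.perm (Equiv.swap i i') =
        (W.perm (Equiv.swap i i') * W.x i' ^ a - W.x i ^ a * W.perm (Equiv.swap i i')) * W.x i' +
          W.x i ^ a * W.tel i' i := by
      have h1 := W.s_x' h
      rw [pow_succ, pow_succ, sub_mul, mul_assoc (W.x i ^ a), mul_assoc (W.x i ^ a), h1,
        mul_add, mul_assoc]
      abel
    rw [e]
    refine Submodule.add_mem _ ?_ (Submodule.subset_span ⟨a, 0, by omega,
      by rw [pow_zero, mul_one]⟩)
    generalize W.perm (Equiv.swap i i') * W.x i' ^ a - W.x i ^ a * W.perm (Equiv.swap i i') = u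
      at ih
    induction ih using Submodule.span_induction with
    | mem r hr =>
      obtain ⟨p, q, hpq, rfl⟩ := hr
      exact Submodule.subset_span ⟨p, q + 1, by omega, by rw [pow_succ]; simp only [mul_assoc]⟩
    | zero => rw [zero_mul]; exact Submodule.zero_mem _
    | add a b _ _ ha hb => rw [add_mul]; exact Submodule.add_mem _ ha hb
    | smul c a _ ha => rw [smul_mul_assoc]; exact Submodule.smul_mem _ _ ha

end AffineRep

namespace Cyc

variable {C : CycParam F}

/-- Linear maps preserve membership of spans checked on generators. -/
theorem mem_of_span {M M' : Type*} [AddCommGroup M] [Module k M] [AddCommGroup M'] [Module k M']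
    (g : M →ₗ[k] M') {s : Set M} {P : Submodule k M'} (h : ∀ z ∈ s, g z ∈ P) {z : M}
    (hz : z ∈ Submodule.span k s) : g z ∈ P :=
  (Submodule.span_le (p := P.comap g)).2 h hz

theorem one_mem_grade (n : ℕ) : (1 : Cyc D C n) ∈ grade D C n 0 :=
  Submodule.subset_span IsMonomial.one

theorem f_mem_grade {n : ℕ} (i : Fin n) {p : ℕ × ZMod 2} {a : F} (ha : a ∈ D.grade p) :
    (rep D C n).f i a ∈ grade D C n p :=
  Submodule.subset_span (IsMonomial.f i p a ha)

theorem x_mem_grade {n : ℕ} (i : Fin n) : (rep D C n).x i ∈ grade D C n (D.δ, 0) :=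
  Submodule.subset_span (IsMonomial.x i)

theorem perm_mem_grade {n : ℕ} (π : Equiv.Perm (Fin n)) :
    (rep D C n).perm π ∈ grade D C n 0 :=
  Submodule.subset_span (IsMonomial.perm π)

theorem mul_mem_grade {n : ℕ} {p q : ℕ × ZMod 2} {y z : Cyc D C n} (hy : y ∈ grade D C n p)
    (hz : z ∈ grade D C n q) : y * z ∈ grade D C n (p + q) := by
  refine mem_of_span (LinearMap.mulRight k z) (P := grade D C n (p + q)) (fun y hy => ?_) hy
  refine mem_of_span (LinearMap.mulLeft k y) (P := grade D C n (p + q)) (fun z hz => ?_) hz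
  exact Submodule.subset_span (IsMonomial.mul p q y z hy hz)

theorem x_pow_mem_grade {n : ℕ} (i : Fin n) (a : ℕ) :
    (rep D C n).x i ^ a ∈ grade D C n (a * D.δ, 0) := by
  induction a with
  | zero => rw [pow_zero, zero_mul]; exact one_mem_grade n
  | succ a ih =>
    rw [pow_succ]
    have := mul_mem_grade ih (x_mem_grade i)
    rwa [Prod.mk_add_mk, add_zero, ← Nat.succ_mul] at this

/-- Only spanning is needed later; whether the homogeneous pieces form a direct sum plays no role.
-/
theorem iSup_grade (n : ℕ) : ⨆ p, grade D C n p = ⊤ := by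
  rw [eq_top_iff]
  rintro z -
  have hz : z ∈ Algebra.adjoin k (Set.range (gen D C (n := n))) := by
    rw [adjoin_gen]; trivial
  induction hz using Algebra.adjoin_induction with
  | mem g hg =>
    obtain ⟨g, rfl⟩ := hg
    cases g with
    | x l => exact Submodule.mem_iSup_of_mem _ (x_mem_grade l)
    | f l a =>
      change ((rep D C n).f l).toLinearMap a ∈ _
      induction a using DirectSum.Decomposition.inductionOn D.grade with
      | zero => rw [map_zero]; exact Submodule.zero_mem _
      | homogeneous m => exact Submodule.mem_iSup_of_mem _ (f_mem_grade l m.2)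
      | add a b ha hb => rw [map_add]; exact Submodule.add_mem _ ha hb
    | perm π => exact Submodule.mem_iSup_of_mem _ (perm_mem_grade π)
  | algebraMap c =>
    rw [Algebra.algebraMap_eq_smul_one]
    exact Submodule.smul_mem _ _ (Submodule.mem_iSup_of_mem _ (one_mem_grade n))
  | add a b _ _ ha hb => exact Submodule.add_mem _ ha hb
  | mul a b ha' hb' ha hb =>
    clear ha' hb'
    induction ha using Submodule.iSup_induction' with
    | zero => rw [zero_mul]; exact Submodule.zero_mem _
    | add x y _ _ hx hy => rw [add_mul]; exact Submodule.add_mem _ hx hy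
    | mem p a ha =>
      induction hb using Submodule.iSup_induction' with
      | zero => rw [mul_zero]; exact Submodule.zero_mem _
      | add x y _ _ hx hy => rw [mul_add]; exact Submodule.add_mem _ hx hy
      | mem q b hb => exact Submodule.mem_iSup_of_mem _ (mul_mem_grade ha hb)

theorem incl_f {n : ℕ} (i : Fin n) (a : F) :
    incl D C n ((rep D C n).f i a) = (rep D C (n + 1)).f i.castSucc a :=
  incl_gen D C (.f i a)

theorem incl_x {n : ℕ} (i : Fin n) :
    incl D C n ((rep D C n).x i) = (rep D C (n + 1)).x i.castSucc :=
  incl_gen D C (.x i)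

theorem incl_perm {n : ℕ} (π : Equiv.Perm (Fin n)) :
    incl D C n ((rep D C n).perm π) = (rep D C (n + 1)).perm (extendPerm π) :=
  incl_gen D C (.perm π)

theorem induction_gen {n : ℕ} {P : Cyc D C n → Prop} (z : Cyc D C n)
    (x : ∀ i, P ((rep D C n).x i)) (f : ∀ i p, ∀ a ∈ D.grade p, P ((rep D C n).f i a))
    (perm : ∀ π, P ((rep D C n).perm π)) (algebraMap : ∀ r, P (algebraMap k _ r))
    (add : ∀ a b, P a → P b → P (a + b)) (mul : ∀ a b, P a → P b → P (a * b)) : P z := by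
  have hz : z ∈ Algebra.adjoin k (Set.range (gen D C (n := n))) := by
    rw [adjoin_gen]; trivial
  induction hz using Algebra.adjoin_induction with
  | mem g hg =>
    obtain ⟨g, rfl⟩ := hg
    cases g with
    | x l => exact x l
    | f l a =>
      change P (((rep D C n).f l).toLinearMap a)
      induction a using DirectSum.Decomposition.inductionOn D.grade with
      | zero => rw [map_zero]; simpa using algebraMap 0
      | homogeneous m => exact f l _ _ m.2
      | add a b ha hb => rw [map_add]; exact add _ _ ha hb
    | perm π => exact perm π
  | algebraMap c => exact algebraMap c
  | add a b _ _ ha hb => exact add _ _ ha hb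
  | mul a b _ _ ha hb => exact mul _ _ ha hb

/-- For permutations this rests on the fact that `S_n` preserves the set of positions below the last
one. -/
theorem incl_mul_x_last {n : ℕ} (y : Cyc D C n) :
    incl D C n y * (rep D C (n + 1)).x (Fin.last n) =
      (rep D C (n + 1)).x (Fin.last n) * incl D C n y := by
  induction y using induction_gen with
  | x i => rw [incl_x, AffineRep.x_comm]
  | f i p a _ => rw [incl_f, AffineRep.f_x_ne _ _ _ (Fin.castSucc_lt_last i).ne]
  | perm π =>
    have h := (rep D C (n + 1)).perm_x_of_forall_lt (π := extendPerm π) (i := Fin.last n)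
      (fun q => by
        induction q using Fin.lastCases with
        | last => simp [extendPerm_last]
        | cast q => simp [extendPerm_last, extendPerm_castSucc, Fin.castSucc_lt_last])
    rwa [extendPerm_last, ← incl_perm] at h
  | algebraMap r => rw [AlgHom.commutes, Algebra.commutes]
  | add a b ha hb => rw [map_add, add_mul, mul_add, ha, hb]
  | mul a b ha hb => rw [map_mul, mul_assoc, hb, ← mul_assoc, ha, mul_assoc]

theorem incl_mul_x_last_pow {n : ℕ} (y : Cyc D C n) (a : ℕ) :
    incl D C n y * (rep D C (n + 1)).x (Fin.last n) ^ a =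
      (rep D C (n + 1)).x (Fin.last n) ^ a * incl D C n y :=
  Commute.pow_right (incl_mul_x_last y) a

theorem koszul_smul_koszul_smul {M : Type*} [AddCommGroup M] [Module k M] (p q : ℕ × ZMod 2)
    (m : M) : (koszul p q : k) • (koszul p q : k) • m = m := by
  rw [smul_smul, ← Int.cast_mul, koszul_mul_self, Int.cast_one, one_smul]

theorem _root_.AffineWreath.TensorRep.supercomm_smul {ι R : Type*} [Ring R] [Algebra k R]
    (W : TensorRep D ι R) {i j : ι} (hij : i ≠ j) {p q : ℕ × ZMod 2} {a b : F}
    (ha : a ∈ D.grade p) (hb : b ∈ D.grade q) :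
    W.f i a * W.f j b = (koszul p q : k) • (W.f j b * W.f i a) := by
  rw [Int.cast_smul_eq_zsmul, W.supercomm i j hij p q a b ha hb]

theorem incl_mul_f_last {n : ℕ} {r q : ℕ × ZMod 2} {y : Cyc D C n} (hy : y ∈ grade D C n r)
    {f : F} (hf : f ∈ D.grade q) :
    incl D C n y * (rep D C (n + 1)).f (Fin.last n) f =
      (koszul r q : k) • ((rep D C (n + 1)).f (Fin.last n) f * incl D C n y) := by
  induction hy using Submodule.span_induction with
  | mem y hy =>
    induction hy with
    | one => rw [map_one, one_mul, mul_one, koszul_even_left _ rfl, Int.cast_one, one_smul]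
    | x i =>
      rw [koszul_even_left _ rfl, Int.cast_one, one_smul]
      change incl D C n ((rep D C n).x i) * _ = _ * incl D C n ((rep D C n).x i)
      rw [incl_x, AffineRep.f_x_ne _ _ _ (Fin.castSucc_lt_last i).ne']
    | f i p a ha =>
      change incl D C n ((rep D C n).f i a) * _ = _ • (_ * incl D C n ((rep D C n).f i a))
      rw [incl_f, TensorRep.supercomm_smul _ (Fin.castSucc_lt_last i).ne ha hf]
    | perm π =>
      rw [koszul_even_left _ rfl, Int.cast_one, one_smul]
      change incl D C n ((rep D C n).perm π) * _ = _ * incl D C n ((rep D C n).perm π)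
      rw [incl_perm, WreathRep.perm_f, extendPerm_last]
    | mul p p' y z _ _ hy hz =>
      rw [map_mul, mul_assoc, hz, mul_smul_comm, ← mul_assoc, hy, smul_mul_assoc, smul_smul,
        koszul_add_left, Int.cast_mul, mul_comm (koszul p q : k), mul_assoc]
  | zero => simp
  | add a b _ _ ha hb => rw [map_add, add_mul, mul_add, ha, hb, smul_add]
  | smul c a _ ha => rw [map_smul, smul_mul_assoc, ha, mul_smul_comm, smul_comm]

theorem f_last_mul_incl {n : ℕ} {r q : ℕ × ZMod 2} {y : Cyc D C n} (hy : y ∈ grade D C n r)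
    {f : F} (hf : f ∈ D.grade q) :
    (rep D C (n + 1)).f (Fin.last n) f * incl D C n y =
      (koszul r q : k) • (incl D C n y * (rep D C (n + 1)).f (Fin.last n) f) := by
  rw [incl_mul_f_last hy hf, koszul_smul_koszul_smul]

end Cyc

end AffineWreath

/-! ### Homogeneous spanning sets -/

namespace AffineWreath

open AffineWreath.Affine

variable {k F : Type*} [CommRing k] [Ring F] [Algebra k F] {D : FrobeniusSuperalgebra k F}

namespace Cyc

variable {C : CycParam F}

variable (D C) in
/-- The span of the homogeneous `x_{n+1}^a f_{n+1} y` of degree `p` with `a < d`. -/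
noncomputable def leadPart (n : ℕ) (p : ℕ × ZMod 2) : Submodule k (Cyc D C (n + 1)) :=
  Submodule.span k {z | ∃ a, a < level D C ∧ ∃ q, ∃ f ∈ D.grade q, ∃ r, ∃ y ∈ grade D C n r,
    (a * D.δ, 0) + q + r = p ∧ z = (rep D C (n + 1)).x (Fin.last n) ^ a *
      ((rep D C (n + 1)).f (Fin.last n) f * incl D C n y)}

variable (D C) in
/-- The span of the homogeneous `y s_n y'` of degree `p`. -/
noncomputable def midPart (n : ℕ) (p : ℕ × ZMod 2) : Submodule k (Cyc D C (n + 1)) :=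
  Submodule.span k {z | ∃ i : Fin n, i.val + 1 = n ∧ ∃ r, ∃ y ∈ grade D C n r, ∃ r',
    ∃ y' ∈ grade D C n r', r + r' = p ∧ z = incl D C n y *
      ((rep D C (n + 1)).perm (Equiv.swap i.castSucc (Fin.last n)) * incl D C n y')}

variable {n : ℕ}

theorem incl_mem_grade {r : ℕ × ZMod 2} {y : Cyc D C n} (hy : y ∈ grade D C n r) :
    incl D C n y ∈ grade D C (n + 1) r := by
  refine mem_of_span (incl D C n).toLinearMap (P := grade D C (n + 1) r) ?_ hy
  intro z hz
  clear hy
  rw [AlgHom.toLinearMap_apply]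
  induction hz with
  | one => rw [map_one]; exact one_mem_grade _
  | x i => exact (incl_x (C := C) (D := D) i).symm ▸ x_mem_grade _
  | f i p a ha => exact (incl_f (C := C) (D := D) i a).symm ▸ f_mem_grade _ ha
  | perm π => exact (incl_perm (C := C) (D := D) π).symm ▸ perm_mem_grade _
  | mul p q y z _ _ hy hz => rw [map_mul]; exact mul_mem_grade hy hz

theorem incl_mul_leadPart {r p : ℕ × ZMod 2} {y : Cyc D C n} (hy : y ∈ grade D C n r)
    {z : Cyc D C (n + 1)} (hz : z ∈ leadPart D C n p) :
    incl D C n y * z ∈ leadPart D C n (r + p) := by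
  refine mem_of_span (LinearMap.mulLeft k (incl D C n y)) (P := leadPart D C n (r + p)) ?_ hz
  rintro _ ⟨a, ha, q, f, hf, r', y', hy', rfl, rfl⟩
  rw [LinearMap.mulLeft_apply, ← mul_assoc, incl_mul_x_last_pow, mul_assoc, ← mul_assoc _ _
    (incl D C n y'), incl_mul_f_last hy hf, smul_mul_assoc, mul_smul_comm]
  refine Submodule.smul_mem _ _ (Submodule.subset_span
    ⟨a, ha, q, f, hf, r + r', y * y', mul_mem_grade hy hy', by abel, ?_⟩)
  simp only [map_mul, mul_assoc]

theorem f_mul_leadPart {q p : ℕ × ZMod 2} {f : F} (hf : f ∈ D.grade q)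
    {z : Cyc D C (n + 1)} (hz : z ∈ leadPart D C n p) :
    (rep D C (n + 1)).f (Fin.last n) f * z ∈ leadPart D C n (q + p) := by
  refine mem_of_span (LinearMap.mulLeft k ((rep D C (n + 1)).f (Fin.last n) f))
    (P := leadPart D C n (q + p)) ?_ hz
  rintro _ ⟨a, ha, q', f', hf', r', y', hy', rfl, rfl⟩
  refine Submodule.subset_span ⟨a, ha, q + q', (D.nakayama ^ a) f * f',
    SetLike.mul_mem_graded (D.nakayama_pow_mem a hf) hf', r', y', hy', by abel, ?_⟩
  rw [LinearMap.mulLeft_apply, ← mul_assoc, AffineRep.f_x_pow_same, map_mul]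
  simp only [mul_assoc]

theorem incl_mul_midPart {r p : ℕ × ZMod 2} {y : Cyc D C n} (hy : y ∈ grade D C n r)
    {z : Cyc D C (n + 1)} (hz : z ∈ midPart D C n p) :
    incl D C n y * z ∈ midPart D C n (r + p) := by
  refine mem_of_span (LinearMap.mulLeft k (incl D C n y)) (P := midPart D C n (r + p)) ?_ hz
  rintro _ ⟨i, hi, r', y', hy', r'', y'', hy'', rfl, rfl⟩
  refine Submodule.subset_span ⟨i, hi, r + r', y * y', mul_mem_grade hy hy', r'', y'', hy'',
    by abel, ?_⟩
  rw [LinearMap.mulLeft_apply, map_mul]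
  simp only [mul_assoc]

theorem f_last_mul_swap (i : Fin n) (f : F) :
    (rep D C (n + 1)).f (Fin.last n) f *
      (rep D C (n + 1)).perm (Equiv.swap i.castSucc (Fin.last n)) =
    (rep D C (n + 1)).perm (Equiv.swap i.castSucc (Fin.last n)) *
      incl D C n ((rep D C n).f i f) := by
  rw [incl_f, WreathRep.perm_f, Equiv.swap_apply_left]

theorem swap_mul_f_last (i : Fin n) (f : F) :
    (rep D C (n + 1)).perm (Equiv.swap i.castSucc (Fin.last n)) *
      (rep D C (n + 1)).f (Fin.last n) f =
    incl D C n ((rep D C n).f i f) *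
      (rep D C (n + 1)).perm (Equiv.swap i.castSucc (Fin.last n)) := by
  rw [incl_f, WreathRep.perm_f, Equiv.swap_apply_right]

theorem f_mul_midPart {q p : ℕ × ZMod 2} {f : F} (hf : f ∈ D.grade q)
    {z : Cyc D C (n + 1)} (hz : z ∈ midPart D C n p) :
    (rep D C (n + 1)).f (Fin.last n) f * z ∈ midPart D C n (q + p) := by
  refine mem_of_span (LinearMap.mulLeft k ((rep D C (n + 1)).f (Fin.last n) f))
    (P := midPart D C n (q + p)) ?_ hz
  rintro _ ⟨i, hi, r, y, hy, r', y', hy', rfl, rfl⟩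
  rw [LinearMap.mulLeft_apply, ← mul_assoc, f_last_mul_incl hy hf, smul_mul_assoc, mul_assoc,
    ← mul_assoc _ _ (incl D C n y'), f_last_mul_swap, mul_assoc _ _ (incl D C n y'), ← map_mul]
  exact Submodule.smul_mem _ _ (Submodule.subset_span ⟨i, hi, r, y, hy, q + r', _,
    mul_mem_grade (f_mem_grade i hf) hy', by abel, rfl⟩)

theorem tel_mul_leadPart (i : Fin n) {p : ℕ × ZMod 2} {z : Cyc D C (n + 1)}
    (hz : z ∈ leadPart D C n p) :
    (rep D C (n + 1)).tel (Fin.last n) i.castSucc * z ∈ leadPart D C n ((D.δ, 0) + p) := by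
  rw [TensorRep.tel, Finset.sum_mul]
  refine Submodule.sum_mem _ fun b _ => ?_
  rw [mul_assoc, ← incl_f, ← D.deg_add_dualDeg b, add_assoc]
  exact f_mul_leadPart (D.basis_mem b) (incl_mul_leadPart (f_mem_grade i (D.dualBasis_mem b)) hz)

theorem tel_mul_leadPart' (i : Fin n) {p : ℕ × ZMod 2} {z : Cyc D C (n + 1)}
    (hz : z ∈ leadPart D C n p) :
    (rep D C (n + 1)).tel i.castSucc (Fin.last n) * z ∈ leadPart D C n ((D.δ, 0) + p) := by
  rw [TensorRep.tel, Finset.sum_mul]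
  refine Submodule.sum_mem _ fun b _ => ?_
  rw [mul_assoc, ← incl_f, ← D.deg_add_dualDeg b, add_assoc]
  exact incl_mul_leadPart (f_mem_grade i (D.basis_mem b)) (f_mul_leadPart (D.dualBasis_mem b) hz)

theorem tel_mul_midPart' (i : Fin n) {p : ℕ × ZMod 2} {z : Cyc D C (n + 1)}
    (hz : z ∈ midPart D C n p) :
    (rep D C (n + 1)).tel i.castSucc (Fin.last n) * z ∈ midPart D C n ((D.δ, 0) + p) := by
  rw [TensorRep.tel, Finset.sum_mul]
  refine Submodule.sum_mem _ fun b _ => ?_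
  rw [mul_assoc, ← incl_f, ← D.deg_add_dualDeg b, add_assoc]
  exact incl_mul_midPart (f_mem_grade i (D.basis_mem b)) (f_mul_midPart (D.dualBasis_mem b) hz)

theorem correction_mul_mem_leadPart {i : Fin n} {a : ℕ} (ha : a ≤ level D C)
    {q r : ℕ × ZMod 2} {f : F} (hf : f ∈ D.grade q) {y : Cyc D C n} (hy : y ∈ grade D C n r)
    {u : Cyc D C (n + 1)} (hu : u ∈ Submodule.span k {z | ∃ p q, p + q + 1 = a ∧
      z = (rep D C (n + 1)).x i.castSucc ^ p * (rep D C (n + 1)).tel (Fin.last n) i.castSucc *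
        (rep D C (n + 1)).x (Fin.last n) ^ q}) :
    u * ((rep D C (n + 1)).f (Fin.last n) f * incl D C n y) ∈
      leadPart D C n ((a * D.δ, 0) + q + r) := by
  refine mem_of_span (LinearMap.mulRight k _) (P := leadPart D C n ((a * D.δ, 0) + q + r)) ?_ hu
  rintro _ ⟨p', q', rfl, rfl⟩
  have h1 : (rep D C (n + 1)).x (Fin.last n) ^ q' *
      ((rep D C (n + 1)).f (Fin.last n) f * incl D C n y) ∈
      leadPart D C n ((q' * D.δ, 0) + q + r) :=
    Submodule.subset_span ⟨q', by omega, q, f, hf, r, y, hy, rfl, rfl⟩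
  have h2 := incl_mul_leadPart (x_pow_mem_grade i p') (tel_mul_leadPart i h1)
  rw [LinearMap.mulRight_apply, mul_assoc, mul_assoc, ← incl_x, ← map_pow]
  convert h2 using 1
  have : (((p' + q' + 1) * D.δ, 0) : ℕ × ZMod 2) =
      (p' * D.δ, 0) + ((D.δ, 0) + (q' * D.δ, 0)) := by
    ext <;> simp [add_mul]; ring
  rw [this]
  abel_nf

/-- Up to terms with smaller powers, `s_n x_{n+1}^a f_{n+1} y` equals `x_n^a f_n s_n y`, which lies
in `𝒜_n s_n 𝒜_n`. -/
theorem swap_mul_leadPart {i : Fin n} (hi : i.val + 1 = n) {p : ℕ × ZMod 2}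
    {z : Cyc D C (n + 1)} (hz : z ∈ leadPart D C n p) :
    (rep D C (n + 1)).perm (Equiv.swap i.castSucc (Fin.last n)) * z ∈
      leadPart D C n p ⊔ midPart D C n p := by
  refine mem_of_span (LinearMap.mulLeft k _) (P := leadPart D C n p ⊔ midPart D C n p) ?_ hz
  rintro _ ⟨a, ha, q, f, hf, r, y, hy, rfl, rfl⟩
  have h1 := correction_mul_mem_leadPart ha.le hf hy
    ((rep D C (n + 1)).s_x'_pow (i := i.castSucc) (i' := Fin.last n) (by simp [hi]) a)
  rw [sub_mul, mul_assoc] at h1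
  have h2 : (rep D C (n + 1)).x i.castSucc ^ a *
      (rep D C (n + 1)).perm (Equiv.swap i.castSucc (Fin.last n)) *
      ((rep D C (n + 1)).f (Fin.last n) f * incl D C n y) ∈
      midPart D C n ((a * D.δ, 0) + q + r) := by
    rw [mul_assoc, ← mul_assoc _ _ (incl D C n y), swap_mul_f_last, mul_assoc, ← mul_assoc,
      ← incl_x, ← map_pow, ← map_mul]
    exact Submodule.subset_span ⟨i, hi, _, _, mul_mem_grade (x_pow_mem_grade i a)
      (f_mem_grade i hf), r, y, hy, rfl, rfl⟩
  have h3 := Submodule.add_mem_sup h1 h2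
  rwa [sub_add_cancel] at h3

theorem perm_swap_commute_incl_incl (y : Cyc D C n) :
    (rep D C (n + 2)).perm (Equiv.swap (Fin.last n).castSucc (Fin.last (n + 1))) *
      incl D C (n + 1) (incl D C n y) = incl D C (n + 1) (incl D C n y) *
      (rep D C (n + 2)).perm (Equiv.swap (Fin.last n).castSucc (Fin.last (n + 1))) := by
  have hne : ∀ i : Fin n, i.castSucc.castSucc ≠ (Fin.last n).castSucc := fun i h =>
    (Fin.castSucc_lt_last i).ne (Fin.castSucc_injective _ h)
  induction y using induction_gen with
  | x i =>
    rw [incl_x, incl_x, AffineRep.s_x_ne _ _ _ _ (by simp) (hne i) (Fin.castSucc_lt_last _).ne]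
  | f i p a _ =>
    rw [incl_f, incl_f, WreathRep.perm_f, Equiv.swap_apply_of_ne_of_ne (hne i)
      (Fin.castSucc_lt_last _).ne]
  | perm π =>
    rw [incl_perm, incl_perm, ← map_mul, ← map_mul, Equiv.mul_swap_eq_swap_mul,
      extendPerm_castSucc, extendPerm_last, extendPerm_last]
  | algebraMap r => simp only [AlgHom.commutes, Algebra.commutes]
  | add a b ha hb => simp only [map_add, add_mul, mul_add, ha, hb]
  | mul a b ha hb => rw [map_mul, map_mul, ← mul_assoc, ha, mul_assoc, hb, mul_assoc]

theorem incl_perm_swap (i j : Fin n) :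
    incl D C n ((rep D C n).perm (Equiv.swap i j)) =
      (rep D C (n + 1)).perm (Equiv.swap i.castSucc j.castSucc) := by
  rw [incl_perm, extendPerm_swap]

theorem swap_incl_swap (i : Fin n) :
    (rep D C (n + 2)).perm (Equiv.swap (Fin.last n).castSucc (Fin.last (n + 1))) *
      (incl D C (n + 1) ((rep D C (n + 1)).perm (Equiv.swap i.castSucc (Fin.last n))) *
      (rep D C (n + 2)).perm (Equiv.swap (Fin.last n).castSucc (Fin.last (n + 1)))) =
    incl D C (n + 1) ((rep D C (n + 1)).perm (Equiv.swap i.castSucc (Fin.last n))) *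
      ((rep D C (n + 2)).perm (Equiv.swap (Fin.last n).castSucc (Fin.last (n + 1))) *
      incl D C (n + 1) ((rep D C (n + 1)).perm (Equiv.swap i.castSucc (Fin.last n)))) := by
  have h1 : i.castSucc.castSucc ≠ (Fin.last n).castSucc := fun h =>
    (Fin.castSucc_lt_last i).ne (Fin.castSucc_injective _ h)
  have h2 : i.castSucc.castSucc ≠ Fin.last (n + 1) := (Fin.castSucc_lt_last _).ne
  have h3 : (Fin.last n).castSucc ≠ Fin.last (n + 1) := (Fin.castSucc_lt_last _).ne
  rw [incl_perm_swap, ← map_mul, ← map_mul, ← map_mul, ← map_mul, ← mul_assoc, ← mul_assoc]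
  congr 1
  rw [Equiv.swap_mul_swap_mul_swap h1 h2, Equiv.swap_comm i.castSucc.castSucc,
    Equiv.swap_comm (Fin.last n).castSucc (Fin.last (n + 1)),
    Equiv.swap_mul_swap_mul_swap h3.symm h2.symm]
  exact Equiv.swap_comm _ _

/-- Conjugation by `s` turns the leading term into `x_{n+2}^a f_{n+2}`, up to `s` applied to terms
of smaller exponent, and `swap_mul_leadPart` handles these. The factor from `𝒜_n` commutes with `s`.
-/
theorem swap_mul_incl_lead_mul_swap {r₁ r' q : ℕ × ZMod 2} {a : ℕ} (ha : a < level D C) {f : F}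
    (hf : f ∈ D.grade q) {y₁ : Cyc D C n} (hy₁ : y₁ ∈ grade D C n r₁) {y' : Cyc D C (n + 1)}
    (hy' : y' ∈ grade D C (n + 1) r') :
    (rep D C (n + 2)).perm (Equiv.swap (Fin.last n).castSucc (Fin.last (n + 1))) *
      (incl D C (n + 1) ((rep D C (n + 1)).x (Fin.last n) ^ a *
        ((rep D C (n + 1)).f (Fin.last n) f * incl D C n y₁)) *
      ((rep D C (n + 2)).perm (Equiv.swap (Fin.last n).castSucc (Fin.last (n + 1))) *
        incl D C (n + 1) y')) ∈
      leadPart D C (n + 1) ((a * D.δ, 0) + q + r₁ + r') ⊔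
        midPart D C (n + 1) ((a * D.δ, 0) + q + r₁ + r') := by
  have hy₂ := incl_mem_grade hy₁
  have h1 := (rep D C (n + 2)).s_x'_pow (i := (Fin.last n).castSucc) (i' := Fin.last (n + 1))
    (by simp) a
  have h2 := correction_mul_mem_leadPart ha.le hf (mul_mem_grade hy₂ hy') h1
  have h3 := swap_mul_leadPart (i := Fin.last n) rfl h2
  have h4 : (rep D C (n + 2)).x (Fin.last (n + 1)) ^ a *
      ((rep D C (n + 2)).f (Fin.last (n + 1)) f *
        incl D C (n + 1) (incl D C n y₁ * y')) ∈
      leadPart D C (n + 1) ((a * D.δ, 0) + q + (r₁ + r')) :=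
    Submodule.subset_span ⟨a, ha, q, f, hf, _, _, mul_mem_grade hy₂ hy', rfl, rfl⟩
  have h5 := Submodule.sub_mem _ (Submodule.mem_sup_left h4) h3
  rw [← add_assoc] at h5
  have hs := (rep D C (n + 2)).perm_swap_mul_self (Fin.last n).castSucc (Fin.last (n + 1))
  have h6 := perm_swap_commute_incl_incl (D := D) (C := C) y₁
  have h7 := swap_mul_f_last (D := D) (C := C) (Fin.last n) f
  rw [incl_f] at h7
  simp only [map_mul, map_pow, incl_x, incl_f]
  rw [map_mul] at h5
  generalize (rep D C (n + 2)).perm (Equiv.swap (Fin.last n).castSucc (Fin.last (n + 1))) = s at *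
  generalize (rep D C (n + 2)).x (Fin.last n).castSucc ^ a = x at *
  generalize (rep D C (n + 2)).f (Fin.last n).castSucc f = g at *
  generalize (rep D C (n + 2)).f (Fin.last (n + 1)) f = g' at *
  generalize incl D C (n + 1) (incl D C n y₁) = z₁ at *
  generalize incl D C (n + 1) y' = z' at *
  convert h5 using 1
  rw [sub_mul, mul_sub, ← mul_assoc s (s * _), ← mul_assoc s s, hs, one_mul, sub_sub_cancel]
  calc _ = s * (x * (g * (z₁ * s) * z')) := by simp only [mul_assoc]
    _ = s * (x * (g * s * (z₁ * z'))) := by rw [← h6]; simp only [mul_assoc]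
    _ = _ := by rw [← h7]; simp only [mul_assoc]

/-- The braid relation converts `s t s` into `t s t`, where `t` lies in the smaller algebra. -/
theorem swap_mul_incl_mid_mul_swap {r₁ r₂ r' : ℕ × ZMod 2} (i : Fin n)
    {y₁ y₂ : Cyc D C n} (hy₁ : y₁ ∈ grade D C n r₁) (hy₂ : y₂ ∈ grade D C n r₂)
    {y' : Cyc D C (n + 1)} (hy' : y' ∈ grade D C (n + 1) r') :
    (rep D C (n + 2)).perm (Equiv.swap (Fin.last n).castSucc (Fin.last (n + 1))) *
      (incl D C (n + 1) (incl D C n y₁ *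
        ((rep D C (n + 1)).perm (Equiv.swap i.castSucc (Fin.last n)) * incl D C n y₂)) *
      ((rep D C (n + 2)).perm (Equiv.swap (Fin.last n).castSucc (Fin.last (n + 1))) *
        incl D C (n + 1) y')) ∈ midPart D C (n + 1) (r₁ + r₂ + r') := by
  have htg : (rep D C (n + 1)).perm (Equiv.swap i.castSucc (Fin.last n)) ∈
    grade D C (n + 1) 0 := perm_mem_grade _
  have h1 := perm_swap_commute_incl_incl (D := D) (C := C) y₁
  have h2 := perm_swap_commute_incl_incl (D := D) (C := C) y₂
  have h3 := swap_incl_swap (D := D) (C := C) i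
  generalize (rep D C (n + 1)).perm (Equiv.swap i.castSucc (Fin.last n)) = t at *
  refine Submodule.subset_span ⟨Fin.last n, rfl, r₁, incl D C n y₁ * t,
    add_zero r₁ ▸ mul_mem_grade (incl_mem_grade hy₁) htg, r₂ + r', t * (incl D C n y₂ * y'),
    ?_, by abel, ?_⟩
  · rw [← zero_add (r₂ + r')]
    exact mul_mem_grade htg (mul_mem_grade (incl_mem_grade hy₂) hy')
  · simp only [map_mul]
    generalize (rep D C (n + 2)).perm (Equiv.swap (Fin.last n).castSucc (Fin.last (n + 1))) = s
      at *
    generalize incl D C (n + 1) t = t' at *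
    generalize incl D C (n + 1) (incl D C n y₁) = z₁ at *
    generalize incl D C (n + 1) (incl D C n y₂) = z₂ at *
    generalize incl D C (n + 1) y' = z' at *
    calc _ = s * z₁ * (t' * (z₂ * s) * z') := by simp only [mul_assoc]
      _ = z₁ * (s * (t' * s)) * (z₂ * z') := by rw [h1, ← h2]; simp only [mul_assoc]
      _ = _ := by rw [h3]; simp only [mul_assoc]

theorem swap_mul_midPart
    (ih : ∀ p, grade D C (n + 1) p ≤ leadPart D C n p ⊔ midPart D C n p) {p : ℕ × ZMod 2}
    {z : Cyc D C (n + 2)} (hz : z ∈ midPart D C (n + 1) p) :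
    (rep D C (n + 2)).perm (Equiv.swap (Fin.last n).castSucc (Fin.last (n + 1))) * z ∈
      leadPart D C (n + 1) p ⊔ midPart D C (n + 1) p := by
  refine mem_of_span (LinearMap.mulLeft k _)
    (P := leadPart D C (n + 1) p ⊔ midPart D C (n + 1) p) ?_ hz
  rintro _ ⟨i, hi, r, y, hy, r', y', hy', rfl, rfl⟩
  obtain rfl : i = Fin.last n := Fin.ext (by simpa using hi)
  rw [LinearMap.mulLeft_apply]
  -- The induction hypothesis splits the left-hand coefficient; its two parts are governed by the
  -- power formula and by the braid relation.
  obtain ⟨y₁, hy₁, y₂, hy₂, rfl⟩ := Submodule.mem_sup.1 (ih r hy)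
  clear hy hi hz
  let T : Cyc D C (n + 1) →ₗ[k] Cyc D C (n + 2) :=
    LinearMap.mulLeft k ((rep D C (n + 2)).perm
      (Equiv.swap (Fin.last n).castSucc (Fin.last (n + 1)))) ∘ₗ
    LinearMap.mulRight k ((rep D C (n + 2)).perm
      (Equiv.swap (Fin.last n).castSucc (Fin.last (n + 1))) * incl D C (n + 1) y') ∘ₗ
    (incl D C (n + 1)).toLinearMap
  have h1 : T y₁ ∈ leadPart D C (n + 1) (r + r') ⊔ midPart D C (n + 1) (r + r') := by
    refine mem_of_span T ?_ hy₁
    rintro _ ⟨a, ha, q, f, hf, r₁, y₃, hy₃, rfl, rfl⟩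
    have h := swap_mul_incl_lead_mul_swap ha hf hy₃ hy'
    exact h
  have h2 : T y₂ ∈ midPart D C (n + 1) (r + r') := by
    refine mem_of_span T ?_ hy₂
    rintro _ ⟨i, hi, r₁, y₃, hy₃, r₂, y₄, hy₄, rfl, rfl⟩
    have h := swap_mul_incl_mid_mul_swap i hy₃ hy₄ hy'
    exact h
  have h3 := Submodule.add_mem _ h1 (Submodule.mem_sup_right h2)
  rw [← map_add] at h3
  exact h3

end Cyc

end AffineWreath

namespace AffineWreath

open AffineWreath.Affine

variable {k F : Type*} [CommRing k] [Ring F] [Algebra k F] {D : FrobeniusSuperalgebra k F}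

namespace Cyc

variable {C : CycParam F}

variable (D C) in
/-- The span of the homogeneous `x_{n+1}^a f_{n+1} y`, `a < d`, and `y s_n y'` of degree `p`. -/
noncomputable def fullPart (n : ℕ) (p : ℕ × ZMod 2) : Submodule k (Cyc D C (n + 1)) :=
  leadPart D C n p ⊔ midPart D C n p

theorem fullPart_le_comap {n : ℕ} {p q : ℕ × ZMod 2} {u : Cyc D C (n + 1)}
    (h : ∀ z ∈ leadPart D C n p, u * z ∈ fullPart D C n q)
    (h' : ∀ z ∈ midPart D C n p, u * z ∈ fullPart D C n q) {z : Cyc D C (n + 1)}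
    (hz : z ∈ fullPart D C n p) : u * z ∈ fullPart D C n q := by
  obtain ⟨z₁, hz₁, z₂, hz₂, rfl⟩ := Submodule.mem_sup.1 hz
  rw [mul_add]
  exact Submodule.add_mem _ (h _ hz₁) (h' _ hz₂)

theorem incl_mul_fullPart {n : ℕ} {r p : ℕ × ZMod 2} {y : Cyc D C n} (hy : y ∈ grade D C n r)
    {z : Cyc D C (n + 1)} (hz : z ∈ fullPart D C n p) :
    incl D C n y * z ∈ fullPart D C n (r + p) :=
  fullPart_le_comap (fun _ h => Submodule.mem_sup_left (incl_mul_leadPart hy h))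
    (fun _ h => Submodule.mem_sup_right (incl_mul_midPart hy h)) hz

theorem f_mul_fullPart {n : ℕ} {q p : ℕ × ZMod 2} {f : F} (hf : f ∈ D.grade q)
    {z : Cyc D C (n + 1)} (hz : z ∈ fullPart D C n p) :
    (rep D C (n + 1)).f (Fin.last n) f * z ∈ fullPart D C n (q + p) :=
  fullPart_le_comap (fun _ h => Submodule.mem_sup_left (f_mul_leadPart hf h))
    (fun _ h => Submodule.mem_sup_right (f_mul_midPart hf h)) hz

theorem perm_mul_fullPart {n : ℕ}
    (hs : ∀ i : Fin n, i.val + 1 = n → ∀ p, ∀ z ∈ fullPart D C n p,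
      (rep D C (n + 1)).perm (Equiv.swap i.castSucc (Fin.last n)) * z ∈ fullPart D C n p)
    (π : Equiv.Perm (Fin (n + 1))) {p : ℕ × ZMod 2} :
    ∀ z ∈ fullPart D C n p, (rep D C (n + 1)).perm π * z ∈ fullPart D C n p := by
  refine perm_induction (P := fun π => ∀ z ∈ fullPart D C n p,
    (rep D C (n + 1)).perm π * z ∈ fullPart D C n p) ?_ ?_ ?_ π
  · intro z hz
    rwa [map_one, one_mul]
  · intro π σ hπ hσ z hz
    rw [map_mul, mul_assoc]
    exact hπ _ (hσ _ hz)
  · intro i i' h z hz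
    induction i using Fin.lastCases with
    | last => exact absurd h (by simp [Fin.val_last]; omega)
    | cast i =>
      induction i' using Fin.lastCases with
      | last => exact hs i (by simpa using h.symm) _ _ hz
      | cast i' =>
        rw [← incl_perm_swap]
        have := incl_mul_fullPart (perm_mem_grade (D := D) (C := C) (Equiv.swap i i')) hz
        rwa [zero_add] at this

/-- Only here, with a single position, does the cyclotomic relation enter: it reduces `x_1^d`. -/
theorem x_mul_fullPart_zero (hC : C.Admissible D) {p : ℕ × ZMod 2} {z : Cyc D C 1}
    (hz : z ∈ fullPart D C 0 p) :
    (rep D C 1).x (Fin.last 0) * z ∈ fullPart D C 0 ((D.δ, 0) + p) := by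
  refine fullPart_le_comap (fun z hz => Submodule.mem_sup_left ?_) (fun z hz => ?_) hz
  · refine mem_of_span (LinearMap.mulLeft k _) (P := leadPart D C 0 ((D.δ, 0) + p)) ?_ hz
    rintro _ ⟨a, ha, q, f, hf, r, y, hy, rfl, rfl⟩
    rw [LinearMap.mulLeft_apply, ← mul_assoc, ← pow_succ']
    have e : ((D.δ, 0) : ℕ × ZMod 2) + ((a * D.δ, 0) + q + r) =
        ((a + 1) * D.δ, 0) + q + r := by
      have : (((a + 1) * D.δ, 0) : ℕ × ZMod 2) = (D.δ, 0) + (a * D.δ, 0) := by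
        ext <;> simp [add_mul, add_comm]
      rw [this]; abel
    rw [e]
    rcases (Nat.succ_le_of_lt ha).lt_or_eq with h | h
    · exact Submodule.subset_span ⟨a + 1, h, q, f, hf, r, y, hy, rfl, rfl⟩
    · have h1 := AffineRep.chiEval_isMonicPoly (rep D C 1) hC (Fin.last 0)
      rw [AffineRep.IsMonicPoly, chiEval_eq_zero C rfl, zero_sub, Submodule.neg_mem_iff] at h1
      rw [← h] at h1
      refine mem_of_span (LinearMap.mulRight k _)
        (P := leadPart D C 0 (((a + 1) * D.δ, 0) + q + r)) ?_ h1
      rintro _ ⟨a', ha', q', g, hg, hq', rfl⟩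
      refine Submodule.subset_span ⟨a', by omega, q' + q, g * f,
        SetLike.mul_mem_graded hg hf, r, y, hy, ?_, ?_⟩
      · rw [← add_assoc, hq']
      · rw [LinearMap.mulRight_apply, map_mul]
        simp only [mul_assoc]
  · refine mem_of_span (LinearMap.mulLeft k _) (P := fullPart D C 0 ((D.δ, 0) + p)) ?_ hz
    rintro _ ⟨i, -⟩
    exact i.elim0

/-- The relation between `s` and `x_{n+1}` gives `x_{n+2} = (s x_{n+1} + ∑ b_{n+1} b^∨_{n+2}) s`, so
stability under `s`, the smaller algebra and `F` is enough. -/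
theorem x_mul_fullPart_succ {n : ℕ}
    (hs : ∀ p, ∀ z ∈ fullPart D C (n + 1) p,
      (rep D C (n + 2)).perm (Equiv.swap (Fin.last n).castSucc (Fin.last (n + 1))) * z ∈
        fullPart D C (n + 1) p)
    {p : ℕ × ZMod 2} {z : Cyc D C (n + 2)} (hz : z ∈ fullPart D C (n + 1) p) :
    (rep D C (n + 2)).x (Fin.last (n + 1)) * z ∈ fullPart D C (n + 1) ((D.δ, 0) + p) := by
  have h1 := (rep D C (n + 2)).s_x (Fin.last n).castSucc (Fin.last (n + 1)) (by simp)
  have h2 := hs _ _ hz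
  have h3 := hs _ _ (incl_mul_fullPart (x_mem_grade (Fin.last n)) h2)
  have h4 := fullPart_le_comap
    (fun _ h => Submodule.mem_sup_left (tel_mul_leadPart' (Fin.last n) h))
    (fun _ h => Submodule.mem_sup_right (tel_mul_midPart' (Fin.last n) h)) h2
  have h5 := Submodule.add_mem _ h3 h4
  rw [incl_x, ← mul_assoc, ← add_mul, h1, sub_add_cancel, mul_assoc, ← mul_assoc _ _ z,
    WreathRep.perm_swap_mul_self, one_mul] at h5
  exact h5

/-- The full span is stable under left multiplication by all generators and contains `1 = x^0`, an
admissible power because `d > 0`. -/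
theorem grade_le_fullPart_of_swap (hd : 0 < level D C) {n : ℕ}
    (hs : ∀ i : Fin n, i.val + 1 = n → ∀ p, ∀ z ∈ fullPart D C n p,
      (rep D C (n + 1)).perm (Equiv.swap i.castSucc (Fin.last n)) * z ∈ fullPart D C n p)
    (hx : ∀ p, ∀ z ∈ fullPart D C n p,
      (rep D C (n + 1)).x (Fin.last n) * z ∈ fullPart D C n ((D.δ, 0) + p))
    (p : ℕ × ZMod 2) : grade D C (n + 1) p ≤ fullPart D C n p := by
  have h1 : (1 : Cyc D C (n + 1)) ∈ fullPart D C n 0 := by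
    refine Submodule.mem_sup_left (Submodule.subset_span ⟨0, hd, 0, 1,
      SetLike.GradedOne.one_mem, 0, 1, one_mem_grade n, ?_, ?_⟩)
    · simp
    · simp
  refine Submodule.span_le.2 fun z hz => ?_
  suffices h : ∀ q, ∀ w ∈ fullPart D C n q, z * w ∈ fullPart D C n (p + q) by
    simpa using h 0 1 h1
  change IsMonomial D C (n + 1) p z at hz
  induction hz with
  | one => intro q w hw; rwa [one_mul, zero_add]
  | x i =>
    intro q w hw
    induction i using Fin.lastCases with
    | last => exact hx q w hw
    | cast i =>
      have := incl_mul_fullPart (x_mem_grade i) hw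
      rwa [incl_x] at this
  | f i p a ha =>
    intro q w hw
    induction i using Fin.lastCases with
    | last => exact f_mul_fullPart ha hw
    | cast i =>
      have := incl_mul_fullPart (f_mem_grade i ha) hw
      rwa [incl_f] at this
  | perm π =>
    intro q w hw
    rw [zero_add]
    exact perm_mul_fullPart hs π w hw
  | mul p p' y z _ _ hy hz =>
    intro q w hw
    rw [mul_assoc, add_assoc]
    exact hy _ _ (hz _ _ hw)

theorem grade_le_fullPart (hC : C.Admissible D) (hd : 0 < level D C) (n : ℕ)
    (p : ℕ × ZMod 2) : grade D C (n + 1) p ≤ fullPart D C n p := by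
  induction n generalizing p with
  | zero =>
    exact grade_le_fullPart_of_swap hd (fun i => i.elim0)
      (fun p z hz => x_mul_fullPart_zero hC hz) p
  | succ n ih =>
    have hs : ∀ p, ∀ z ∈ fullPart D C (n + 1) p,
        (rep D C (n + 2)).perm (Equiv.swap (Fin.last n).castSucc (Fin.last (n + 1))) * z ∈
          fullPart D C (n + 1) p := fun p z hz =>
      fullPart_le_comap (fun _ h => swap_mul_leadPart rfl h)
        (fun _ h => swap_mul_midPart ih h) hz
    refine grade_le_fullPart_of_swap hd (fun i hi => ?_)
      (fun p z hz => x_mul_fullPart_succ hs hz) p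
    obtain rfl : i = Fin.last n := Fin.ext (by simpa using hi)
    exact hs

end Cyc

end AffineWreath

/-! ### Coset generators and uniqueness of the trace -/

namespace AffineWreath

open AffineWreath.Affine

variable {k F : Type*} [CommRing k] [Ring F] [Algebra k F] {D : FrobeniusSuperalgebra k F}

namespace Cyc

variable {C : CycParam F}

variable (D C) in
/-- The span of the `f_{n+1} y`. -/
noncomputable def coeffSpan (n : ℕ) : Submodule k (Cyc D C (n + 1)) :=
  Submodule.span k {z | ∃ f y, z = (rep D C (n + 1)).f (Fin.last n) f * incl D C n y}

variable (D C) in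
/-- The span of the `x_{n+1}^a f_{n+1} y` with `a < m`. -/
noncomputable def lowerSpan (n m : ℕ) : Submodule k (Cyc D C (n + 1)) :=
  Submodule.span k {z | ∃ a, a < m ∧ ∃ f y, z = (rep D C (n + 1)).x (Fin.last n) ^ a *
    ((rep D C (n + 1)).f (Fin.last n) f * incl D C n y)}

variable {n : ℕ}

theorem incl_mul_mem_coeffSpan (y : Cyc D C n) {z : Cyc D C (n + 1)} (hz : z ∈ coeffSpan D C n) :
    incl D C n y * z ∈ coeffSpan D C n := by
  refine mem_of_span (LinearMap.mulLeft k _) (P := coeffSpan D C n) ?_ hz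
  rintro _ ⟨f, y', rfl⟩
  rw [LinearMap.mulLeft_apply, ← mul_assoc]
  have hy : y ∈ ⨆ p, grade D C n p := by rw [iSup_grade]; trivial
  induction hy using Submodule.iSup_induction' with
  | zero => rw [map_zero, zero_mul, zero_mul]; exact Submodule.zero_mem _
  | add a b _ _ ha hb => rw [map_add, add_mul, add_mul]; exact Submodule.add_mem _ ha hb
  | mem p y hy =>
    induction f using DirectSum.Decomposition.inductionOn D.grade with
    | zero => rw [map_zero, mul_zero, zero_mul]; exact Submodule.zero_mem _
    | homogeneous m =>
      rw [incl_mul_f_last hy m.2, smul_mul_assoc, mul_assoc, ← map_mul]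
      exact Submodule.smul_mem _ _ (Submodule.subset_span ⟨_, _, rfl⟩)
    | add a b ha hb => rw [map_add, mul_add, add_mul]; exact Submodule.add_mem _ ha hb

theorem x_pow_mul_mem_lowerSpan {a m : ℕ} (ha : a < m) {z : Cyc D C (n + 1)}
    (hz : z ∈ coeffSpan D C n) :
    (rep D C (n + 1)).x (Fin.last n) ^ a * z ∈ lowerSpan D C n m := by
  refine mem_of_span (LinearMap.mulLeft k _) (P := lowerSpan D C n m) ?_ hz
  rintro _ ⟨f, y', rfl⟩
  exact Submodule.subset_span ⟨a, ha, f, y', rfl⟩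

theorem incl_mul_lowerSpan {m : ℕ} (y : Cyc D C n) {z : Cyc D C (n + 1)}
    (hz : z ∈ lowerSpan D C n m) : incl D C n y * z ∈ lowerSpan D C n m := by
  refine mem_of_span (LinearMap.mulLeft k _) (P := lowerSpan D C n m) ?_ hz
  rintro _ ⟨a, ha, f, y', rfl⟩
  rw [LinearMap.mulLeft_apply, ← mul_assoc, incl_mul_x_last_pow, mul_assoc]
  exact x_pow_mul_mem_lowerSpan ha
    (incl_mul_mem_coeffSpan y (Submodule.subset_span ⟨f, y', rfl⟩))

theorem f_mul_lowerSpan {m : ℕ} (f : F) {z : Cyc D C (n + 1)}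
    (hz : z ∈ lowerSpan D C n m) :
    (rep D C (n + 1)).f (Fin.last n) f * z ∈ lowerSpan D C n m := by
  refine mem_of_span (LinearMap.mulLeft k _) (P := lowerSpan D C n m) ?_ hz
  rintro _ ⟨a, ha, f', y', rfl⟩
  refine Submodule.subset_span ⟨a, ha, (D.nakayama ^ a) f * f', y', ?_⟩
  rw [LinearMap.mulLeft_apply, ← mul_assoc, AffineRep.f_x_pow_same, map_mul]
  simp only [mul_assoc]

theorem x_pow_mul_lowerSpan {m : ℕ} (b : ℕ) {z : Cyc D C (n + 1)}
    (hz : z ∈ lowerSpan D C n m) :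
    (rep D C (n + 1)).x (Fin.last n) ^ b * z ∈ lowerSpan D C n (b + m) := by
  refine mem_of_span (LinearMap.mulLeft k _) (P := lowerSpan D C n (b + m)) ?_ hz
  rintro _ ⟨a, ha, f', y', rfl⟩
  exact Submodule.subset_span ⟨b + a, by omega, f', y',
    by rw [LinearMap.mulLeft_apply, pow_add, mul_assoc]⟩

theorem lowerSpan_mono {m m' : ℕ} (h : m ≤ m') : lowerSpan D C n m ≤ lowerSpan D C n m' := by
  refine Submodule.span_mono ?_
  rintro _ ⟨a, ha, f, y, rfl⟩
  exact ⟨a, by omega, f, y, rfl⟩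

theorem tel_mul_lowerSpan {m : ℕ} (i : Fin n) {z : Cyc D C (n + 1)}
    (hz : z ∈ lowerSpan D C n m) :
    (rep D C (n + 1)).tel (Fin.last n) i.castSucc * z ∈ lowerSpan D C n m := by
  rw [TensorRep.tel, Finset.sum_mul]
  refine Submodule.sum_mem _ fun b _ => ?_
  rw [mul_assoc, ← incl_f]
  exact f_mul_lowerSpan _ (incl_mul_lowerSpan _ hz)

theorem tel_mul_lowerSpan' {m : ℕ} (i : Fin n) {z : Cyc D C (n + 1)}
    (hz : z ∈ lowerSpan D C n m) :
    (rep D C (n + 1)).tel i.castSucc (Fin.last n) * z ∈ lowerSpan D C n m := by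
  rw [TensorRep.tel, Finset.sum_mul]
  refine Submodule.sum_mem _ fun b _ => ?_
  rw [mul_assoc, ← incl_f]
  exact incl_mul_lowerSpan _ (f_mul_lowerSpan _ hz)

theorem correction_mul_mem_lowerSpan {i : Fin n} {a : ℕ} {v : Cyc D C (n + 1)}
    (hv : v ∈ coeffSpan D C n)
    {u : Cyc D C (n + 1)} (hu : u ∈ Submodule.span k {z | ∃ p q, p + q + 1 = a ∧
      z = (rep D C (n + 1)).x i.castSucc ^ p * (rep D C (n + 1)).tel (Fin.last n) i.castSucc *
        (rep D C (n + 1)).x (Fin.last n) ^ q}) :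
    u * v ∈ lowerSpan D C n a := by
  refine mem_of_span (LinearMap.mulRight k _) (P := lowerSpan D C n a) ?_ hu
  rintro _ ⟨p', q', rfl, rfl⟩
  rw [LinearMap.mulRight_apply, mul_assoc, mul_assoc, ← incl_x, ← map_pow]
  exact incl_mul_lowerSpan _ (tel_mul_lowerSpan i (x_pow_mul_mem_lowerSpan (by omega) hv))

variable (D C) in
/-- The span of the `(j, n+1) x_{n+1}^a f_{n+1} y` with `a < d`. -/
noncomputable def cosetSpan (n : ℕ) : Submodule k (Cyc D C (n + 1)) :=
  Submodule.span k {z | ∃ j a, a < level D C ∧ ∃ f y, z = (rep D C (n + 1)).perm (coset j) *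
    ((rep D C (n + 1)).x (Fin.last n) ^ a *
      ((rep D C (n + 1)).f (Fin.last n) f * incl D C n y))}

variable (D C) in
/-- The span of the `(j, n+1) x_{n+1}^a f_{n+1} y` with `a < d`, except those with `j = n + 1` and
`a = d - 1`. -/
noncomputable def cosetKer (n : ℕ) : Submodule k (Cyc D C (n + 1)) :=
  Submodule.span k {z | ∃ j a, a < level D C ∧ ¬ (j = Fin.last n ∧ a + 1 = level D C) ∧
    ∃ f y, z = (rep D C (n + 1)).perm (coset j) * ((rep D C (n + 1)).x (Fin.last n) ^ a *
      ((rep D C (n + 1)).f (Fin.last n) f * incl D C n y))}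

theorem cosetKer_le_cosetSpan (n : ℕ) : cosetKer D C n ≤ cosetSpan D C n := by
  refine Submodule.span_mono ?_
  rintro _ ⟨j, a, ha, -, h⟩
  exact ⟨j, a, ha, h⟩

/-- The strict bound `m < d` keeps the exponent `d - 1` out of reach. -/
theorem lowerSpan_le_cosetKer {m : ℕ} (hm : m < level D C) :
    lowerSpan D C n m ≤ cosetKer D C n := by
  refine Submodule.span_mono ?_
  rintro _ ⟨a, ha, f, y, rfl⟩
  exact ⟨Fin.last n, a, by omega, fun h => by omega, f, y, by rw [coset_last, map_one, one_mul]⟩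

/-- Moving `s` to the left past `x^a f y₁` leaves `(j, n+1) s` in front, up to lower terms. This
product equals `(j, n+2) (j, n+1)`, and its coset is never the trivial one. -/
theorem mid_mem_cosetKer {j : Fin (n + 1)} {a : ℕ} (ha : a < level D C) (f : F) (y₁ : Cyc D C n)
    (y' : Cyc D C (n + 1)) :
    incl D C (n + 1) ((rep D C (n + 1)).perm (coset j) * ((rep D C (n + 1)).x (Fin.last n) ^ a *
      ((rep D C (n + 1)).f (Fin.last n) f * incl D C n y₁))) *
      ((rep D C (n + 2)).perm (Equiv.swap (Fin.last n).castSucc (Fin.last (n + 1))) *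
        incl D C (n + 1) y') ∈ cosetKer D C (n + 1) := by
  have h1 := (rep D C (n + 2)).s_x'_pow (i := (Fin.last n).castSucc) (i' := Fin.last (n + 1))
    (by simp) a
  have h2 := correction_mul_mem_lowerSpan (i := Fin.last n) (Submodule.subset_span
    ⟨f, incl D C n y₁ * y', rfl⟩) h1
  have h3 := lowerSpan_le_cosetKer ha
    (incl_mul_lowerSpan ((rep D C (n + 1)).perm (coset j)) h2)
  have h4 : (rep D C (n + 2)).perm (coset j.castSucc) *
      ((rep D C (n + 2)).x (Fin.last (n + 1)) ^ a * ((rep D C (n + 2)).f (Fin.last (n + 1)) f *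
        incl D C (n + 1) ((rep D C (n + 1)).perm (coset j) * (incl D C n y₁ * y')))) ∈
      cosetKer D C (n + 1) :=
    Submodule.subset_span ⟨j.castSucc, a, ha, fun h => (Fin.castSucc_lt_last j).ne h.1, f, _, rfl⟩
  have h5 := Submodule.sub_mem _ h4 h3
  have h6 := perm_swap_commute_incl_incl (D := D) (C := C) y₁
  have h7 := swap_mul_f_last (D := D) (C := C) (Fin.last n) f
  have h8 := congrArg (rep D C (n + 2)).perm (coset_extendPerm (coset j) (Fin.last n).castSucc)
  rw [extendPerm_castSucc, coset_apply_last, map_mul, map_mul, ← incl_perm] at h8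
  have h9 := incl_mul_x_last_pow ((rep D C (n + 1)).perm (coset j)) a
  have h10 : incl D C (n + 1) ((rep D C (n + 1)).perm (coset j)) *
      (rep D C (n + 2)).f (Fin.last (n + 1)) f = (rep D C (n + 2)).f (Fin.last (n + 1)) f *
      incl D C (n + 1) ((rep D C (n + 1)).perm (coset j)) := by
    rw [incl_perm, WreathRep.perm_f, extendPerm_last]
  rw [show coset (Fin.last n).castSucc =
    Equiv.swap (Fin.last n).castSucc (Fin.last (n + 1)) from rfl] at h8
  rw [incl_f] at h7
  simp only [map_mul, map_pow, incl_x, incl_f] at h5 ⊢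
  generalize (rep D C (n + 2)).perm (Equiv.swap (Fin.last n).castSucc (Fin.last (n + 1))) = s at *
  generalize (rep D C (n + 2)).x (Fin.last n).castSucc ^ a = x at *
  generalize (rep D C (n + 2)).x (Fin.last (n + 1)) ^ a = x' at *
  generalize (rep D C (n + 2)).f (Fin.last n).castSucc f = g at *
  generalize (rep D C (n + 2)).f (Fin.last (n + 1)) f = g' at *
  generalize incl D C (n + 1) ((rep D C (n + 1)).perm (coset j)) = c at *
  generalize (rep D C (n + 2)).perm (coset j.castSucc) = c' at *
  generalize incl D C (n + 1) (incl D C n y₁) = z₁ at *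
  generalize incl D C (n + 1) y' = z' at *
  convert h5 using 1
  rw [sub_mul, mul_sub]
  have e1 : c' * (x' * (g' * (c * (z₁ * z')))) = c * (s * x' * (g' * (z₁ * z'))) := by
    calc _ = c' * (x' * (g' * c * (z₁ * z'))) := by simp only [mul_assoc]
      _ = c' * ((x' * c) * (g' * (z₁ * z'))) := by rw [← h10]; simp only [mul_assoc]
      _ = (c' * c) * (x' * (g' * (z₁ * z'))) := by rw [← h9]; simp only [mul_assoc]
      _ = _ := by rw [h8]; simp only [mul_assoc]
  rw [e1, sub_sub_cancel]
  calc _ = c * (x * (g * (z₁ * s) * z')) := by simp only [mul_assoc]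
    _ = c * (x * ((g * s) * (z₁ * z'))) := by rw [← h6]; simp only [mul_assoc]
    _ = _ := by rw [← h7]; simp only [mul_assoc]

theorem incl_mul_swap_mul_incl_mem_cosetKer (h : cosetSpan D C n = ⊤) (y y' : Cyc D C (n + 1)) :
    incl D C (n + 1) y *
      ((rep D C (n + 2)).perm (Equiv.swap (Fin.last n).castSucc (Fin.last (n + 1))) *
        incl D C (n + 1) y') ∈ cosetKer D C (n + 1) := by
  have hy : y ∈ cosetSpan D C n := by rw [h]; trivial
  let T : Cyc D C (n + 1) →ₗ[k] Cyc D C (n + 2) :=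
    LinearMap.mulRight k ((rep D C (n + 2)).perm
      (Equiv.swap (Fin.last n).castSucc (Fin.last (n + 1))) * incl D C (n + 1) y') ∘ₗ
    (incl D C (n + 1)).toLinearMap
  refine mem_of_span T (P := cosetKer D C (n + 1)) ?_ hy
  rintro _ ⟨j, a, ha, f, y₁, rfl⟩
  have := mid_mem_cosetKer (j := j) ha f y₁ y'
  exact this

/-- By induction: expanding the left factor of an element of `𝒜_n s_n 𝒜_n` in coset generators for
the smaller algebra rewrites it in coset generators for the larger one. -/
theorem cosetSpan_eq_top (hC : C.Admissible D) (hd : 0 < level D C) (n : ℕ) :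
    cosetSpan D C n = ⊤ := by
  have key : ∀ n, (∀ i : Fin n, i.val + 1 = n → ∀ y y' : Cyc D C n, incl D C n y *
      ((rep D C (n + 1)).perm (Equiv.swap i.castSucc (Fin.last n)) * incl D C n y') ∈
        cosetKer D C n) → cosetSpan D C n = ⊤ := by
    intro n h
    rw [eq_top_iff, ← iSup_grade, iSup_le_iff]
    intro p
    refine (grade_le_fullPart hC hd n p).trans (sup_le (Submodule.span_le.2 ?_)
      (Submodule.span_le.2 ?_))
    · rintro _ ⟨a, ha, q, f, hf, r, y, hy, rfl, rfl⟩
      exact Submodule.subset_span ⟨Fin.last n, a, ha, f, y,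
        by rw [coset_last, map_one, one_mul]⟩
    · rintro _ ⟨i, hi, r, y, hy, r', y', hy', rfl, rfl⟩
      exact cosetKer_le_cosetSpan _ (h i hi y y')
  induction n with
  | zero => exact key 0 fun i => i.elim0
  | succ n ih =>
    refine key (n + 1) fun i hi => ?_
    obtain rfl : i = Fin.last n := Fin.ext (by simpa using hi)
    exact incl_mul_swap_mul_incl_mem_cosetKer ih

theorem summand_none_le_cosetKer (hC : C.Admissible D) (hd : 0 < level D C) (n : ℕ) :
    summand D C n none ≤ cosetKer D C n := by
  refine Submodule.span_le.2 ?_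
  rintro _ ⟨i, hi, y, y', rfl⟩
  rw [mul_assoc]
  cases n with
  | zero => exact i.elim0
  | succ n =>
    obtain rfl : i = Fin.last n := Fin.ext (by simpa using hi)
    exact incl_mul_swap_mul_incl_mem_cosetKer (cosetSpan_eq_top hC hd n) y y'

theorem iSup_summand (hC : C.Admissible D) (hd : 0 < level D C) (n : ℕ) :
    ⨆ i, summand D C n i = ⊤ := by
  rw [eq_top_iff, ← iSup_grade, iSup_le_iff]
  intro p
  refine (grade_le_fullPart hC hd n p).trans (sup_le (Submodule.span_le.2 ?_)
    (Submodule.span_le.2 ?_))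
  · rintro _ ⟨a, ha, q, f, hf, r, y, hy, rfl, rfl⟩
    exact Submodule.mem_iSup_of_mem (some ⟨a, ha⟩) (Submodule.subset_span
      ⟨f, y, (mul_assoc _ _ _).symm⟩)
  · rintro _ ⟨i, hi, r, y, hy, r', y', hy', rfl, rfl⟩
    exact Submodule.mem_iSup_of_mem none (Submodule.subset_span
      ⟨i, hi, y, y', (mul_assoc _ _ _).symm⟩)

/-- The trace map is given by the coset decomposition. -/
def IsCosetTrace (n : ℕ) (τ : Cyc D C (n + 1) →ₗ[k] Cyc D C n) : Prop :=
  ∀ j a, a < level D C → ∀ f y, τ ((rep D C (n + 1)).perm (coset j) *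
    ((rep D C (n + 1)).x (Fin.last n) ^ a * ((rep D C (n + 1)).f (Fin.last n) f *
      incl D C n y))) = if j = Fin.last n ∧ a + 1 = level D C then D.tr f • y else 0

theorem IsCosetTrace.eq_zero {τ : Cyc D C (n + 1) →ₗ[k] Cyc D C n} (hτ : IsCosetTrace n τ)
    {z : Cyc D C (n + 1)} (hz : z ∈ cosetKer D C n) : τ z = 0 := by
  rw [← LinearMap.mem_ker]
  refine Submodule.span_le.2 ?_ hz
  rintro _ ⟨j, a, ha, hj, f, y, rfl⟩
  rw [SetLike.mem_coe, LinearMap.mem_ker, hτ j a ha, if_neg hj]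

theorem IsCosetTrace.apply_top {τ : Cyc D C (n + 1) →ₗ[k] Cyc D C n} (hτ : IsCosetTrace n τ)
    (hd : 0 < level D C) (f : F) (y : Cyc D C n) :
    τ ((rep D C (n + 1)).x (Fin.last n) ^ (level D C - 1) *
      ((rep D C (n + 1)).f (Fin.last n) f * incl D C n y)) = D.tr f • y := by
  have := hτ (Fin.last n) (level D C - 1) (by omega) f y
  rwa [if_pos ⟨rfl, by omega⟩, coset_last, map_one, one_mul] at this

theorem IsCosetTrace.isTrace (hC : C.Admissible D) (hd : 0 < level D C)
    {τ : Cyc D C (n + 1) →ₗ[k] Cyc D C n} (hτ : IsCosetTrace n τ) : IsTrace D C n τ where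
  top f y := by
    rw [mul_assoc]
    exact hτ.apply_top hd f y
  lower a ha z hz := by
    refine hτ.eq_zero (lowerSpan_le_cosetKer ha ?_)
    refine Submodule.span_le.2 ?_ hz
    rintro _ ⟨f, y, rfl⟩
    rw [mul_assoc]
    exact Submodule.subset_span ⟨a, by omega, f, y, rfl⟩
  swap z hz := hτ.eq_zero (summand_none_le_cosetKer hC hd n hz)

theorem IsTrace.unique (hC : C.Admissible D) (hd : 0 < level D C)
    {τ τ' : Cyc D C (n + 1) →ₗ[k] Cyc D C n} (h : IsTrace D C n τ) (h' : IsTrace D C n τ') :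
    τ = τ' := by
  rw [← LinearMap.eqLocus_eq_top, eq_top_iff, ← iSup_summand hC hd n, iSup_le_iff]
  rintro (_ | a) z hz
  · rw [LinearMap.mem_eqLocus, h.swap z hz, h'.swap z hz]
  · by_cases ha : a.val + 1 < level D C
    · rw [LinearMap.mem_eqLocus, h.lower a ha z hz, h'.lower a ha z hz]
    · have ha' : a.val = level D C - 1 := by omega
      refine Submodule.span_le.2 ?_ hz
      rintro _ ⟨f, y, rfl⟩
      rw [SetLike.mem_coe, LinearMap.mem_eqLocus, ha', h.top, h'.top]

theorem exists_isCosetTrace (hC : C.Admissible D) (n : ℕ) :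
    ∃ τ : Cyc D C (n + 1) →ₗ[k] Cyc D C n, IsCosetTrace n τ := by
  obtain ⟨τ, hτ⟩ := exists_preTrace hC n
  refine ⟨τ, fun j a ha f y => ?_⟩
  rw [← mul_assoc (_ ^ a)]
  exact hτ j a ha f y

/-- The trace is determined on the spanning summands, so it must be the functional coming from the
induced module. -/
theorem IsTrace.isCosetTrace (hC : C.Admissible D) (hd : 0 < level D C)
    {τ : Cyc D C (n + 1) →ₗ[k] Cyc D C n} (h : IsTrace D C n τ) : IsCosetTrace n τ := by
  obtain ⟨τ', hτ'⟩ := exists_isCosetTrace hC n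
  rwa [h.unique hC hd (hτ'.isTrace hC hd)]

end Cyc

end AffineWreath

/-! ### Bimodule property, degree and injectivity -/

namespace AffineWreath

open AffineWreath.Affine

variable {k F : Type*} [CommRing k] [Ring F] [Algebra k F] {D : FrobeniusSuperalgebra k F}

namespace Cyc

variable {C : CycParam F} {n : ℕ}

theorem incl_mul_summand_none (y : Cyc D C n) {z : Cyc D C (n + 1)}
    (hz : z ∈ summand D C n none) : incl D C n y * z ∈ summand D C n none := by
  refine mem_of_span (LinearMap.mulLeft k _) (P := summand D C n none) ?_ hz
  rintro _ ⟨i, hi, y₁, y₂, rfl⟩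
  refine Submodule.subset_span ⟨i, hi, y * y₁, y₂, ?_⟩
  rw [LinearMap.mulLeft_apply, map_mul]
  simp only [mul_assoc]

theorem f_mul_incl_mem (f : F) (y : Cyc D C n) :
    (rep D C (n + 1)).f (Fin.last n) f * incl D C n y ∈
      Submodule.span k {z | ∃ y f, z = incl D C n y * (rep D C (n + 1)).f (Fin.last n) f} := by
  have hy : y ∈ ⨆ p, grade D C n p := by rw [iSup_grade]; trivial
  induction hy using Submodule.iSup_induction' with
  | zero => rw [map_zero, mul_zero]; exact Submodule.zero_mem _
  | add a b _ _ ha hb => rw [map_add, mul_add]; exact Submodule.add_mem _ ha hb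
  | mem p y hy =>
    induction f using DirectSum.Decomposition.inductionOn D.grade with
    | zero => rw [map_zero, zero_mul]; exact Submodule.zero_mem _
    | homogeneous m =>
      rw [f_last_mul_incl hy m.2]
      exact Submodule.smul_mem _ _ (Submodule.subset_span ⟨_, _, rfl⟩)
    | add a b ha hb => rw [map_add, add_mul]; exact Submodule.add_mem _ ha hb

theorem f_mul_summand_none (f : F) {z : Cyc D C (n + 1)} (hz : z ∈ summand D C n none) :
    (rep D C (n + 1)).f (Fin.last n) f * z ∈ summand D C n none := by
  refine mem_of_span (LinearMap.mulLeft k _) (P := summand D C n none) ?_ hz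
  rintro _ ⟨i, hi, y₁, y₂, rfl⟩
  rw [LinearMap.mulLeft_apply, mul_assoc, ← mul_assoc]
  refine mem_of_span (LinearMap.mulRight k _) (P := summand D C n none) ?_ (f_mul_incl_mem f y₁)
  rintro _ ⟨y, g, rfl⟩
  refine Submodule.subset_span ⟨i, hi, y, (rep D C n).f i g * y₂, ?_⟩
  have h := f_last_mul_swap (D := D) (C := C) i g
  change incl D C n y * _ * ((rep D C (n + 1)).perm (Equiv.swap i.castSucc (Fin.last n)) * _) =
    _ * (rep D C (n + 1)).perm (Equiv.swap i.castSucc (Fin.last n)) * _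
  rw [map_mul, mul_assoc, ← mul_assoc _ _ (incl D C n y₂), h]
  simp only [mul_assoc]

/-- `x_{n+1}` commutes with `𝒜_n` and can be moved through `s_n`, where it becomes `x_n`. The errors
have exponent below `m` in `x_{n+1}`. -/
theorem x_pow_mul_summand_none (m : ℕ) {z : Cyc D C (n + 1)} (hz : z ∈ summand D C n none) :
    (rep D C (n + 1)).x (Fin.last n) ^ m * z ∈ summand D C n none ⊔ lowerSpan D C n m := by
  refine mem_of_span (LinearMap.mulLeft k _) (P := summand D C n none ⊔ lowerSpan D C n m) ?_ hz
  rintro _ ⟨i, hi, y, y', rfl⟩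
  change _ * (_ * (rep D C (n + 1)).perm (Equiv.swap i.castSucc (Fin.last n)) * _) ∈ _
  have h1 := (rep D C (n + 1)).s_x_pow (i := i.castSucc) (i' := Fin.last n) (by simp [hi]) m
  have h3 : ((rep D C (n + 1)).perm (Equiv.swap i.castSucc (Fin.last n)) *
      (rep D C (n + 1)).x i.castSucc ^ m - (rep D C (n + 1)).x (Fin.last n) ^ m *
      (rep D C (n + 1)).perm (Equiv.swap i.castSucc (Fin.last n))) * incl D C n y' ∈
      lowerSpan D C n m := by
    refine mem_of_span (LinearMap.mulRight k _) (P := lowerSpan D C n m) ?_ h1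
    rintro _ ⟨p, q, rfl, rfl⟩
    have h4 : (rep D C (n + 1)).x (Fin.last n) ^ 0 * ((rep D C (n + 1)).f (Fin.last n) 1 *
      incl D C n ((rep D C n).x i ^ p * y')) ∈ lowerSpan D C n 1 :=
      Submodule.subset_span ⟨0, one_pos, 1, _, rfl⟩
    have h5 := x_pow_mul_lowerSpan q (tel_mul_lowerSpan' i h4)
    rw [pow_zero, one_mul, map_one, one_mul, map_mul, map_pow, incl_x] at h5
    have h6 := lowerSpan_mono (show q + 1 ≤ p + q + 1 by omega) h5
    rw [LinearMap.mulRight_apply]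
    simp only [mul_assoc] at h6 ⊢
    exact h6
  have h6 : incl D C n y * ((rep D C (n + 1)).perm (Equiv.swap i.castSucc (Fin.last n)) *
      incl D C n ((rep D C n).x i ^ m * y')) ∈ summand D C n none :=
    Submodule.subset_span ⟨i, hi, _, _, (mul_assoc _ _ _).symm⟩
  have h7 := Submodule.sub_mem _ (Submodule.mem_sup_left h6)
    (Submodule.mem_sup_right (incl_mul_lowerSpan y h3))
  rw [mul_assoc, ← mul_assoc, ← incl_mul_x_last_pow, mul_assoc]
  convert h7 using 1
  rw [sub_mul, mul_sub, map_mul, map_pow, incl_x]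
  simp only [mul_assoc]
  rw [sub_sub_cancel]

/-- Outside `S_n` there is only one double coset of `S_n` in `S_{n+1}`, that of `s_n`. -/
theorem exists_perm_eq {i : Fin n} (hi : i.val + 1 = n) {π : Equiv.Perm (Fin (n + 1))}
    (hπ : π (Fin.last n) ≠ Fin.last n) : ∃ α β : Equiv.Perm (Fin n),
      π = extendPerm α * (Equiv.swap i.castSucc (Fin.last n) * extendPerm β) := by
  obtain ⟨m, rfl⟩ : ∃ m, n = m + 1 := ⟨i.val, hi.symm⟩
  obtain rfl : i = Fin.last m := Fin.ext (by simpa using hi)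
  obtain ⟨g, hg⟩ := exists_extendPerm (g := coset (π (Fin.last _)) * π) (by simp)
  obtain ⟨j, hj⟩ := Fin.exists_castSucc_eq.2 hπ
  have h1 := coset_extendPerm (coset j) (Fin.last m).castSucc
  rw [extendPerm_castSucc, coset_apply_last, hj] at h1
  refine ⟨coset j, coset j * g, ?_⟩
  change π = extendPerm (coset j) * (coset (Fin.last m).castSucc * _)
  rw [← mul_assoc, ← h1, map_mul, hg, mul_assoc, ← mul_assoc (extendPerm _), ← map_mul,
    coset_mul_self, map_one, one_mul, coset_mul_self_mul]

/-- Crossing `s_n` costs one power, so the exponents that survive are below `m + a`. For `m + a ≤ d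
- 1` the trace kills the whole product. -/
theorem x_pow_mul_perm_mul_mem {π : Equiv.Perm (Fin (n + 1))}
    (hπ : π (Fin.last n) ≠ Fin.last n) (m a : ℕ) (f : F) (y : Cyc D C n) :
    (rep D C (n + 1)).x (Fin.last n) ^ m * ((rep D C (n + 1)).perm π *
      ((rep D C (n + 1)).x (Fin.last n) ^ a * ((rep D C (n + 1)).f (Fin.last n) f *
        incl D C n y))) ∈ summand D C n none ⊔ lowerSpan D C n (m + a) := by
  obtain ⟨i, hi⟩ : ∃ i : Fin n, i.val + 1 = n := by
    obtain ⟨j, -⟩ := Fin.exists_castSucc_eq.2 hπ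
    have := j.isLt
    exact ⟨⟨n - 1, by omega⟩, by simp; omega⟩
  obtain ⟨α, β, rfl⟩ := exists_perm_eq hi hπ
  have h1 := (rep D C (n + 1)).s_x'_pow (i := i.castSucc) (i' := Fin.last n) (by simp [hi]) a
  have h2 := correction_mul_mem_lowerSpan (Submodule.subset_span
    ⟨f, (rep D C n).perm β * y, rfl⟩) h1
  have h3 := x_pow_mul_lowerSpan m (incl_mul_lowerSpan ((rep D C n).perm α) h2)
  have h4 : incl D C n ((rep D C n).x i ^ a * (rep D C n).f i f) *
      ((rep D C (n + 1)).perm (Equiv.swap i.castSucc (Fin.last n)) *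
      incl D C n ((rep D C n).perm β * y)) ∈ summand D C n none :=
    Submodule.subset_span ⟨i, hi, _, _, (mul_assoc _ _ _).symm⟩
  have h5 := x_pow_mul_summand_none m (incl_mul_summand_none ((rep D C n).perm α) h4)
  have h6 := Submodule.add_mem _ (sup_le_sup_left (lowerSpan_mono (Nat.le_add_right m a)) _ h5)
    (Submodule.mem_sup_right h3)
  convert h6 using 1
  have h7 := swap_mul_f_last (D := D) (C := C) i f
  have h9 := incl_mul_x_last_pow ((rep D C n).perm β) a
  have h10 : incl D C n ((rep D C n).perm β) *
      (rep D C (n + 1)).f (Fin.last n) f = (rep D C (n + 1)).f (Fin.last n) f *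
      incl D C n ((rep D C n).perm β) := by
    rw [incl_perm, WreathRep.perm_f, extendPerm_last]
  rw [map_mul, map_mul, ← incl_perm, ← incl_perm]
  rw [incl_f] at h7
  simp only [map_mul, map_pow, incl_x, incl_f]
  generalize (rep D C (n + 1)).perm (Equiv.swap i.castSucc (Fin.last n)) = s at *
  generalize (rep D C (n + 1)).x i.castSucc ^ a = x at *
  generalize (rep D C (n + 1)).x (Fin.last n) ^ a = x' at *
  generalize (rep D C (n + 1)).x (Fin.last n) ^ m = x'' at *
  generalize (rep D C (n + 1)).f i.castSucc f = g at *
  generalize (rep D C (n + 1)).f (Fin.last n) f = g' at *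
  generalize incl D C n ((rep D C n).perm α) = c at *
  generalize incl D C n ((rep D C n).perm β) = b at *
  generalize incl D C n y = z at *
  rw [← mul_add, ← mul_add, sub_mul]
  have e : x * g * (s * (b * z)) = x * s * (g' * (b * z)) := by
    calc _ = x * ((g * s) * (b * z)) := by simp only [mul_assoc]
      _ = _ := by rw [← h7]; simp only [mul_assoc]
  rw [e, add_sub_cancel]
  calc _ = x'' * (c * (s * ((b * x') * (g' * z)))) := by simp only [mul_assoc]
    _ = x'' * (c * (s * (x' * ((b * g') * z)))) := by rw [h9]; simp only [mul_assoc]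
    _ = _ := by rw [h10]; simp only [mul_assoc]

namespace IsCosetTrace

variable {τ : Cyc D C (n + 1) →ₗ[k] Cyc D C n}

theorem eq_zero_of_mem_lowerSpan (hτ : IsCosetTrace n τ) {m : ℕ} (hm : m < level D C)
    {z : Cyc D C (n + 1)} (hz : z ∈ lowerSpan D C n m) : τ z = 0 :=
  hτ.eq_zero (lowerSpan_le_cosetKer hm hz)

theorem eq_zero_of_mem_sup (hτ : IsCosetTrace n τ) (hC : C.Admissible D) (hd : 0 < level D C)
    {m : ℕ} (hm : m < level D C) {z : Cyc D C (n + 1)}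
    (hz : z ∈ summand D C n none ⊔ lowerSpan D C n m) : τ z = 0 :=
  hτ.eq_zero (sup_le (summand_none_le_cosetKer hC hd n) (lowerSpan_le_cosetKer hm) hz)

theorem map_mul_incl (hτ : IsCosetTrace n τ) (hC : C.Admissible D) (hd : 0 < level D C)
    (z : Cyc D C (n + 1)) (b : Cyc D C n) : τ (z * incl D C n b) = τ z * b := by
  have h : z ∈ LinearMap.eqLocus (τ ∘ₗ LinearMap.mulRight k (incl D C n b))
      (LinearMap.mulRight k b ∘ₗ τ) := by
    have hz : z ∈ cosetSpan D C n := by rw [cosetSpan_eq_top hC hd]; trivial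
    refine Submodule.span_le.2 ?_ hz
    rintro _ ⟨j, a, ha, f, y, rfl⟩
    rw [SetLike.mem_coe, LinearMap.mem_eqLocus]
    simp only [LinearMap.comp_apply, LinearMap.mulRight_apply, mul_assoc]
    rw [← map_mul, hτ j a ha, hτ j a ha]
    split_ifs
    · rw [smul_mul_assoc]
    · rw [zero_mul]
  exact h

theorem map_incl_mul_top (hτ : IsCosetTrace n τ) (hd : 0 < level D C) (b : Cyc D C n) (f : F)
    (y : Cyc D C n) :
    τ (incl D C n b * ((rep D C (n + 1)).x (Fin.last n) ^ (level D C - 1) *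
      ((rep D C (n + 1)).f (Fin.last n) f * incl D C n y))) = D.tr f • (b * y) := by
  have hb : b ∈ ⨆ p, grade D C n p := by rw [iSup_grade]; trivial
  induction hb using Submodule.iSup_induction' with
  | zero => simp only [map_zero, zero_mul, smul_zero]
  | add a b _ _ ha hb => rw [map_add, add_mul, map_add, ha, hb, add_mul, smul_add]
  | mem p b hb =>
    induction f using DirectSum.Decomposition.inductionOn D.grade with
    | zero => simp only [map_zero, zero_mul, mul_zero, zero_smul]
    | @homogeneous q f =>
      rw [← mul_assoc, incl_mul_x_last_pow, mul_assoc, ← mul_assoc (incl D C n b),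
        incl_mul_f_last hb f.2, smul_mul_assoc, mul_smul_comm, map_smul, mul_assoc, ← map_mul,
        hτ.apply_top hd]
      -- The sign matters only where `tr f` can be nonzero, and there `f` is even.
      by_cases hq : q = (D.δ, 0)
      · rw [koszul_even_right _ (by rw [hq]), Int.cast_one, one_smul]
      · rw [D.tr_eq_zero q hq _ f.2, zero_smul, smul_zero]
    | add a b ha hb => simp only [map_add, add_mul, mul_add, add_smul, ha, hb]

/-- Left multiplication by `𝒜_n` respects the summands of the decomposition but not the individual
coset generators, so linearity is checked on the former. -/
theorem map_incl_mul (hτ : IsCosetTrace n τ) (hC : C.Admissible D) (hd : 0 < level D C)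
    (b : Cyc D C n) (z : Cyc D C (n + 1)) : τ (incl D C n b * z) = b * τ z := by
  have h : z ∈ LinearMap.eqLocus (τ ∘ₗ LinearMap.mulLeft k (incl D C n b))
      (LinearMap.mulLeft k b ∘ₗ τ) := by
    have hz : z ∈ ⨆ i, summand D C n i := by rw [iSup_summand hC hd]; trivial
    have hτ' := hτ.isTrace hC hd
    suffices h : ⨆ i, summand D C n i ≤ LinearMap.eqLocus
      (τ ∘ₗ LinearMap.mulLeft k (incl D C n b)) (LinearMap.mulLeft k b ∘ₗ τ) from h hz
    clear hz
    refine iSup_le ?_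
    rintro (_ | a) z hz
    · rw [LinearMap.mem_eqLocus, LinearMap.comp_apply, LinearMap.comp_apply,
        LinearMap.mulLeft_apply, LinearMap.mulLeft_apply,
        hτ'.swap _ (incl_mul_summand_none b hz), hτ'.swap z hz, mul_zero]
    · refine Submodule.span_le.2 ?_ hz
      rintro _ ⟨f, y, rfl⟩
      rw [SetLike.mem_coe, LinearMap.mem_eqLocus, LinearMap.comp_apply, LinearMap.comp_apply,
        LinearMap.mulLeft_apply, LinearMap.mulLeft_apply, mul_assoc]
      change τ (_ * ((rep D C (n + 1)).x (Fin.last n) ^ a.val *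
        ((rep D C (n + 1)).f (Fin.last n) f * incl D C n y))) = b * τ
        ((rep D C (n + 1)).x (Fin.last n) ^ a.val *
        ((rep D C (n + 1)).f (Fin.last n) f * incl D C n y))
      by_cases ha : a.val + 1 < level D C
      · have h1 : (rep D C (n + 1)).x (Fin.last n) ^ a.val *
            ((rep D C (n + 1)).f (Fin.last n) f * incl D C n y) ∈ lowerSpan D C n (a.val + 1) :=
          Submodule.subset_span ⟨a, by omega, f, y, rfl⟩
        rw [hτ.eq_zero_of_mem_lowerSpan ha h1,
          hτ.eq_zero_of_mem_lowerSpan ha (incl_mul_lowerSpan b h1), mul_zero]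
      · have ha' : a.val = level D C - 1 := by omega
        rw [ha', hτ.map_incl_mul_top hd, hτ.apply_top hd, mul_smul_comm]
  exact h

/-- The form of `hP` covers two cases together: degrees from which `d δ` can be subtracted, and
lower degrees, where there is no condition and `P` may be zero. -/
theorem apply_mem (hτ : IsCosetTrace n τ) (hC : C.Admissible D) (hd : 0 < level D C)
    {p : ℕ × ZMod 2} {P : Submodule k (Cyc D C n)}
    (hP : ∀ r, p = r + (level D C * D.δ, 0) → grade D C n r ≤ P) {z : Cyc D C (n + 1)}
    (hz : z ∈ grade D C (n + 1) p) : τ z ∈ P := by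
  suffices h : fullPart D C n p ≤ P.comap τ from h (grade_le_fullPart hC hd n p hz)
  refine sup_le (Submodule.span_le.2 ?_) (Submodule.span_le.2 ?_)
  · rintro _ ⟨a, ha, q, f, hf, r, y, hy, rfl, rfl⟩
    have h1 := hτ (Fin.last n) a ha f y
    rw [coset_last, map_one, one_mul] at h1
    rw [SetLike.mem_coe, Submodule.mem_comap, h1]
    split_ifs with h
    · by_cases hq : q = (D.δ, 0)
      · refine Submodule.smul_mem _ _ (hP r ?_ hy)
        rw [hq, ← h.2, add_comm _ r, add_mul, one_mul]
        rfl
      · rw [D.tr_eq_zero q hq f hf, zero_smul]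
        exact Submodule.zero_mem _
    · exact Submodule.zero_mem _
  · rintro _ ⟨i, hi, r, y, hy, r', y', hy', rfl, rfl⟩
    have h1 : τ (incl D C n y * ((rep D C (n + 1)).perm (Equiv.swap i.castSucc (Fin.last n)) *
        incl D C n y')) = 0 := (hτ.isTrace hC hd).swap _
      (Submodule.subset_span ⟨i, hi, y, y', (mul_assoc _ _ _).symm⟩)
    rw [SetLike.mem_coe, Submodule.mem_comap, h1]
    exact Submodule.zero_mem _

theorem map_grade (hτ : IsCosetTrace n τ) (hC : C.Admissible D) (hd : 0 < level D C)
    {p : ℕ × ZMod 2} {z : Cyc D C (n + 1)}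
    (hz : z ∈ grade D C (n + 1) (p + (level D C * D.δ, 0))) : τ z ∈ grade D C n p := by
  refine hτ.apply_mem hC hd (fun r hr => ?_) hz
  rw [Prod.ext_iff] at hr
  simp only [Prod.fst_add, Prod.snd_add, add_zero] at hr
  have : p = r := Prod.ext (by omega) hr.2
  rw [this]

theorem map_grade_low (hτ : IsCosetTrace n τ) (hC : C.Admissible D) (hd : 0 < level D C)
    {p : ℕ × ZMod 2} (hp : p.1 < level D C * D.δ) {z : Cyc D C (n + 1)}
    (hz : z ∈ grade D C (n + 1) p) : τ z = 0 := by
  refine (Submodule.mem_bot k).1 (hτ.apply_mem hC hd (fun r hr => ?_) hz)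
  rw [hr, Prod.fst_add] at hp
  exact absurd hp (by simp)

end IsCosetTrace

theorem incl_injective (hC : C.Admissible D) (hd : 0 < level D C) (n : ℕ) :
    Function.Injective (incl D C n) := by
  obtain ⟨τ, hτ⟩ := exists_isCosetTrace hC n
  rw [injective_iff_map_eq_zero]
  intro y hy
  -- Any `b^∨ b` serves; a basis element exists because `F` is not zero.
  obtain ⟨f, hf⟩ : ∃ f, D.tr f = 1 := by
    obtain ⟨ε, hε⟩ := D.isGreatest.1
    have hr : Nonempty (Fin D.rank) := by
      by_contra h
      rw [not_nonempty_iff] at h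
      have := D.basis.repr.toEquiv.subsingleton
      exact hε (Subsingleton.elim _ _)
    exact ⟨_, (D.tr_dualBasis_mul hr.some hr.some).trans (if_pos rfl)⟩
  have := hτ.apply_top hd f y
  rwa [hy, mul_zero, mul_zero, map_zero, hf, one_smul, eq_comm] at this

end Cyc

end AffineWreath

/-! ### Directness of the sum and dual bases -/

namespace AffineWreath

open AffineWreath.Affine

variable {k F : Type*} [CommRing k] [Ring F] [Algebra k F] {D : FrobeniusSuperalgebra k F}

theorem FrobeniusSuperalgebra.exists_nakayama_pow_inv (hfin : IsOfFinOrder D.nakayama) (m : ℕ) :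
    ∃ K, ∀ f, (D.nakayama ^ m) ((D.nakayama ^ K) f) = f := by
  -- With this exponent the powers combine to `ψ^(θ m)`, the identity; the inverse is thus itself a
  -- power of `ψ` and preserves homogeneity.
  refine ⟨m * (orderOf D.nakayama - 1), fun f => ?_⟩
  have h := hfin.orderOf_pos
  rw [← Module.End.mul_apply, ← pow_add]
  have e : m + m * (orderOf D.nakayama - 1) = orderOf D.nakayama * m := by
    obtain ⟨t, ht⟩ := Nat.exists_eq_add_of_le' h
    rw [ht, Nat.add_sub_cancel]
    ring
  rw [e, pow_mul, pow_orderOf_eq_one, one_pow, Module.End.one_apply]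

namespace Cyc

variable {C : CycParam F} {n : ℕ}

theorem exists_eq_sum_of_mem_summand {a : Fin (level D C)} {z : Cyc D C (n + 1)}
    (hz : z ∈ summand D C n (some a)) : ∃ y : Fin D.rank → Cyc D C n,
      z = ∑ b, (rep D C (n + 1)).x (Fin.last n) ^ a.val *
        ((rep D C (n + 1)).f (Fin.last n) (D.basis b) * incl D C n (y b)) := by
  induction hz using Submodule.span_induction with
  | mem z hz =>
    obtain ⟨f, y, rfl⟩ := hz
    refine ⟨fun b => D.basis.repr f b • y, ?_⟩
    have h : (rep D C (n + 1)).f (Fin.last n) f =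
        ∑ b, D.basis.repr f b • (rep D C (n + 1)).f (Fin.last n) (D.basis b) := by
      conv_lhs => rw [← D.basis.sum_repr f]
      simp only [map_sum, map_smul]
    change _ * (rep D C (n + 1)).f (Fin.last n) f * _ = _
    rw [h, mul_assoc, Finset.sum_mul, Finset.mul_sum]
    refine Finset.sum_congr rfl fun b _ => ?_
    rw [map_smul, smul_mul_assoc, mul_smul_comm, mul_smul_comm, mul_smul_comm]
    rfl
  | zero => exact ⟨0, by simp⟩
  | add z w _ _ hz hw =>
    obtain ⟨y, rfl⟩ := hz
    obtain ⟨y', rfl⟩ := hw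
    exact ⟨y + y', by simp only [Pi.add_apply, map_add, mul_add, Finset.sum_add_distrib]⟩
  | smul c z _ hz =>
    obtain ⟨y, rfl⟩ := hz
    refine ⟨c • y, ?_⟩
    simp only [Pi.smul_apply, map_smul, mul_smul_comm, Finset.smul_sum]

theorem f_mul_x_pow_mul_f_mul (m : ℕ) (f g : F) (z : Cyc D C (n + 1)) :
    (rep D C (n + 1)).f (Fin.last n) f * ((rep D C (n + 1)).x (Fin.last n) ^ m *
      ((rep D C (n + 1)).f (Fin.last n) g * z)) =
    (rep D C (n + 1)).x (Fin.last n) ^ m *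
      ((rep D C (n + 1)).f (Fin.last n) ((D.nakayama ^ m) f * g) * z) := by
  rw [← mul_assoc, AffineRep.f_x_pow_same, map_mul]
  simp only [mul_assoc]

/-- The factor `x^{d-1-a}` lifts the element to the top exponent. Multiplying by `ψ^K(b^∨)`, which
becomes `b^∨` after crossing `x^{d-1}`, then extracts the coefficient of `b`. -/
theorem IsCosetTrace.eq_zero_of_mem_summand {τ : Cyc D C (n + 1) →ₗ[k] Cyc D C n}
    (hτ : IsCosetTrace n τ) (hfin : IsOfFinOrder D.nakayama) {a : Fin (level D C)}
    {z : Cyc D C (n + 1)} (hz : z ∈ summand D C n (some a))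
    (h : ∀ f, τ ((rep D C (n + 1)).f (Fin.last n) f *
      ((rep D C (n + 1)).x (Fin.last n) ^ (level D C - 1 - a.val) * z)) = 0) : z = 0 := by
  obtain ⟨y, rfl⟩ := exists_eq_sum_of_mem_summand hz
  obtain ⟨K, hK⟩ := FrobeniusSuperalgebra.exists_nakayama_pow_inv hfin (level D C - 1)
  have ha := a.isLt
  refine Finset.sum_eq_zero fun b _ => ?_
  have h1 := h ((D.nakayama ^ K) (D.dualBasis b))
  rw [Finset.mul_sum, Finset.mul_sum, map_sum, Finset.sum_eq_single b] at h1
  · rw [← mul_assoc (_ ^ _), ← pow_add, Nat.sub_add_cancel (by omega), f_mul_x_pow_mul_f_mul,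
      hK, hτ.apply_top (by omega), D.tr_dualBasis_mul, if_pos rfl, one_smul] at h1
    rw [h1, map_zero, mul_zero, mul_zero]
  · intro c _ hc
    rw [← mul_assoc (_ ^ _), ← pow_add, Nat.sub_add_cancel (by omega), f_mul_x_pow_mul_f_mul,
      hK, hτ.apply_top (by omega), D.tr_dualBasis_mul, if_neg hc.symm, zero_smul]
  · exact fun hb => absurd (Finset.mem_univ b) hb

theorem isInternal_summand (hC : C.Admissible D) (hd : 0 < level D C)
    (hfin : IsOfFinOrder D.nakayama) (n : ℕ) : DirectSum.IsInternal (summand D C n) := by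
  obtain ⟨τ, hτ⟩ := exists_isCosetTrace hC n
  refine DirectSum.isInternal_submodule_of_iSupIndep_of_iSup_eq_top ?_ (iSup_summand hC hd n)
  rw [iSupIndep_iff_finsetSum_eq_zero_imp_eq_zero]
  intro s v hv hs
  -- Downward induction on `a`, starting at `a = d - 1` with `m = 0`. After multiplication by
  -- `x^{d-1-a}` the smaller exponents and the summand `none` have trace zero, and the larger
  -- exponents are already known to vanish.
  have key : ∀ m, ∀ a : Fin (level D C), some a ∈ s → level D C = a.val + 1 + m →
      v (some a) = 0 := by
    intro m
    induction m using Nat.strong_induction_on with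
    | _ m ih =>
      intro a ha hm
      refine hτ.eq_zero_of_mem_summand hfin (hv _ ha) fun f => ?_
      have h1 := congrArg (fun z => τ ((rep D C (n + 1)).f (Fin.last n) f *
        ((rep D C (n + 1)).x (Fin.last n) ^ (level D C - 1 - a.val) * z))) hs
      simp only [mul_zero, map_zero] at h1
      rw [Finset.mul_sum, Finset.mul_sum, map_sum, Finset.sum_eq_single (some a)] at h1
      · exact h1
      · rintro (_ | c) hc hne
        · have h2 := x_pow_mul_summand_none (level D C - 1 - a.val) (hv _ hc)
          obtain ⟨z₁, hz₁, z₂, hz₂, h3⟩ := Submodule.mem_sup.1 h2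
          rw [← h3, mul_add]
          exact hτ.eq_zero_of_mem_sup hC hd (by omega) (Submodule.add_mem_sup
            (f_mul_summand_none f hz₁) (f_mul_lowerSpan f hz₂))
        · have hca : c.val ≠ a.val := fun h => hne (by rw [Fin.ext h])
          have hcl := c.isLt
          rcases lt_or_gt_of_ne hca with h | h
          · have h2 : v (some c) ∈ lowerSpan D C n (c.val + 1) := by
              refine Submodule.span_le.2 ?_ (hv _ hc)
              rintro _ ⟨g, y, rfl⟩
              rw [mul_assoc]
              exact Submodule.subset_span ⟨c, by omega, g, y, rfl⟩
            exact hτ.eq_zero_of_mem_lowerSpan (by omega)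
              (f_mul_lowerSpan f (x_pow_mul_lowerSpan _ h2))
          · rw [ih (level D C - 1 - c.val) (by omega) c hc (by omega), mul_zero, mul_zero, map_zero]
      · exact fun h => absurd ha h
  have key' : ∀ a : Fin (level D C), some a ∈ s → v (some a) = 0 := fun a ha =>
    key (level D C - 1 - a.val) a ha (by have := a.isLt; omega)
  rintro (_ | a) ha
  · rw [Finset.sum_eq_single_of_mem none ha] at hs
    · exact hs
    · rintro (_ | a) ha hne
      · exact absurd rfl hne
      · exact key' a ha
  · exact key' a ha

variable (D C) in
/-- The index set of the dual bases. -/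
abbrev DualIndex (n : ℕ) : Type := Fin (n + 1) × Fin (level D C) × Fin D.rank

variable (D C) in
/-- The basis element `(j, n+1) x_{n+1}^a b_{n+1}`. -/
noncomputable def basisElt (n : ℕ) (J : DualIndex D C n) : Cyc D C (n + 1) :=
  (rep D C (n + 1)).perm (coset J.1) * ((rep D C (n + 1)).x (Fin.last n) ^ J.2.1.val *
    (rep D C (n + 1)).f (Fin.last n) (D.basis J.2.2))

variable (D C) in
/-- The degree of a basis element. -/
noncomputable def basisDeg (n : ℕ) (J : DualIndex D C n) : ℕ × ZMod 2 :=
  (J.2.1.val * D.δ, 0) + D.deg J.2.2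

variable (D C) in
/-- The degree of a dual basis element. -/
noncomputable def dualEltDeg (n : ℕ) (J : DualIndex D C n) : ℕ × ZMod 2 :=
  ((level D C - 1 - J.2.1.val) * D.δ, 0) + D.dualDeg J.2.2

theorem basisElt_mem_grade (J : DualIndex D C n) :
    basisElt D C n J ∈ grade D C (n + 1) (basisDeg D C n J) := by
  have := mul_mem_grade (perm_mem_grade (D := D) (C := C) (coset J.1))
    (mul_mem_grade (x_pow_mem_grade (Fin.last n) J.2.1.val)
      (f_mem_grade (Fin.last n) (D.basis_mem J.2.2)))
  rwa [zero_add] at this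

theorem basisDeg_add_dualEltDeg (J : DualIndex D C n) :
    basisDeg D C n J + dualEltDeg D C n J = (level D C * D.δ, 0) := by
  have h := J.2.1.isLt
  rw [basisDeg, dualEltDeg, add_add_add_comm, D.deg_add_dualDeg, Prod.mk_add_mk, Prod.mk_add_mk,
    ← add_mul, ← Nat.succ_mul]
  simp only [add_zero]
  congr 2
  omega

variable (D C) in
/-- The map `y ↦ ∑ (j, n+1) x_{n+1}^a b_{n+1} y_{j,a,b}`. -/
noncomputable def basisSum (n : ℕ) :
    (DualIndex D C n → Cyc D C n) →ₗ[k] Cyc D C (n + 1) :=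
  ∑ J, LinearMap.mulLeft k (basisElt D C n J) ∘ₗ (incl D C n).toLinearMap ∘ₗ LinearMap.proj J

theorem basisSum_apply (y : DualIndex D C n → Cyc D C n) :
    basisSum D C n y = ∑ J, basisElt D C n J * incl D C n (y J) := by
  simp [basisSum, LinearMap.sum_apply]

theorem basisSum_surjective (hC : C.Admissible D) (hd : 0 < level D C) (n : ℕ) :
    Function.Surjective (basisSum D C n) := by
  classical
  rw [← LinearMap.range_eq_top, eq_top_iff, ← cosetSpan_eq_top hC hd n]
  refine Submodule.span_le.2 ?_
  rintro _ ⟨j, a, ha, f, y, rfl⟩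
  have h : (rep D C (n + 1)).f (Fin.last n) f =
      ∑ b, D.basis.repr f b • (rep D C (n + 1)).f (Fin.last n) (D.basis b) := by
    conv_lhs => rw [← D.basis.sum_repr f]
    simp only [map_sum, map_smul]
  rw [SetLike.mem_coe, h, Finset.sum_mul, Finset.mul_sum, Finset.mul_sum]
  refine Submodule.sum_mem _ fun b _ => ?_
  rw [smul_mul_assoc, mul_smul_comm, mul_smul_comm]
  refine Submodule.smul_mem _ _ ⟨Pi.single (j, ⟨a, ha⟩, b) y, ?_⟩
  rw [basisSum_apply, Finset.sum_eq_single (j, ⟨a, ha⟩, b)]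
  · rw [Pi.single_eq_same, basisElt]
    simp only [mul_assoc]
  · intro J _ hJ
    rw [Pi.single_eq_of_ne hJ, map_zero, mul_zero]
  · exact fun h => absurd (Finset.mem_univ _) h

/-- Finiteness over the commutative ring `k` is what later permits passing from surjectivity to
injectivity. -/
theorem module_finite (hC : C.Admissible D) (hd : 0 < level D C) (n : ℕ) :
    Module.Finite k (Cyc D C n) := by
  induction n with
  | zero =>
    refine Module.Finite.of_surjective (Algebra.linearMap k (Cyc D C 0)) fun z => ?_
    induction z using induction_gen with
    | x i => exact i.elim0
    | f i p a _ => exact i.elim0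
    | perm π => exact ⟨1, by rw [Subsingleton.elim π 1]; simp⟩
    | algebraMap r => exact ⟨r, rfl⟩
    | add a b ha hb =>
      obtain ⟨a, rfl⟩ := ha
      obtain ⟨b, rfl⟩ := hb
      exact ⟨a + b, map_add _ _ _⟩
    | mul a b ha hb =>
      obtain ⟨a, rfl⟩ := ha
      obtain ⟨b, rfl⟩ := hb
      exact ⟨a * b, by simp⟩
  | succ n ih => exact Module.Finite.of_surjective _ (basisSum_surjective hC hd n)

variable (D C) in
/-- The element `f_{n+1} x_{n+1}^(d-1-a) (j, n+1)` for `f = ψ^K(b^∨)`. -/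
noncomputable def preDual (n K : ℕ) (I : DualIndex D C n) : Cyc D C (n + 1) :=
  (rep D C (n + 1)).f (Fin.last n) ((D.nakayama ^ K) (D.dualBasis I.2.2)) *
    ((rep D C (n + 1)).x (Fin.last n) ^ (level D C - 1 - I.2.1.val) *
      (rep D C (n + 1)).perm (coset I.1))

theorem preDual_mem_grade (K : ℕ) (I : DualIndex D C n) :
    preDual D C n K I ∈ grade D C (n + 1) (dualEltDeg D C n I) := by
  have := mul_mem_grade (f_mem_grade (D := D) (C := C) (Fin.last n)
    (D.nakayama_pow_mem K (D.dualBasis_mem I.2.2)))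
    (mul_mem_grade (x_pow_mem_grade (Fin.last n) (level D C - 1 - I.2.1.val))
      (perm_mem_grade (coset I.1)))
  rwa [add_zero, add_comm (D.dualDeg _)] at this

/-- For equal cosets the exponent of `x` is at most `d - 1`, with equality only for equal powers,
and then `tr(b^∨ c)` decides. For different cosets the permutation in between lies outside `S_n`, so
only elements killed by the trace occur. The Gram matrix is therefore unitriangular with respect to
`a`. -/
theorem IsCosetTrace.apply_preDual_mul_basisElt {τ : Cyc D C (n + 1) →ₗ[k] Cyc D C n}
    (hτ : IsCosetTrace n τ) (hC : C.Admissible D) (hd : 0 < level D C) {K : ℕ}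
    (hK : ∀ f, (D.nakayama ^ (level D C - 1)) ((D.nakayama ^ K) f) = f)
    {I J : DualIndex D C n} (h : J.2.1.val ≤ I.2.1.val) :
    τ (preDual D C n K I * basisElt D C n J) = if I = J then 1 else 0 := by
  obtain ⟨i, a', b'⟩ := I
  obtain ⟨j, a, b⟩ := J
  change a.val ≤ a'.val at h
  have ha := a'.isLt
  have e : preDual D C n K (i, a', b') * basisElt D C n (j, a, b) =
      (rep D C (n + 1)).f (Fin.last n) ((D.nakayama ^ K) (D.dualBasis b')) *
        ((rep D C (n + 1)).x (Fin.last n) ^ (level D C - 1 - a'.val) *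
        ((rep D C (n + 1)).perm (coset i * coset j) *
        ((rep D C (n + 1)).x (Fin.last n) ^ a.val *
        ((rep D C (n + 1)).f (Fin.last n) (D.basis b) * incl D C n 1)))) := by
    rw [preDual, basisElt, map_mul, map_one, mul_one]
    simp only [mul_assoc]
  rw [e]
  by_cases hij : i = j
  · subst hij
    rw [coset_mul_self, map_one, one_mul, ← mul_assoc (_ ^ _), ← pow_add, f_mul_x_pow_mul_f_mul]
    rcases h.lt_or_eq with h | h
    · rw [if_neg fun h' => h.ne (by simp only [Prod.mk.injEq] at h'; rw [h'.2.1])]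
      exact hτ.eq_zero_of_mem_lowerSpan (m := level D C - 1) (by omega)
        (Submodule.subset_span ⟨_, by omega, _, _, rfl⟩)
    · rw [h, Nat.sub_add_cancel (by omega), hK, hτ.apply_top hd, D.tr_dualBasis_mul]
      have ha' : a' = a := Fin.ext h.symm
      by_cases hb : b' = b
      · rw [if_pos hb, if_pos (by rw [ha', hb]), one_smul]
      · rw [if_neg hb, if_neg (by simp [hb]), zero_smul]
  · rw [if_neg (by simp [hij])]
    have h1 : (coset i * coset j) (Fin.last n) ≠ Fin.last n := by
      rw [Equiv.Perm.mul_apply, coset_apply_last]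
      intro h
      exact hij ((coset i).injective (h.trans (coset_self i).symm)).symm
    have h2 := x_pow_mul_perm_mul_mem h1 (level D C - 1 - a'.val) a.val (D.basis b)
      (1 : Cyc D C n)
    obtain ⟨z₁, hz₁, z₂, hz₂, h3⟩ := Submodule.mem_sup.1 h2
    rw [← h3, mul_add]
    exact hτ.eq_zero_of_mem_sup hC hd (by omega) (Submodule.add_mem_sup
      (f_mul_summand_none _ hz₁) (f_mul_lowerSpan _ hz₂))

theorem IsCosetTrace.exists_dual {τ : Cyc D C (n + 1) →ₗ[k] Cyc D C n}
    (hτ : IsCosetTrace n τ) (hC : C.Admissible D) (hd : 0 < level D C)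
    (hfin : IsOfFinOrder D.nakayama) (I : DualIndex D C n) :
    ∃ v ∈ grade D C (n + 1) (dualEltDeg D C n I),
      ∀ J, τ (v * basisElt D C n J) = if I = J then 1 else 0 := by
  obtain ⟨K, hK⟩ := FrobeniusSuperalgebra.exists_nakayama_pow_inv hfin (level D C - 1)
  induction h : level D C - I.2.1.val using Nat.strong_induction_on generalizing I with
  | _ m ih =>
    have ih' : ∀ J : DualIndex D C n, ∃ v ∈ grade D C (n + 1) (dualEltDeg D C n J),
        I.2.1.val < J.2.1.val →
          ∀ J', τ (v * basisElt D C n J') = if J = J' then 1 else 0 := by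
      intro J
      have hJ := J.2.1.isLt
      by_cases hIJ : I.2.1.val < J.2.1.val
      · obtain ⟨v, hv, hv'⟩ := ih (level D C - J.2.1.val) (by omega) J rfl
        exact ⟨v, hv, fun _ => hv'⟩
      · exact ⟨0, Submodule.zero_mem _, fun h => absurd h hIJ⟩
    choose w hw hw' using ih'
    -- Back substitution: the entries for larger exponents are removed with the dual elements
    -- already found there.
    refine ⟨preDual D C n K I - ∑ J with I.2.1.val < J.2.1.val,
      incl D C n (τ (preDual D C n K I * basisElt D C n J)) * w J, ?_, fun J => ?_⟩
    · refine Submodule.sub_mem _ (preDual_mem_grade K I) (Submodule.sum_mem _ fun J _ => ?_)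
      have h1 := mul_mem_grade (preDual_mem_grade K I) (basisElt_mem_grade J)
      have h2 := basisDeg_add_dualEltDeg J
      -- Below degree `d δ` the coefficient vanishes; otherwise its degree is exactly what makes the
      -- correction homogeneous of the degree of `preDual`.
      by_cases hlt : (dualEltDeg D C n I + basisDeg D C n J).1 < level D C * D.δ
      · rw [hτ.map_grade_low hC hd hlt h1, map_zero, zero_mul]
        exact Submodule.zero_mem _
      · obtain ⟨l, hl⟩ : ∃ l, dualEltDeg D C n I + basisDeg D C n J =
            l + (level D C * D.δ, 0) :=
          ⟨((dualEltDeg D C n I + basisDeg D C n J).1 - level D C * D.δ,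
            (dualEltDeg D C n I + basisDeg D C n J).2), Prod.ext (by simp; simp at hlt; omega)
            (by simp)⟩
        rw [hl] at h1
        have h3 := mul_mem_grade (incl_mem_grade (hτ.map_grade hC hd h1)) (hw J)
        have h4 : l + dualEltDeg D C n J = dualEltDeg D C n I := by
          rw [← h2, add_comm _ (basisDeg D C n J), ← add_assoc, add_right_comm,
            add_comm (basisDeg D C n J)] at hl
          exact (add_right_cancel hl).symm
        rwa [h4] at h3
    · rw [sub_mul, map_sub, Finset.sum_mul, map_sum]
      have h1 : ∀ J' ∈ Finset.univ.filter fun J' : DualIndex D C n => I.2.1.val < J'.2.1.val,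
          τ (incl D C n (τ (preDual D C n K I * basisElt D C n J')) * w J' * basisElt D C n J) =
            if J' = J then τ (preDual D C n K I * basisElt D C n J) else 0 := by
        intro J' hJ'
        rw [Finset.mem_filter] at hJ'
        rw [mul_assoc, hτ.map_incl_mul hC hd, hw' J' hJ'.2]
        split_ifs with h
        · rw [h, mul_one]
        · rw [mul_zero]
      rw [Finset.sum_congr rfl h1, Finset.sum_ite_eq']
      by_cases hIJ : I.2.1.val < J.2.1.val
      · have hmem : J ∈ Finset.univ.filter fun J' : DualIndex D C n => I.2.1.val < J'.2.1.val :=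
          Finset.mem_filter.2 ⟨Finset.mem_univ _, hIJ⟩
        rw [if_pos hmem, sub_self, if_neg]
        rintro rfl
        exact lt_irrefl _ hIJ
      · rw [if_neg (by simpa using hIJ), sub_zero,
          hτ.apply_preDual_mul_basisElt hC hd hK (not_lt.1 hIJ)]

theorem IsCosetTrace.isFrobeniusExtension {τ : Cyc D C (n + 1) →ₗ[k] Cyc D C n}
    (hτ : IsCosetTrace n τ) (hC : C.Admissible D) (hd : 0 < level D C)
    (hfin : IsOfFinOrder D.nakayama) :
    IsFrobeniusExtension (grade D C (n + 1)) (grade D C n) (incl D C n) τ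
      (level D C * D.δ) where
  map_mul_left := hτ.map_incl_mul hC hd
  map_mul_right := hτ.map_mul_incl hC hd
  map_grade l ε z hz := hτ.map_grade hC hd (p := (l, ε)) (by rwa [Prod.mk_add_mk, add_zero])
  map_grade_low l ε h z hz := hτ.map_grade_low hC hd (p := (l, ε)) h hz
  exists_dual_bases := by
    choose v hv hv' using hτ.exists_dual hC hd hfin
    have hfinite := module_finite hC hd n
    -- Expand `a` in the generators; pairing with `v J` returns the coefficients.
    have h1 : ∀ a, ∑ J, basisElt D C n J * incl D C n (τ (v J * a)) = a := by
      intro a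
      obtain ⟨y, rfl⟩ := basisSum_surjective hC hd n a
      conv_rhs => rw [basisSum_apply]
      refine Finset.sum_congr rfl fun J _ => ?_
      rw [basisSum_apply, Finset.mul_sum, map_sum, Finset.sum_eq_single J]
      · rw [← mul_assoc, hτ.map_mul_incl hC hd, hv', if_pos rfl, one_mul]
      · intro J' _ hJ
        rw [← mul_assoc, hτ.map_mul_incl hC hd, hv', if_neg hJ.symm, zero_mul]
      · exact fun h => absurd (Finset.mem_univ _) h
    let Φ : Cyc D C (n + 1) →ₗ[k] (DualIndex D C n → Cyc D C n) :=
      LinearMap.pi fun J => τ ∘ₗ LinearMap.mulRight k (basisElt D C n J)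
    have hΦ : ∀ y : DualIndex D C n → Cyc D C n, Φ (∑ J, incl D C n (y J) * v J) = y := by
      intro y
      funext J
      change τ ((∑ J, incl D C n (y J) * v J) * basisElt D C n J) = y J
      rw [Finset.sum_mul, map_sum, Finset.sum_eq_single J]
      · rw [mul_assoc, hτ.map_incl_mul hC hd, hv', if_pos rfl, mul_one]
      · intro J' _ hJ
        rw [mul_assoc, hτ.map_incl_mul hC hd, hv', if_neg hJ, mul_zero]
      · exact fun h => absurd (Finset.mem_univ _) h
    -- `Φ` is surjective by the previous identity, and so is its composite with `basisSum`. The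
    -- composite is an endomorphism of a finitely generated `k`-module, hence injective, and
    -- surjectivity of `basisSum` passes injectivity on to `Φ`.
    have hinj : Function.Injective Φ := by
      have hs : Function.Surjective (Φ ∘ₗ basisSum D C n) := by
        intro y
        obtain ⟨y', hy'⟩ := basisSum_surjective hC hd n (∑ J, incl D C n (y J) * v J)
        exact ⟨y', by rw [LinearMap.comp_apply, hy', hΦ]⟩
      have hi := OrzechProperty.injective_of_surjective_endomorphism _ hs
      intro a b hab
      obtain ⟨a, rfl⟩ := basisSum_surjective hC hd n a
      obtain ⟨b, rfl⟩ := basisSum_surjective hC hd n b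
      exact congrArg _ (hi hab)
    -- Both sides have the same image under `Φ`.
    have h2 : ∀ a, ∑ J, incl D C n (τ (a * basisElt D C n J)) * v J = a := fun a =>
      hinj (hΦ fun J => τ (a * basisElt D C n J))
    let E := Fintype.equivFin (DualIndex D C n)
    refine ⟨_, fun i => basisDeg D C n (E.symm i), fun i => dualEltDeg D C n (E.symm i),
      fun i => basisElt D C n (E.symm i), fun i => v (E.symm i), fun i => basisElt_mem_grade _,
      fun i => hv _, fun i => basisDeg_add_dualEltDeg _, fun a => ?_, fun a => ?_⟩
    · exact (Equiv.sum_comp E.symm fun J => basisElt D C n J * incl D C n (τ (v J * a))).trans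
        (h1 a)
    · exact (Equiv.sum_comp E.symm fun J => incl D C n (τ (a * basisElt D C n J)) * v J).trans
        (h2 a)

end Cyc

end AffineWreath
theorem mainTheorem7 {k F : Type*} [CommRing k] [Ring F] [Algebra k F]
    (D : FrobeniusSuperalgebra k F)
    (hk : ringChar k ≠ 2)
    (hfin : IsOfFinOrder D.nakayama)
    (hθ : ¬ ringChar k ∣ D.θ)
    (hdiag : ∃ v : Module.Basis (Fin D.rank) k F, ∀ i, ∃ μ : k, D.nakayama (v i) = μ • v i)
    (C : CycParam F)
    (hdeg : ∀ m ∈ Finset.Icc 1 D.θ, ∀ j ∈ Finset.Icc 1 (C.e m), C.c m j ∈ D.grade (m * D.δ, 0))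
    (hC : ∀ m ∈ Finset.Icc 1 D.θ, ∀ j ∈ Finset.Icc 1 (C.e m), C.c m j ∈ D.fixedTwistedCenter m)
    (hd : 0 < level D C)
    (n : ℕ) :
    Function.Injective (Cyc.incl D C n) ∧
    DirectSum.IsInternal (Cyc.summand D C n) ∧
    (∃! τ : Cyc D C (n + 1) →ₗ[k] Cyc D C n, Cyc.IsTrace D C n τ) ∧
    ∀ τ : Cyc D C (n + 1) →ₗ[k] Cyc D C n, Cyc.IsTrace D C n τ →
      IsFrobeniusExtension (Cyc.grade D C (n + 1)) (Cyc.grade D C n) (Cyc.incl D C n) τ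
        (level D C * D.δ) := by
  have hCA : C.Admissible D := ⟨hdeg, hC⟩
  obtain ⟨τ, hτ⟩ := Cyc.exists_isCosetTrace hCA n
  exact ⟨Cyc.incl_injective hCA hd n, Cyc.isInternal_summand hCA hd hfin n,
    ⟨τ, hτ.isTrace hCA hd, fun τ' hτ' => hτ'.unique hCA hd (hτ.isTrace hCA hd)⟩,
    fun τ' hτ' => (hτ'.isCosetTrace hCA hd).isFrobeniusExtension hCA hd hfin⟩
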